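/- All graphs are finite and simple. A \emph{path in} $G$ is an induced subgraph of $G$ that is a path. For positive integers $\kappa,\lambda$, a \emph{stable strong $(\kappa,\lambda)$-block} in $G$ consists of a stable set $B$ of at least $\kappa$ vertices of $G$ and, for every $2$-subset $\{x,y\}$ of $B$, a set $\mathcal P_{\{x,y\}}$ of at least $\lambda$ pairwise internally disjoint paths in $G$ from $x$ to $y$, such that for all distinct $2$-subsets $\{x,y\},\{x',y'\}$ of $B$ we have $V(\mathcal P_{\{x,y\}})\cap V(\mathcal P_{\{x',y'\}})=\{x,y\}\cap\{x',y'\}$, where $V(\mathcal P)=\bigcup_{P\in\mathcal P}V(P)$. The graph $G$ is \emph{$(\kappa,\lambda)$-separable} if it has no stable strong $(\kappa,\lambda)$-block. An \emph{induced minor} of $G$ is a graph obtained from $G$ by removing vertices and contracting edges (equivalently, $H$ is isomorphic to an induced minor of $G$ if there are pairwise disjoint non-empty sets $X_v\subseteq V(G)$, $v\in V(H)$, each inducing a connected subgraph of $G$, such that for all distinct $u,v\in V(H)$ there is an edge of $G$ between $X_u$ and $X_v$ if and only if $uv\in E(H)$). Let $\mathrm{Bin}_\rho$ be the full binary tree of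 radius $\rho$ (with $2^{\rho+1}-1$ vertices). \textbf{Theorem.} For every positive integer $\sigma$ there is a positive integer $c=c(\sigma)$, and for all positive integers $\rho,\sigma$ there is a non-negative integer $d=d(\rho,\sigma)$, such that for every positive integer $t$, every $K_t$-free graph with no induced minor isomorphic to $\mathrm{Bin}_\rho$ or to $K_{\sigma,\sigma}$ is $(c,t^d)$-separable. -/

import Mathlib

namespace PolySep

/-- Two vertex sets are anticomplete in `G` if they are disjoint and no edge of `G` joins them. -/
def Anticomplete {V : Type*} (G : SimpleGraph V) (X Y : Set V) : Prop :=
  Disjoint X Y ∧ ∀ x ∈ X, ∀ y ∈ Y, ¬ G.Adj x y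

/-- `X` is an induced `H`-model in `G`: the branch sets are pairwise disjoint, nonempty and
connected, those of adjacent vertices of `H` are not anticomplete, and those of distinct
nonadjacent vertices of `H` are anticomplete. -/
structure IsInducedModel {V W : Type*} (H : SimpleGraph W) (G : SimpleGraph V)
    (X : W → Set V) : Prop where
  connected : ∀ w, (G.induce (X w)).Connected
  disjoint : ∀ u v, u ≠ v → Disjoint (X u) (X v)
  adj : ∀ u v, H.Adj u v → ¬ Anticomplete G (X u) (X v)
  not_adj : ∀ u v, u ≠ v → ¬ H.Adj u v → Anticomplete G (X u) (X v)

/-- `G` has an induced minor isomorphic to `H`. -/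
def HasInducedMinor {V W : Type*} (G : SimpleGraph V) (H : SimpleGraph W) : Prop :=
  ∃ X : W → Set V, IsInducedModel H G X

/-- The full binary tree of radius `r`. Its vertices are the binary words of length at most `r`,
the root is the empty word, and the children of `l` are `false :: l` and `true :: l`. -/
def binTree (r : ℕ) : SimpleGraph {l : List Bool // l.length ≤ r} :=
  SimpleGraph.fromRel fun u v => ∃ b : Bool, v.1 = b :: u.1

/-- `P` is a path in `G` from `x` to `y`, in the sense of an induced subgraph of `G` that is a
path with ends `x` and `y`. -/
def IsPathFromTo {V : Type*} (G : SimpleGraph V) (x y : V) (P : G.Subgraph) : Prop :=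
  P.IsInduced ∧ ∃ p : G.Walk x y, p.IsPath ∧ p.toSubgraph = P

/-- The set of all vertices of the paths in a set of paths. -/
def pathVerts {V : Type*} {G : SimpleGraph V} (S : Set G.Subgraph) : Set V :=
  ⋃ P ∈ S, P.verts

/-- `(B, 𝓟)` is a `(k, l)`-block in `G`: `B` has at least `k` vertices, and for every 2-subset
`{x, y}` of `B`, `𝓟 s(x, y)` is a set of at least `l` pairwise internally disjoint paths in `G`
from `x` to `y`. The values of `𝓟` at other unordered pairs play no role. -/
structure IsBlock {V : Type*} (G : SimpleGraph V) (k l : ℕ) (B : Set V)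
    (𝓟 : Sym2 V → Set G.Subgraph) : Prop where
  le_card : (k : ℕ∞) ≤ B.encard
  isPath : ∀ x ∈ B, ∀ y ∈ B, x ≠ y → ∀ P ∈ 𝓟 s(x, y), IsPathFromTo G x y P
  le_card_paths : ∀ x ∈ B, ∀ y ∈ B, x ≠ y → (l : ℕ∞) ≤ (𝓟 s(x, y)).encard
  internally_disjoint : ∀ x ∈ B, ∀ y ∈ B, x ≠ y →
    ∀ P ∈ 𝓟 s(x, y), ∀ Q ∈ 𝓟 s(x, y), P ≠ Q →
      Disjoint (P.verts \ {x, y}) (Q.verts \ {x, y})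

/-- The pair `(B, 𝓟)` is strong: for distinct 2-subsets of `B`, the corresponding path systems
meet only in the common elements of the two subsets. -/
def IsStrong {V : Type*} {G : SimpleGraph V} (B : Set V) (𝓟 : Sym2 V → Set G.Subgraph) : Prop :=
  ∀ x ∈ B, ∀ y ∈ B, ∀ x' ∈ B, ∀ y' ∈ B, x ≠ y → x' ≠ y' → s(x, y) ≠ s(x', y') →
    pathVerts (𝓟 s(x, y)) ∩ pathVerts (𝓟 s(x', y')) = ({x, y} : Set V) ∩ {x', y'}

/-- `G` is `(k, l)`-separable: it has no stable strong `(k, l)`-block. -/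
def IsPairSeparable {V : Type*} (G : SimpleGraph V) (k l : ℕ) : Prop :=
  ¬ ∃ (B : Set V) (𝓟 : Sym2 V → Set G.Subgraph),
    IsBlock G k l B 𝓟 ∧ IsStrong B 𝓟 ∧ G.IsIndepSet B

end PolySep

namespace PolySep

open scoped Classical

universe w

/-! ### Polynomially bounded functions -/

/-! Take a stable strong block with a number of vertices depending only on `σ`. The crucial claim is
that polynomially many internally disjoint paths between two nonadjacent vertices contain any
prescribed constant number with pairwise anticomplete interiors (`exists_anticomplete_interiors`).
Given this for all pairs of block vertices, `NoBiclique.not_many_paths` selects one path per pair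
between two groups of `σ` block vertices so that, with the paths absorbed into one side, a model of
`K_{σ,σ}` results. Only `K_{σ,σ}` matters in this last part, which is why `c` does not depend on
`ρ`.

For the claim, excluding `K_{σ,σ}` makes Ramsey bounds for connected sets polynomial
(`erdos_hajnal`). So if the claim fails, then after deletion of their first interior vertices many
of the paths touch pairwise. This is a state (`IsState`): a connected set `x` with disjoint induced
paths ("rows") starting at neighbours of `x`, whose tails touch pairwise. The heart of the proof,
`grows`, finds in every large state a tree model of radius `D` on boundedly many rows, either with
`x` in its root (`OutX`) or with a root touching all other rows (`OutR`).

The induction on `D` is double. With the result for `D`, boundedly many anticomplete hubs that touch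
`x` and have polynomially many common touching rows give `OutX` of radius `D + 1`
(`Grows.exists_popsWith`): between hubs, the rows contain smaller states centred at hubs, and the
trees found there hang from `x`. An inner induction then raises the radius `e` of `OutR`. Each row
is cut just before it touches a noticeable fraction of some target set. Either many of the cut rows
are anticomplete, and extended by one vertex they serve as hubs and give `OutX`; or many touch
pairwise and form a new state. Repetition yields `σ + 2` mutually anticomplete states
(`exists_chain`), whose trees are joined along one further row (`Chain.exists_outR`).

Trees carry `σ + 2` children at the root because all but few vertices touch fewer than `σ` pairwise
anticomplete connected sets; a new attachment therefore leaves two children untouched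
(`FT.exists_bad`). -/

/-- `f` is bounded by a power of `t` for `t ≥ 2`. -/
def Poly (f : ℕ → ℕ) : Prop := ∃ d, ∀ t, 2 ≤ t → f t ≤ t ^ d

theorem Poly.const (c : ℕ) : Poly fun _ => c :=
  ⟨c, fun _ ht => (Nat.lt_two_pow_self).le.trans (Nat.pow_le_pow_left ht c)⟩

theorem Poly.id : Poly fun t => t := ⟨1, fun t _ => by simp⟩

theorem Poly.mul {f g : ℕ → ℕ} (hf : Poly f) (hg : Poly g) : Poly fun t => f t * g t := by
  obtain ⟨a, ha⟩ := hf
  obtain ⟨b, hb⟩ := hg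
  exact ⟨a + b, fun t ht => by rw [pow_add]; exact Nat.mul_le_mul (ha t ht) (hb t ht)⟩

theorem Poly.pow {f : ℕ → ℕ} (hf : Poly f) (n : ℕ) : Poly fun t => f t ^ n := by
  obtain ⟨a, ha⟩ := hf
  exact ⟨a * n, fun t ht => by rw [pow_mul]; exact Nat.pow_le_pow_left (ha t ht) n⟩

theorem Poly.add {f g : ℕ → ℕ} (hf : Poly f) (hg : Poly g) : Poly fun t => f t + g t := by
  obtain ⟨a, ha⟩ := hf
  obtain ⟨b, hb⟩ := hg
  refine ⟨max a b + 1, fun t ht => ?_⟩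
  have h1 := (ha t ht).trans (Nat.pow_le_pow_right (by lia) (le_max_left a b))
  have h2 := (hb t ht).trans (Nat.pow_le_pow_right (by lia) (le_max_right a b))
  calc f t + g t ≤ t ^ max a b * 2 := by lia
    _ ≤ t ^ (max a b + 1) := by rw [pow_succ]; exact Nat.mul_le_mul_left _ ht

/-! ### Ramsey-type lemmas -/

/-- A maximal `r`-clique has fewer than `q` elements, and every other element is unrelated to one of
its members. A popular such member starts the stable set, and the induction continues among the
elements unrelated to it. For fixed `s` the bound is polynomial in `q`. -/
theorem ramsey_symm {ι : Type*} (r : ι → ι → Prop) (hr : ∀ i j, r i j → r j i) {q : ℕ} (hq : 1 ≤ q)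
    (s : ℕ) (K : Finset ι) (hK : (2 * q) ^ s ≤ K.card) :
    (∃ Q ⊆ K, Q.card = q ∧ ∀ i ∈ Q, ∀ j ∈ Q, i ≠ j → r i j) ∨
    (∃ S ⊆ K, S.card = s ∧ ∀ i ∈ S, ∀ j ∈ S, i ≠ j → ¬ r i j) := by
  induction s generalizing K with
  | zero => exact Or.inr ⟨∅, by simp⟩
  | succ s ih =>
    by_cases hbig : ∃ Q ⊆ K, q ≤ Q.card ∧ ∀ i ∈ Q, ∀ j ∈ Q, i ≠ j → r i j
    · obtain ⟨Q, hQK, hQ, h⟩ := hbig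
      obtain ⟨Q', hQ', hc⟩ := Finset.exists_subset_card_eq hQ
      exact Or.inl ⟨Q', hQ'.trans hQK, hc, fun i hi j hj => h i (hQ' hi) j (hQ' hj)⟩
    push Not at hbig
    let F := K.powerset.filter fun Q => ∀ i ∈ Q, ∀ j ∈ Q, i ≠ j → r i j
    have hF : F.Nonempty := ⟨∅, by simp [F]⟩
    obtain ⟨C, hCF, hmax⟩ := F.exists_max_image Finset.card hF
    simp only [F, Finset.mem_filter, Finset.mem_powerset] at hCF hmax
    have hCq : C.card < q := by
      by_contra hlt
      obtain ⟨i, hi, j, hj, hij, hn⟩ := hbig C hCF.1 (not_lt.1 hlt)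
      exact hn (hCF.2 i hi j hj hij)
    have hcov : ∀ v ∈ K, ∃ c ∈ C, v = c ∨ ¬ r c v := by
      intro v hv
      by_contra hcon
      push Not at hcon
      have hvC : v ∉ C := fun h => (hcon v h).1 rfl
      have := hmax (insert v C) ⟨Finset.insert_subset hv hCF.1, by
        intro i hi j hj hij
        rcases Finset.mem_insert.1 hi with rfl | hi' <;> rcases Finset.mem_insert.1 hj with rfl | hj'
        · exact absurd rfl hij
        · exact hr _ _ (hcon j hj').2
        · exact (hcon i hi').2
        · exact hCF.2 i hi' j hj' hij⟩
      rw [Finset.card_insert_of_notMem hvC] at this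
      lia
    choose! g hgC hg using hcov
    have hpos : 0 < (2 * q) ^ s := by positivity
    have hlt : C.card * (2 * (2 * q) ^ s - 1) < K.card := by
      have h1 : C.card * (2 * (2 * q) ^ s - 1) ≤ (q - 1) * (2 * (2 * q) ^ s) :=
        Nat.mul_le_mul (by lia) (by lia)
      have h2 : (q - 1) * (2 * (2 * q) ^ s) < q * (2 * (2 * q) ^ s) :=
        Nat.mul_lt_mul_of_pos_right (by lia) (by lia)
      have h3 : q * (2 * (2 * q) ^ s) = (2 * q) ^ (s + 1) := by ring
      lia
    obtain ⟨c, hc, hfib⟩ := Finset.exists_lt_card_fiber_of_mul_lt_card_of_maps_to hgC hlt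
    set K' := (K.filter fun v => g v = c).erase c
    have hK' : (2 * q) ^ s ≤ K'.card := by
      have := Finset.pred_card_le_card_erase (s := K.filter fun v => g v = c) (a := c)
      simp only [K']
      lia
    have hsub : K' ⊆ K := (Finset.erase_subset _ _).trans (Finset.filter_subset _ _)
    rcases ih K' hK' with ⟨Q, hQ, h⟩ | ⟨S, hS, hcard, h⟩
    · exact Or.inl ⟨Q, hQ.trans hsub, h⟩
    · have hcS : c ∉ S := fun h => by simpa [K'] using hS h
      have hcn : ∀ v ∈ S, ¬ r c v := by
        intro v hv
        have hv' := hS hv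
        simp only [K', Finset.mem_erase, Finset.mem_filter] at hv'
        have := hg v hv'.2.1
        rw [hv'.2.2] at this
        exact this.resolve_left hv'.1
      refine Or.inr ⟨insert c S, Finset.insert_subset (hCF.1 hc) (hS.trans hsub), by
        rw [Finset.card_insert_of_notMem hcS, hcard], ?_⟩
      intro i hi j hj hij
      rcases Finset.mem_insert.1 hi with rfl | hi' <;> rcases Finset.mem_insert.1 hj with rfl | hj'
      · exact absurd rfl hij
      · exact hcn j hj'
      · exact fun h => hcn i hi' (hr _ _ h)
      · exact h i hi' j hj' hij

theorem ramsey_lt (p : ℕ → ℕ → Prop) {q : ℕ} (hq : 1 ≤ q) (s : ℕ) (K : Finset ℕ)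
    (hK : (2 * q) ^ s ≤ K.card) :
    (∃ Q ⊆ K, Q.card = q ∧ ∀ i ∈ Q, ∀ j ∈ Q, i < j → p i j) ∨
    (∃ S ⊆ K, S.card = s ∧ ∀ i ∈ S, ∀ j ∈ S, i < j → ¬ p i j) := by
  rcases ramsey_symm (fun i j => (i < j ∧ p i j) ∨ (j < i ∧ p j i)) (fun i j h => h.symm) hq s K hK
    with ⟨Q, hQ, hc, h⟩ | ⟨S, hS, hc, h⟩
  · refine Or.inl ⟨Q, hQ, hc, fun i hi j hj hij => ?_⟩
    rcases h i hi j hj hij.ne with h | h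
    · exact h.2
    · lia
  · exact Or.inr ⟨S, hS, hc, fun i hi j hj hij hp => h i hi j hj hij.ne (Or.inl ⟨hij, hp⟩)⟩

/-- If `p` has no `s`-clique, then it has a large stable set. -/
theorem exists_stable_lt (p : ℕ → ℕ → Prop) {a : ℕ} (ha : 1 ≤ a) (s : ℕ) (K : Finset ℕ)
    (hK : (2 * a) ^ s ≤ K.card)
    (h : ¬ ∃ Q ⊆ K, Q.card = s ∧ ∀ i ∈ Q, ∀ j ∈ Q, i < j → p i j) :
    ∃ S ⊆ K, S.card = a ∧ ∀ i ∈ S, ∀ j ∈ S, i < j → ¬ p i j := by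
  rcases ramsey_lt (fun i j => ¬ p i j) ha s K hK with h' | ⟨S, hS, hc, h'⟩
  · exact h'
  · exact absurd ⟨S, hS, hc, fun i hi j hj hij => not_not.1 (h' i hi j hj hij)⟩ h

def multiRamseyBound (s a : ℕ) : ℕ → ℕ
  | 0 => a
  | n + 1 => (2 * multiRamseyBound s a n) ^ s

theorem one_le_multiRamseyBound {s a : ℕ} (ha : 1 ≤ a) (n : ℕ) : 1 ≤ multiRamseyBound s a n := by
  cases n with
  | zero => exact ha
  | succ n =>
    have := one_le_multiRamseyBound (s := s) ha n
    exact Nat.one_le_pow _ _ (by lia)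

/-- The relations are made stable one after the other; for fixed `s` and `n` the bound stays
polynomial in `a`. -/
theorem multi_ramsey {s a : ℕ} (ha : 1 ≤ a) (n : ℕ) (p : ℕ → ℕ → ℕ → Prop) (K : Finset ℕ)
    (hK : multiRamseyBound s a n ≤ K.card)
    (h : ∀ l < n, ¬ ∃ Q ⊆ K, Q.card = s ∧ ∀ i ∈ Q, ∀ j ∈ Q, i < j → p l i j) :
    ∃ S ⊆ K, S.card = a ∧ ∀ l < n, ∀ i ∈ S, ∀ j ∈ S, i < j → ¬ p l i j := by
  induction n generalizing K with
  | zero =>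
    obtain ⟨S, hS, hc⟩ := Finset.exists_subset_card_eq hK
    exact ⟨S, hS, hc, by simp⟩
  | succ n ih =>
    obtain ⟨K', hK', hc, h'⟩ := exists_stable_lt (p n) (one_le_multiRamseyBound (s := s) ha n) s K hK
      (h n (by lia))
    obtain ⟨S, hS, hSc, hS'⟩ := ih K' hc.ge fun l hl ⟨Q, hQ, hh⟩ =>
      h l (by lia) ⟨Q, hQ.trans hK', hh⟩
    refine ⟨S, hS.trans hK', hSc, fun l hl i hi j hj hij => ?_⟩
    rcases Nat.lt_succ_iff_lt_or_eq.1 hl with hl | rfl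
    · exact hS' l hl i hi j hj hij
    · exact h' i (hS hi) j (hS hj) hij

/-- The first summand bounds a union of `(2q)^σ` stable sets; the second bounds the number of its
`σ`-subsets, times the Ramsey number `(2q)^σ`. -/
def ehBound (σ q a : ℕ) : ℕ := (2 * q) ^ σ * a + ((2 * q) ^ σ * a) ^ σ * (2 * q) ^ σ + 1

theorem Poly.ehBound (σ : ℕ) {q a : ℕ → ℕ} (hq : Poly q) (ha : Poly a) :
    Poly fun t => ehBound σ (q t) (a t) :=
  let h1 := ((Poly.const 2).mul hq).pow σ
  ((h1.mul ha).add (((h1.mul ha).pow σ).mul h1)).add (Poly.const 1)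

/-- If all stable sets are small, strip off `(2q)^σ` maximal stable sets in turn. Every remaining
element is related to something in each of them, hence by Ramsey to a stable `σ`-set in their union.
Many elements share the same `σ`-set, and a second use of Ramsey among them completes a biclique. -/
theorem erdos_hajnal {ι : Type*} (r : ι → ι → Prop) (hr : ∀ i j, r i j → r j i) {σ q a : ℕ}
    (hq : 1 ≤ q) (K : Finset ι) (hK : ehBound σ q a ≤ K.card)
    (hclique : ¬ ∃ Q ⊆ K, Q.card = q ∧ ∀ i ∈ Q, ∀ j ∈ Q, i ≠ j → r i j)
    (hbic : ¬ ∃ S ⊆ K, ∃ T ⊆ K, S.card = σ ∧ T.card = σ ∧ Disjoint S T ∧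
      (∀ i ∈ S, ∀ j ∈ S, i ≠ j → ¬ r i j) ∧ (∀ i ∈ T, ∀ j ∈ T, i ≠ j → ¬ r i j) ∧
      ∀ i ∈ S, ∀ j ∈ T, r i j) :
    ∃ S ⊆ K, S.card = a ∧ ∀ i ∈ S, ∀ j ∈ S, i ≠ j → ¬ r i j := by
  by_contra hcon
  have hsmall : ∀ S ⊆ K, (∀ i ∈ S, ∀ j ∈ S, i ≠ j → ¬ r i j) → S.card ≤ a := by
    intro S hS hst
    by_contra hlt
    obtain ⟨S', hS', hc⟩ := Finset.exists_subset_card_eq (not_le.1 hlt).le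
    exact hcon ⟨S', hS'.trans hS, hc, fun i hi j hj => hst i (hS' hi) j (hS' hj)⟩
  -- `U` is the union of `n` successively removed maximal stable sets, and `N` takes one related
  -- element from each.
  have hU : ∀ n, ∃ U ⊆ K, U.card ≤ n * a ∧ ∀ w ∈ K \ U, ∃ N ⊆ U, N.card = n ∧ ∀ u ∈ N, r u w := by
    intro n
    induction n with
    | zero => exact ⟨∅, by simp, by simp, fun w _ => ⟨∅, by simp⟩⟩
    | succ n ih =>
      obtain ⟨U, hUK, hUc, hU⟩ := ih
      let F := (K \ U).powerset.filter fun Q => ∀ i ∈ Q, ∀ j ∈ Q, i ≠ j → ¬ r i j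
      have hF : F.Nonempty := ⟨∅, by simp [F]⟩
      obtain ⟨M, hMF, hmax⟩ := F.exists_max_image Finset.card hF
      simp only [F, Finset.mem_filter, Finset.mem_powerset] at hMF hmax
      have hMK := hMF.1.trans Finset.sdiff_subset
      refine ⟨U ∪ M, Finset.union_subset hUK hMK, ?_, fun w hw => ?_⟩
      · have := hsmall M hMK hMF.2
        have := Finset.card_union_le U M
        have : (n + 1) * a = n * a + a := by ring
        lia
      · simp only [Finset.mem_sdiff, Finset.mem_union, not_or] at hw
        obtain ⟨N, hN, hNc, hNr⟩ := hU w (by simp [hw])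
        have : ∃ m ∈ M, r m w := by
          by_contra hno
          push Not at hno
          have := hmax (insert w M) ⟨Finset.insert_subset (by simp [hw]) hMF.1, by
            intro i hi j hj hij
            rcases Finset.mem_insert.1 hi with rfl | hi' <;>
              rcases Finset.mem_insert.1 hj with rfl | hj'
            · exact absurd rfl hij
            · exact fun h => hno j hj' (hr _ _ h)
            · exact hno i hi'
            · exact hMF.2 i hi' j hj' hij⟩
          rw [Finset.card_insert_of_notMem hw.2.2] at this
          lia
        obtain ⟨m, hm, hmw⟩ := this
        have hmN : m ∉ N := fun h => (Finset.mem_sdiff.1 (hMF.1 hm)).2 (hN h)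
        refine ⟨insert m N, ?_, by rw [Finset.card_insert_of_notMem hmN, hNc], ?_⟩
        · exact Finset.insert_subset (Finset.mem_union_right _ hm)
            (hN.trans Finset.subset_union_left)
        · intro u hu
          rcases Finset.mem_insert.1 hu with rfl | hu
          · exact hmw
          · exact hNr u hu
  obtain ⟨U, hUK, hUc, hU⟩ := hU ((2 * q) ^ σ)
  have hS : ∀ w ∈ K \ U, ∃ S ∈ U.powersetCard σ, (∀ i ∈ S, ∀ j ∈ S, i ≠ j → ¬ r i j) ∧
      ∀ u ∈ S, r u w := by
    intro w hw
    obtain ⟨N, hN, hNc, hNr⟩ := hU w hw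
    rcases ramsey_symm r hr hq σ N hNc.ge with ⟨Q, hQ, h⟩ | ⟨S, hS, hc, h⟩
    · exact absurd ⟨Q, (hQ.trans hN).trans hUK, h⟩ hclique
    · exact ⟨S, Finset.mem_powersetCard.2 ⟨hS.trans hN, hc⟩, h, fun u hu => hNr u (hS hu)⟩
  choose! S hSU hSst hSr using hS
  have hcard : (U.powersetCard σ).card * ((2 * q) ^ σ) < (K \ U).card := by
    rw [Finset.card_powersetCard]
    have h1 : U.card.choose σ ≤ ((2 * q) ^ σ * a) ^ σ :=
      (Nat.choose_le_pow _ _).trans (Nat.pow_le_pow_left hUc σ)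
    have h2 := Nat.mul_le_mul_right ((2 * q) ^ σ) h1
    have h3 := Finset.le_card_sdiff U K
    unfold ehBound at hK
    lia
  obtain ⟨S0, hS0, hfib⟩ := Finset.exists_lt_card_fiber_of_mul_lt_card_of_maps_to hSU hcard
  rw [Finset.mem_powersetCard] at hS0
  have hfK : (K \ U).filter (fun w => S w = S0) ⊆ K :=
    (Finset.filter_subset _ _).trans Finset.sdiff_subset
  rcases ramsey_symm r hr hq σ _ hfib.le with ⟨Q, hQ, h⟩ | ⟨T, hT, hc, h⟩
  · exact hclique ⟨Q, hQ.trans hfK, h⟩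
  · have hTm : ∀ w ∈ T, w ∈ K \ U ∧ S w = S0 := fun w hw => Finset.mem_filter.1 (hT hw)
    have hne : T.Nonempty ∨ σ = 0 := by
      rcases T.eq_empty_or_nonempty with rfl | h
      · exact Or.inr (by simpa using hc.symm)
      · exact Or.inl h
    rcases hne with ⟨w0, hw0⟩ | rfl
    · refine hbic ⟨S0, hS0.1.trans hUK, T, hT.trans hfK, hS0.2, hc, ?_, ?_, h, ?_⟩
      · exact Finset.disjoint_left.2 fun i hi hi' =>
          (Finset.mem_sdiff.1 (hTm i hi').1).2 (hS0.1 hi)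
      · rw [← (hTm w0 hw0).2]
        exact hSst w0 (hTm w0 hw0).1
      · intro i hi j hj
        refine hSr j (hTm j hj).1 i ?_
        rw [(hTm j hj).2]
        exact hi
    · exact hbic ⟨∅, by simp, ∅, by simp⟩

/-! ### Pigeonhole and double counting for dense relations -/

theorem exists_fiber {ι κ : Type*} {s : Finset ι} {t : Finset κ} {f : ι → κ}
    (hf : ∀ a ∈ s, f a ∈ t) (ht : t.Nonempty) :
    ∃ y ∈ t, ∃ s' ⊆ s, (∀ a ∈ s', f a = y) ∧ s.card ≤ t.card * s'.card := by
  obtain ⟨y, hy, hmax⟩ := t.exists_max_image (fun y => (s.filter fun a => f a = y).card) ht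
  refine ⟨y, hy, s.filter fun a => f a = y, Finset.filter_subset _ _,
    fun a ha => (Finset.mem_filter.1 ha).2, ?_⟩
  rw [mul_comm]
  exact Finset.card_le_mul_card_image_of_maps_to hf _ hmax

/-- Double counting: rows that are dense to the columns have common columns. -/
theorem exists_common {ι κ : Type*} (p : ι → κ → Prop) {e N : ℕ} (A : Finset ι) (C : Finset κ)
    (he : 1 ≤ e)
    (hA : 2 * e * N ≤ A.card) (hA0 : A.Nonempty)
    (h : ∀ i ∈ A, C.card ≤ e * (C.filter fun c => p i c).card) :
    ∃ H ⊆ A, H.card = N ∧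
      C.card ≤ 2 * e * A.card ^ N * (C.filter fun c => ∀ i ∈ H, p i c).card := by
  -- Columns with fewer than `N` related rows contribute at most `|C| * N` pairs, at most half of
  -- the guaranteed total since `|A| ≥ 2 * e * N`. So the columns in `C1` have density at least `1 /
  -- (2e)`; pigeonhole over `N`-subsets of `A` then fixes `H`.
  let C1 := C.filter fun c => N ≤ (A.filter fun i => p i c).card
  have hsum : ∑ i ∈ A, (C.filter fun c => p i c).card = ∑ c ∈ C, (A.filter fun i => p i c).card :=
    Finset.sum_card_bipartiteAbove_eq_sum_card_bipartiteBelow p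
  have h1 : A.card * C.card ≤ e * ∑ i ∈ A, (C.filter fun c => p i c).card := by
    rw [Finset.mul_sum]
    exact Finset.card_nsmul_le_sum _ _ _ h
  have h2 : ∑ c ∈ C, (A.filter fun i => p i c).card ≤ C1.card * A.card + C.card * N := by
    have : ∀ c ∈ C, (A.filter fun i => p i c).card ≤
        (if N ≤ (A.filter fun i => p i c).card then A.card else 0) + N := by
      intro c _
      split_ifs with h
      · exact (Finset.card_filter_le _ _).trans (by lia)
      · lia
    refine (Finset.sum_le_sum this).trans ?_
    rw [Finset.sum_add_distrib, ← Finset.sum_filter]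
    simp [C1]
  have h3 : C.card ≤ 2 * e * C1.card := by
    have hpos : 0 < A.card := hA0.card_pos
    have e1 : e * (C1.card * A.card + C.card * N) * 2
        = A.card * (2 * e * C1.card) + 2 * e * N * C.card := by ring
    have e2 : 2 * e * N * C.card ≤ A.card * C.card := Nat.mul_le_mul_right _ hA
    have e3 := Nat.mul_le_mul_left e h2
    rw [← hsum] at e3
    exact Nat.le_of_mul_le_mul_left (by lia : A.card * C.card ≤ A.card * (2 * e * C1.card)) hpos
  have hH : ∀ c ∈ C1, ∃ H ∈ A.powersetCard N, ∀ i ∈ H, p i c := by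
    intro c hc
    obtain ⟨H, hH, hc⟩ := Finset.exists_subset_card_eq (Finset.mem_filter.1 hc).2
    exact ⟨H, Finset.mem_powersetCard.2 ⟨hH.trans (Finset.filter_subset _ _), hc⟩,
      fun i hi => (Finset.mem_filter.1 (hH hi)).2⟩
  choose! g hgA hg using hH
  have hNA : (A.powersetCard N).Nonempty := by
    rw [Finset.powersetCard_nonempty]
    have : 1 * N ≤ 2 * e * N := Nat.mul_le_mul_right _ (by lia)
    lia
  obtain ⟨H, hH, C2, hC2, hgC2, hfib⟩ := exists_fiber hgA hNA
  refine ⟨H, (Finset.mem_powersetCard.1 hH).1, (Finset.mem_powersetCard.1 hH).2, h3.trans ?_⟩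
  rw [mul_assoc (2 * e)]
  refine Nat.mul_le_mul_left _ (hfib.trans (Nat.mul_le_mul ?_ (Finset.card_le_card ?_)))
  · rw [Finset.card_powersetCard]
    exact Nat.choose_le_pow _ _
  · intro c hc
    refine Finset.mem_filter.2 ⟨(Finset.mem_filter.1 (hC2 hc)).1, ?_⟩
    rw [← hgC2 c hc]
    exact hg c (hC2 hc)

/-- A large grid of dense relations to a common set contains a subgrid with a common point. -/
theorem exists_grid {ι ι' κ : Type*} (p : ι → ι' → κ → Prop) {E σ : ℕ} (hE : 1 ≤ E)
    (R : Finset ι) (R' : Finset ι') (C : Finset κ) (hC : C.Nonempty)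
    (hR' : 2 * E * σ + 1 ≤ R'.card)
    (hR : R'.card ^ σ * (4 * E * R'.card ^ σ * σ + 1) ≤ R.card)
    (h : ∀ r ∈ R, ∀ r' ∈ R', C.card ≤ E * (C.filter fun c => p r r' c).card) :
    ∃ H ⊆ R, ∃ H' ⊆ R', ∃ c ∈ C, H.card = σ ∧ H'.card = σ ∧ ∀ r ∈ H, ∀ r' ∈ H', p r r' c := by
  -- One round of `exists_common` for each `r` gives `σ` elements of `R'` with many common points.
  -- Pigeonhole makes this `σ`-set the same for many `r`, and a second round runs over these `r`
  -- with the reduced density.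
  have h1 : ∀ r ∈ R, ∃ H' ∈ R'.powersetCard σ, C.card ≤ 2 * E * R'.card ^ σ *
      (C.filter fun c => ∀ i ∈ H', p r i c).card := by
    intro r hr
    obtain ⟨H, hH, hc, hh⟩ := exists_common (p r) (N := σ) R' C hE (by lia)
      (Finset.card_pos.1 (by lia)) (h r hr)
    exact ⟨H, Finset.mem_powersetCard.2 ⟨hH, hc⟩, hh⟩
  choose! g hgR hg using h1
  have hσ : σ ≤ R'.card := by
    have : 1 * σ ≤ 2 * E * σ := Nat.mul_le_mul_right _ (by lia)
    lia
  obtain ⟨H', hH', R1, hR1R, hgR1, hfib⟩ := exists_fiber hgR (Finset.powersetCard_nonempty.2 hσ)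
  have hpos : 0 < R'.card ^ σ := Nat.pow_pos (by lia)
  have hR1c : 4 * E * R'.card ^ σ * σ + 1 ≤ R1.card := by
    rw [Finset.card_powersetCard] at hfib
    have := hR.trans (hfib.trans (Nat.mul_le_mul_right _ (Nat.choose_le_pow _ _)))
    exact Nat.le_of_mul_le_mul_left this hpos
  have hsub : ∀ r ∈ R1, r ∈ R ∧ g r = H' := fun r hr => ⟨hR1R hr, hgR1 r hr⟩
  obtain ⟨H, hH, hHc, hh⟩ := exists_common (fun r c => ∀ i ∈ H', p r i c) (e := 2 * E * R'.card ^ σ)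
    (N := σ) R1 C (Nat.mul_pos (by lia) hpos)
    (by
      have : 2 * (2 * E * R'.card ^ σ) * σ = 4 * E * R'.card ^ σ * σ := by ring
      lia)
    (Finset.card_pos.1 (by lia))
    (fun r hr => by
      have := hg r (hsub r hr).1
      rw [(hsub r hr).2] at this
      convert this)
  have hne : (C.filter fun c => ∀ i ∈ H, ∀ j ∈ H', p i j c).Nonempty := by
    by_contra hno
    rw [Finset.not_nonempty_iff_eq_empty] at hno
    have h0 : C.card ≤ 0 := by
      refine hh.trans (le_of_eq ?_)
      convert Nat.mul_zero _
      rw [Finset.card_eq_zero, ← hno]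
      congr!
    have := hC.card_pos
    lia
  obtain ⟨c, hc⟩ := hne
  rw [Finset.mem_filter] at hc
  exact ⟨H, fun r hr => (hsub r (hH hr)).1, H', (Finset.mem_powersetCard.1 hH').1, c, hc.1, hHc,
    (Finset.mem_powersetCard.1 hH').2, hc.2⟩

/-! ### Connected sets and touching sets -/

variable {V : Type w}

/-- Some edge joins `X` and `Y`. -/
def Touch (G : SimpleGraph V) (X Y : Set V) : Prop := ∃ x ∈ X, ∃ y ∈ Y, G.Adj x y

/-- `X` induces a connected subgraph. -/
def Conn (G : SimpleGraph V) (X : Set V) : Prop := (G.induce X).Connected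

variable {G : SimpleGraph V}

theorem Touch.symm {X Y : Set V} (h : Touch G X Y) : Touch G Y X := by
  obtain ⟨x, hx, y, hy, h⟩ := h
  exact ⟨y, hy, x, hx, h.symm⟩

theorem touch_comm {X Y : Set V} : Touch G X Y ↔ Touch G Y X := ⟨Touch.symm, Touch.symm⟩

theorem Touch.mono {X Y X' Y' : Set V} (h : Touch G X Y) (hX : X ⊆ X') (hY : Y ⊆ Y') :
    Touch G X' Y' := by
  obtain ⟨x, hx, y, hy, h⟩ := h
  exact ⟨x, hX hx, y, hY hy, h⟩

theorem touch_union_left {X Y Z : Set V} : Touch G (X ∪ Y) Z ↔ Touch G X Z ∨ Touch G Y Z := by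
  constructor
  · rintro ⟨x, hx | hx, y, hy, h⟩
    · exact Or.inl ⟨x, hx, y, hy, h⟩
    · exact Or.inr ⟨x, hx, y, hy, h⟩
  · rintro (h | h)
    · exact h.mono Set.subset_union_left subset_rfl
    · exact h.mono Set.subset_union_right subset_rfl

theorem touch_union_right {X Y Z : Set V} : Touch G X (Y ∪ Z) ↔ Touch G X Y ∨ Touch G X Z := by
  rw [touch_comm, touch_union_left, touch_comm, @touch_comm _ _ Z]

theorem touch_iUnion_right {ι : Type*} {X : Set V} {Y : ι → Set V} :
    Touch G X (⋃ i, Y i) ↔ ∃ i, Touch G X (Y i) := by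
  constructor
  · rintro ⟨x, hx, y, hy, h⟩
    obtain ⟨i, hi⟩ := Set.mem_iUnion.1 hy
    exact ⟨i, x, hx, y, hi, h⟩
  · rintro ⟨i, h⟩
    exact h.mono subset_rfl (Set.subset_iUnion _ _)

theorem touch_iUnion_left {ι : Type*} {X : Set V} {Y : ι → Set V} :
    Touch G (⋃ i, Y i) X ↔ ∃ i, Touch G (Y i) X := by
  rw [touch_comm, touch_iUnion_right]
  simp only [touch_comm]

@[simp] theorem not_touch_empty_left {X : Set V} : ¬ Touch G ∅ X := by
  rintro ⟨x, hx, _⟩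
  exact hx

theorem anticomplete_iff {X Y : Set V} : Anticomplete G X Y ↔ Disjoint X Y ∧ ¬ Touch G X Y :=
  ⟨fun h => ⟨h.1, fun ⟨x, hx, y, hy, ha⟩ => h.2 x hx y hy ha⟩,
    fun h => ⟨h.1, fun x hx y hy ha => h.2 ⟨x, hx, y, hy, ha⟩⟩⟩

theorem Anticomplete.symm {X Y : Set V} (h : Anticomplete G X Y) : Anticomplete G Y X :=
  ⟨h.1.symm, fun x hx y hy ha => h.2 y hy x hx ha.symm⟩

theorem Anticomplete.mono {X Y X' Y' : Set V} (h : Anticomplete G X Y) (hX : X' ⊆ X)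
    (hY : Y' ⊆ Y) : Anticomplete G X' Y' :=
  ⟨h.1.mono hX hY, fun x hx y hy => h.2 x (hX hx) y (hY hy)⟩

theorem Anticomplete.union_left {X Y Z : Set V} (h : Anticomplete G X Z)
    (h' : Anticomplete G Y Z) : Anticomplete G (X ∪ Y) Z :=
  ⟨Set.disjoint_union_left.2 ⟨h.1, h'.1⟩, fun x hx y hy => hx.elim (fun hx => h.2 x hx y hy)
    fun hx => h'.2 x hx y hy⟩

theorem Anticomplete.biUnion_left {ι : Type*} {J : Finset ι} {X : ι → Set V} {Z : Set V}
    (h : ∀ j ∈ J, Anticomplete G (X j) Z) : Anticomplete G (⋃ j ∈ J, X j) Z := by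
  refine ⟨?_, fun x hx y hy => ?_⟩
  · simp only [Set.disjoint_iUnion_left]
    exact fun j hj => (h j hj).1
  · obtain ⟨j, hj, hx⟩ := Set.mem_iUnion₂.1 hx
    exact (h j hj).2 x hx y hy

theorem Conn.nonempty {X : Set V} (h : Conn G X) : X.Nonempty :=
  Set.nonempty_coe_sort.1 (SimpleGraph.Connected.nonempty h)

theorem conn_singleton (v : V) : Conn G {v} := by
  have : Subsingleton (({v} : Set V) : Type _) := Set.subsingleton_coe _ |>.2 Set.subsingleton_singleton
  have : Nonempty (({v} : Set V) : Type _) := ⟨⟨v, rfl⟩⟩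
  exact ⟨SimpleGraph.Preconnected.of_subsingleton⟩

theorem Conn.union_of_touch {X Y : Set V} (hX : Conn G X) (hY : Conn G Y) (h : Touch G X Y) :
    Conn G (X ∪ Y) := by
  obtain ⟨x, hx, y, hy, h⟩ := h
  exact SimpleGraph.connected_induce_union hX.1 hY.1 hx hy h

theorem Conn.union_iUnion {ι : Type*} {X : Set V} {Y : ι → Set V} (hX : Conn G X)
    (h : ∀ i, Conn G (X ∪ Y i)) : Conn G (X ∪ ⋃ i, Y i) := by
  obtain ⟨x, hx⟩ := hX.nonempty
  refine SimpleGraph.induce_connected_of_patches x (Or.inl hx) fun {v} hv => ?_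
  rcases hv with hv | hv
  · exact ⟨X, Set.subset_union_left, hx, hv, hX.1 _ _⟩
  · obtain ⟨i, hi⟩ := Set.mem_iUnion.1 hv
    exact ⟨X ∪ Y i, Set.union_subset_union_right _ (Set.subset_iUnion _ _), Or.inl hx, Or.inr hi,
      (h i).1 _ _⟩

/-- There is no pair of families of `σ` connected sets, each pairwise anticomplete, such that any
two sets from different families are disjoint and touching. -/
def NoBiclique (G : SimpleGraph V) (σ : ℕ) : Prop :=
  ∀ X Y : Fin σ → Set V, (∀ i, Conn G (X i)) → (∀ i, Conn G (Y i)) →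
    (∀ i j, i ≠ j → Anticomplete G (X i) (X j)) → (∀ i j, i ≠ j → Anticomplete G (Y i) (Y j)) →
    (∀ i j, Disjoint (X i) (Y j)) → (∀ i j, Touch G (X i) (Y j)) → False

theorem noBiclique_of_not_hasInducedMinor {σ : ℕ}
    (h : ¬ HasInducedMinor G (completeBipartiteGraph (Fin σ) (Fin σ))) : NoBiclique G σ := by
  intro X Y hX hY hXX hYY hXY hT
  refine h ⟨Sum.elim X Y, ?_, ?_, ?_, ?_⟩
  · rintro (i | i)
    · exact hX i
    · exact hY i
  · rintro (i | i) (j | j) hij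
    · exact (hXX i j fun h => hij (by rw [h])).1
    · exact hXY i j
    · exact (hXY j i).symm
    · exact (hYY i j fun h => hij (by rw [h])).1
  · rintro (i | i) (j | j) hij
    · simp [completeBipartiteGraph] at hij
    · exact fun ha => (anticomplete_iff.1 ha).2 (hT i j)
    · exact fun ha => (anticomplete_iff.1 ha).2 (hT j i).symm
    · simp [completeBipartiteGraph] at hij
  · rintro (i | i) (j | j) hij ha
    · exact hXX i j fun h => hij (by rw [h])
    · simp [completeBipartiteGraph] at ha
    · simp [completeBipartiteGraph] at ha
    · exact hYY i j fun h => hij (by rw [h])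

theorem NoBiclique.elim {σ : ℕ} (h : NoBiclique G σ) {ι κ : Type*} (S : Finset ι) (T : Finset κ)
    (X : ι → Set V) (Y : κ → Set V) (hS : σ ≤ S.card) (hT : σ ≤ T.card)
    (hX : ∀ i ∈ S, Conn G (X i)) (hY : ∀ i ∈ T, Conn G (Y i))
    (hXX : ∀ i ∈ S, ∀ j ∈ S, i ≠ j → Anticomplete G (X i) (X j))
    (hYY : ∀ i ∈ T, ∀ j ∈ T, i ≠ j → Anticomplete G (Y i) (Y j))
    (hXY : ∀ i ∈ S, ∀ j ∈ T, Disjoint (X i) (Y j))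
    (ht : ∀ i ∈ S, ∀ j ∈ T, Touch G (X i) (Y j)) : False := by
  have emb : ∀ {α : Type _} (S : Finset α), σ ≤ S.card → ∃ f : Fin σ → α,
      Function.Injective f ∧ ∀ i, f i ∈ S := fun S hS =>
    ⟨fun i => (S.equivFin.symm (Fin.castLE hS i) : _),
      fun i j hij => by simpa using hij, fun i => Subtype.prop _⟩
  have emb' : ∀ {α : Type _} (S : Finset α), σ ≤ S.card → ∃ f : Fin σ → α,
      Function.Injective f ∧ ∀ i, f i ∈ S := fun S hS =>
    ⟨fun i => (S.equivFin.symm (Fin.castLE hS i) : _),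
      fun i j hij => by simpa using hij, fun i => Subtype.prop _⟩
  obtain ⟨f, hf, hfS⟩ := emb S hS
  obtain ⟨g, hg, hgT⟩ := emb' T hT
  exact h (fun i => X (f i)) (fun i => Y (g i)) (fun i => hX _ (hfS i)) (fun i => hY _ (hgT i))
    (fun i j hij => hXX _ (hfS i) _ (hfS j) fun h => hij (hf h))
    (fun i j hij => hYY _ (hgT i) _ (hgT j) fun h => hij (hg h))
    (fun i j => hXY _ (hfS i) _ (hgT j)) (fun i j => ht _ (hfS i) _ (hgT j))

/-- Split a finite set of natural numbers of size `2σ` into its first and second halves. -/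
theorem exists_halves {σ : ℕ} (Q : Finset ℕ) (hQ : Q.card = 2 * σ) :
    ∃ S ⊆ Q, ∃ T ⊆ Q, S.card = σ ∧ T.card = σ ∧ ∀ i ∈ S, ∀ j ∈ T, i < j := by
  let f := Q.orderEmbOfFin hQ
  refine ⟨(Finset.univ : Finset (Fin σ)).image fun i : Fin σ => f ⟨i, by have := i.2; lia⟩, ?_,
    (Finset.univ : Finset (Fin σ)).image fun i : Fin σ => f ⟨σ + i, by have := i.2; lia⟩, ?_, ?_, ?_, ?_⟩
  · intro x hx
    obtain ⟨i, _, rfl⟩ := Finset.mem_image.1 hx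
    exact Finset.orderEmbOfFin_mem _ _ _
  · intro x hx
    obtain ⟨i, _, rfl⟩ := Finset.mem_image.1 hx
    exact Finset.orderEmbOfFin_mem _ _ _
  · rw [Finset.card_image_of_injective _ fun i j hij => by simpa [Fin.ext_iff] using hij]
    simp
  · rw [Finset.card_image_of_injective _ fun i j hij => by simpa [Fin.ext_iff] using hij]
    simp
  · intro x hx y hy
    obtain ⟨i, _, rfl⟩ := Finset.mem_image.1 hx
    obtain ⟨j, _, rfl⟩ := Finset.mem_image.1 hy
    exact f.strictMono (by simp only [Fin.lt_def]; lia)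

theorem not_clique_of_cliqueFree {ι : Type*} {t : ℕ} (h : G.CliqueFree t) (v : ι → V)
    (Q : Finset ι) (hQ : Q.card = t) (hc : ∀ i ∈ Q, ∀ j ∈ Q, i ≠ j → G.Adj (v i) (v j)) :
    False := by
  refine h (Q.image v) ⟨?_, ?_⟩
  · intro x hx y hy hxy
    obtain ⟨i, hi, rfl⟩ := Finset.mem_image.1 (Finset.mem_coe.1 hx)
    obtain ⟨j, hj, rfl⟩ := Finset.mem_image.1 (Finset.mem_coe.1 hy)
    exact hc i hi j hj fun h => hxy (by rw [h])
  · rw [Finset.card_image_of_injOn, hQ]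
    intro i hi j hj hij
    by_contra hne
    exact (hc i hi j hj hne).ne hij

theorem anticomplete_singleton {v w : V} : Anticomplete G {v} {w} ↔ v ≠ w ∧ ¬ G.Adj v w := by
  simp [Anticomplete]

theorem touch_singleton {v w : V} : Touch G {v} {w} ↔ G.Adj v w := by
  simp [Touch]

/-- A biclique of the touching relation with stable sides is a `K_{σ,σ}` model. Empty sets are
allowed because a row with one vertex has an empty tail; they touch nothing and so cannot occur in a
biclique with `σ > 0`. -/
theorem erdos_hajnal_touch {ι : Type*} {σ q a : ℕ} (hb : NoBiclique G σ) (hq : 1 ≤ q)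
    (E : ι → Set V) (K : Finset ι) (hK : ehBound σ q a ≤ K.card)
    (hE : ∀ i ∈ K, E i = ∅ ∨ Conn G (E i))
    (hdisj : ∀ i ∈ K, ∀ j ∈ K, i ≠ j → Disjoint (E i) (E j))
    (hclique : ¬ ∃ Q ⊆ K, Q.card = q ∧ ∀ i ∈ Q, ∀ j ∈ Q, i ≠ j → Touch G (E i) (E j)) :
    ∃ S ⊆ K, S.card = a ∧ ∀ i ∈ S, ∀ j ∈ S, i ≠ j → Anticomplete G (E i) (E j) := by
  obtain ⟨S, hS, hc, h⟩ := erdos_hajnal (fun i j => Touch G (E i) (E j)) (fun _ _ => Touch.symm) hq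
    K hK hclique (by
      rintro ⟨S, hS, T, hT, hSc, hTc, hST, hSs, hTs, ht⟩
      rcases Nat.eq_zero_or_pos σ with rfl | hσ
      · exact hb (fun i => i.elim0) (fun i => i.elim0) (fun i => i.elim0) (fun i => i.elim0)
          (fun i => i.elim0) (fun i => i.elim0) (fun i => i.elim0) (fun i => i.elim0)
      obtain ⟨s0, hs0⟩ := Finset.card_pos.1 (hSc ▸ hσ)
      obtain ⟨t0, ht0⟩ := Finset.card_pos.1 (hTc ▸ hσ)
      refine hb.elim S T E E hSc.ge hTc.ge ?_ ?_ ?_ ?_ ?_ ht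
      · intro i hi
        refine (hE i (hS hi)).resolve_left fun h0 => ?_
        have := ht i hi t0 ht0
        simp [h0] at this
      · intro i hi
        refine (hE i (hT hi)).resolve_left fun h0 => ?_
        have := (ht s0 hs0 i hi).symm
        simp [h0] at this
      · exact fun i hi j hj hij =>
          anticomplete_iff.2 ⟨hdisj i (hS hi) j (hS hj) hij, hSs i hi j hj hij⟩
      · exact fun i hi j hj hij =>
          anticomplete_iff.2 ⟨hdisj i (hT hi) j (hT hj) hij, hTs i hi j hj hij⟩
      · exact fun i hi j hj => hdisj i (hS hi) j (hT hj) fun h =>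
          Finset.disjoint_left.1 hST hi (h ▸ hj))
  exact ⟨S, hS, hc, fun i hi j hj hij =>
    anticomplete_iff.2 ⟨hdisj i (hS hi) j (hS hj) hij, h i hi j hj hij⟩⟩

/-- No `2σ` sets among which each set touches every later one, if sets and the later ones can be
replaced by connected families that are pairwise anticomplete. -/
theorem not_clique_lt {σ : ℕ} (hb : NoBiclique G σ) (X Y : ℕ → Set V) (K : Finset ℕ)
    (hX : ∀ i ∈ K, X i = ∅ ∨ Conn G (X i)) (hY : ∀ i ∈ K, Y i = ∅ ∨ Conn G (Y i))
    (hXX : ∀ i ∈ K, ∀ j ∈ K, i ≠ j → Anticomplete G (X i) (X j))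
    (hYY : ∀ i ∈ K, ∀ j ∈ K, i ≠ j → Anticomplete G (Y i) (Y j))
    (hXY : ∀ i ∈ K, ∀ j ∈ K, i ≠ j → Disjoint (X i) (Y j)) (p : ℕ → ℕ → Prop)
    (hp : ∀ i ∈ K, ∀ j ∈ K, i < j → p i j → Touch G (X i) (Y j)) :
    ¬ ∃ Q ⊆ K, Q.card = 2 * σ ∧ ∀ i ∈ Q, ∀ j ∈ Q, i < j → p i j := by
  rintro ⟨Q, hQ, hc, h⟩
  obtain ⟨S, hS, T, hT, hSc, hTc, hST⟩ := exists_halves Q hc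
  have hS' := hS.trans hQ
  have hT' := hT.trans hQ
  have ht : ∀ i ∈ S, ∀ j ∈ T, Touch G (X i) (Y j) := fun i hi j hj =>
    hp i (hS' hi) j (hT' hj) (hST i hi j hj) (h i (hS hi) j (hT hj) (hST i hi j hj))
  rcases Nat.eq_zero_or_pos σ with rfl | hσ
  · exact hb (fun i => i.elim0) (fun i => i.elim0) (fun i => i.elim0) (fun i => i.elim0)
      (fun i => i.elim0) (fun i => i.elim0) (fun i => i.elim0) (fun i => i.elim0)
  obtain ⟨s0, hs0⟩ := Finset.card_pos.1 (hSc ▸ hσ)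
  obtain ⟨t0, ht0⟩ := Finset.card_pos.1 (hTc ▸ hσ)
  refine hb.elim S T X Y hSc.ge hTc.ge (fun i hi => ?_) (fun i hi => ?_)
    (fun i hi j hj => hXX i (hS' hi) j (hS' hj)) (fun i hi j hj => hYY i (hT' hi) j (hT' hj))
    (fun i hi j hj => hXY i (hS' hi) j (hT' hj) (hST i hi j hj).ne) ht
  · refine (hX i (hS' hi)).resolve_left fun h0 => ?_
    have := ht i hi t0 ht0
    simp [h0] at this
  · refine (hY i (hT' hi)).resolve_left fun h0 => ?_
    have := (ht s0 hs0 i hi).symm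
    simp [h0] at this

/-- The four selections of `exists_anticomplete_insert`, from the outside in: the sets `E i`, the
vertices `v i`, and the contacts between `E i` and `v j` for the two orders of `i` and `j`. -/
def tailBound (σ q t a : ℕ) : ℕ := ehBound σ q (ehBound σ t ((2 * (2 * a) ^ (2 * σ)) ^ (2 * σ)))

theorem Poly.tailBound (σ : ℕ) {q a : ℕ → ℕ} (hq : Poly q) (ha : Poly a) :
    Poly fun t => tailBound σ (q t) t (a t) :=
  Poly.ehBound σ hq (Poly.ehBound σ Poly.id
    (((Poly.const 2).mul (((Poly.const 2).mul ha).pow _)).pow _))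

/-- A large family of sets `E i` with extra vertices `v i` contains a clique of touching `E i`,
or a large pairwise anticomplete subfamily of `E i ∪ {v i}`. -/
theorem exists_anticomplete_insert {σ q t a : ℕ} (hb : NoBiclique G σ) (ht : G.CliqueFree t)
    (ht1 : 1 ≤ t) (hq : 1 ≤ q) (ha : 1 ≤ a) (E : ℕ → Set V) (v : ℕ → V) (K : Finset ℕ)
    (hK : tailBound σ q t a ≤ K.card) (hE : ∀ i ∈ K, E i = ∅ ∨ Conn G (E i))
    (hdisj : ∀ i ∈ K, ∀ j ∈ K, i ≠ j → Disjoint (E i ∪ {v i}) (E j ∪ {v j}))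
    (hclique : ¬ ∃ Q ⊆ K, Q.card = q ∧ ∀ i ∈ Q, ∀ j ∈ Q, i ≠ j → Touch G (E i) (E j)) :
    ∃ S ⊆ K, S.card = a ∧
      ∀ i ∈ S, ∀ j ∈ S, i ≠ j → Anticomplete G (E i ∪ {v i}) (E j ∪ {v j}) := by
  obtain ⟨K1, hK1, hc1, h1⟩ := erdos_hajnal_touch hb hq E K hK hE
    (fun i hi j hj hij => (hdisj i hi j hj hij).mono Set.subset_union_left Set.subset_union_left)
    hclique
  obtain ⟨K2, hK2, hc2, h2⟩ := erdos_hajnal_touch hb ht1 (fun i => ({v i} : Set V)) K1 hc1.ge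
    (fun i _ => Or.inr (conn_singleton _))
    (fun i hi j hj hij => (hdisj i (hK1 hi) j (hK1 hj) hij).mono Set.subset_union_right
      Set.subset_union_right)
    (fun ⟨Q, _, hc, h⟩ => not_clique_of_cliqueFree ht v Q hc
      fun i hi j hj hij => touch_singleton.1 (h i hi j hj hij))
  have hK2K := hK2.trans hK1
  have hd : ∀ i ∈ K2, ∀ j ∈ K2, i ≠ j → Disjoint (E i) {v j} := fun i hi j hj hij =>
    (hdisj i (hK2K hi) j (hK2K hj) hij).mono Set.subset_union_left Set.subset_union_right
  have hs : ∀ i ∈ K2, ({v i} : Set V) = ∅ ∨ Conn G {v i} := fun _ _ => Or.inr (conn_singleton _)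
  obtain ⟨K3, hK3, hc3, h3⟩ := exists_stable_lt (fun i j => Touch G (E i) {v j})
    (Nat.one_le_pow _ _ (by lia)) (2 * σ) K2 hc2.ge
    (not_clique_lt hb E (fun i => {v i}) K2 (fun i hi => hE i (hK2K hi)) hs
      (fun i hi j hj => h1 i (hK2 hi) j (hK2 hj)) h2 hd _ fun _ _ _ _ _ h => h)
  obtain ⟨K4, hK4, hc4, h4⟩ := exists_stable_lt (fun i j => Touch G {v i} (E j))
    ha (2 * σ) K3 hc3.ge
    (not_clique_lt hb (fun i => {v i}) E K3 (fun i hi => hs i (hK3 hi))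
      (fun i hi => hE i (hK2K (hK3 hi))) (fun i hi j hj => h2 i (hK3 hi) j (hK3 hj))
      (fun i hi j hj => h1 i (hK2 (hK3 hi)) j (hK2 (hK3 hj)))
      (fun i hi j hj hij => (hd j (hK3 hj) i (hK3 hi) hij.symm).symm) _ fun _ _ _ _ _ h => h)
  have hK43 := hK4.trans hK3
  have hK4K := hK43.trans hK2K
  refine ⟨K4, hK4K, hc4, fun i hi j hj hij =>
    anticomplete_iff.2 ⟨hdisj i (hK4K hi) j (hK4K hj) hij, ?_⟩⟩
  rw [touch_union_left, touch_union_right, touch_union_right, not_or, not_or, not_or]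
  refine ⟨⟨(anticomplete_iff.1 (h1 i (hK2 (hK43 hi)) j (hK2 (hK43 hj)) hij)).2, ?_⟩, ?_,
    (anticomplete_iff.1 (h2 i (hK43 hi) j (hK43 hj) hij)).2⟩
  · rcases hij.lt_or_gt with hlt | hlt
    · exact h3 i (hK4 hi) j (hK4 hj) hlt
    · exact fun h => h4 j hj i hi hlt h.symm
  · rcases hij.lt_or_gt with hlt | hlt
    · exact h4 i hi j hj hlt
    · exact fun h => h3 j (hK4 hj) i (hK4 hi) hlt h.symm

/-! ### Tree models -/

/-- `Y` is disjoint from `S` and touches it, but only in its subset `R`. -/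
def Attach (G : SimpleGraph V) (Y R S : Set V) : Prop :=
  Disjoint Y S ∧ Touch G Y R ∧ ¬ Touch G Y (S \ R)

/-- `S` is the union of an induced model of the full binary tree of radius `d`, and `R` is the
branch set of its root. -/
def BT (G : SimpleGraph V) : ℕ → Set V → Set V → Prop
  | 0, R, S => Conn G R ∧ S = R
  | d + 1, R, S => Conn G R ∧ ∃ R' S' : Bool → Set V, (∀ b, BT G d (R' b) (S' b)) ∧
      (∀ b c, b ≠ c → Anticomplete G (S' b) (S' c)) ∧ (∀ b, Attach G R (R' b) (S' b)) ∧
      S = R ∪ ⋃ b, S' b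

/-- A tree model as in `BT`, except that the root has `σ + 2` children. -/
def FT (G : SimpleGraph V) (σ : ℕ) : ℕ → Set V → Set V → Prop
  | 0, R, S => Conn G R ∧ S = R
  | d + 1, R, S => Conn G R ∧ ∃ R' S' : Fin (σ + 2) → Set V, (∀ b, BT G d (R' b) (S' b)) ∧
      (∀ b c, b ≠ c → Anticomplete G (S' b) (S' c)) ∧ (∀ b, Attach G R (R' b) (S' b)) ∧
      S = R ∪ ⋃ b, S' b

theorem BT.conn_root {d : ℕ} {R S : Set V} (h : BT G d R S) : Conn G R := by
  cases d <;> exact h.1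

theorem BT.root_subset {d : ℕ} {R S : Set V} (h : BT G d R S) : R ⊆ S := by
  cases d with
  | zero => exact h.2.ge
  | succ d =>
    obtain ⟨_, R', S', _, _, _, rfl⟩ := h
    exact Set.subset_union_left

theorem FT.conn_root {σ d : ℕ} {R S : Set V} (h : FT G σ d R S) : Conn G R := by
  cases d <;> exact h.1

theorem FT.root_subset {σ d : ℕ} {R S : Set V} (h : FT G σ d R S) : R ⊆ S := by
  cases d with
  | zero => exact h.2.ge
  | succ d =>
    obtain ⟨_, R', S', _, _, _, rfl⟩ := h
    exact Set.subset_union_left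

theorem BT.conn {d : ℕ} {R S : Set V} (h : BT G d R S) : Conn G S := by
  induction d generalizing R S with
  | zero => exact h.2 ▸ h.1
  | succ d ih =>
    obtain ⟨hR, R', S', hB, _, hA, rfl⟩ := h
    exact hR.union_iUnion fun b => hR.union_of_touch (ih (hB b))
      ((hA b).2.1.mono subset_rfl (hB b).root_subset)

theorem FT.conn {σ d : ℕ} {R S : Set V} (h : FT G σ d R S) : Conn G S := by
  cases d with
  | zero => exact h.2 ▸ h.1
  | succ d =>
    obtain ⟨hR, R', S', hB, _, hA, rfl⟩ := h
    exact hR.union_iUnion fun b => hR.union_of_touch (hB b).conn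
      ((hA b).2.1.mono subset_rfl (hB b).root_subset)

theorem FT.exists_bt {σ d : ℕ} {R S Y : Set V} (h : FT G σ d R S) (hd : Disjoint Y S)
    (hR : Touch G Y R) (hS : ¬ Touch G Y (S \ R)) :
    ∃ S' ⊆ S, BT G d R S' ∧ Attach G Y R S' := by
  cases d with
  | zero => exact ⟨S, subset_rfl, h, hd, hR, hS⟩
  | succ d =>
    obtain ⟨hc, R', S', hB, hAn, hA, rfl⟩ := h
    let e : Bool → Fin (σ + 2) := fun b => if b then ⟨0, by lia⟩ else ⟨1, by lia⟩
    have he : ∀ b c, b ≠ c → e b ≠ e c := by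
      rintro (_ | _) (_ | _) h <;> simp [e] at h ⊢
    have hsub : (R ∪ ⋃ b, S' (e b)) ⊆ R ∪ ⋃ b, S' b :=
      Set.union_subset_union_right _ (Set.iUnion_subset fun b => Set.subset_iUnion S' (e b))
    exact ⟨R ∪ ⋃ b, S' (e b), hsub,
      ⟨hc, fun b => R' (e b), fun b => S' (e b), fun b => hB _, fun b c h => hAn _ _ (he b c h),
        fun b => hA _, rfl⟩, hd.mono_right hsub, hR,
      fun h => hS (h.mono subset_rfl (Set.sdiff_subset_sdiff_left hsub))⟩

theorem exists_two_of_card {n : ℕ} (p : Fin n → Prop)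
    (h : (Finset.univ.filter fun i => p i).card + 2 ≤ n) :
    ∃ e : Bool → Fin n, (∀ b, ¬ p (e b)) ∧ ∀ b c, b ≠ c → e b ≠ e c := by
  have h1 := Finset.card_filter_add_card_filter_not (s := (Finset.univ : Finset (Fin n))) p
  have h2 : 1 < (Finset.univ.filter fun i => ¬ p i).card := by
    simp only [Finset.card_univ, Fintype.card_fin] at h1
    lia
  obtain ⟨i, hi, j, hj, hij⟩ := Finset.one_lt_card.1 h2
  rw [Finset.mem_filter] at hi hj
  refine ⟨fun b => if b then i else j, ?_, ?_⟩
  · rintro (_ | _)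
    · exact hj.2
    · exact hi.2
  · rintro (_ | _) (_ | _) h
    · exact absurd rfl h
    · exact hij.symm
    · exact hij
    · exact absurd rfl h

def badBound (σ t : ℕ) : ℕ := (σ + 2) ^ σ * (2 * t) ^ σ

theorem Poly.badBound (σ : ℕ) : Poly (badBound σ) :=
  (Poly.const _).mul (((Poly.const 2).mul Poly.id).pow _)

/-- Few vertices touch many of `n` pairwise anticomplete connected sets. -/
theorem card_le_of_touch_many {σ t n : ℕ} (hb : NoBiclique G σ) (ht : G.CliqueFree t) (ht1 : 1 ≤ t)
    (X : Fin n → Set V) (hX : ∀ i, Conn G (X i))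
    (hXX : ∀ i j, i ≠ j → Anticomplete G (X i) (X j)) (W : Finset V)
    (hW : ∀ w ∈ W, (∀ i, w ∉ X i) ∧
      σ ≤ (Finset.univ.filter fun i => Touch G {w} (X i)).card) :
    W.card ≤ n ^ σ * (2 * t) ^ σ := by
  by_contra hlt
  have hS : ∀ w ∈ W, ∃ S ∈ (Finset.univ : Finset (Fin n)).powersetCard σ,
      ∀ i ∈ S, Touch G {w} (X i) := by
    intro w hw
    obtain ⟨S, hS, hc⟩ := Finset.exists_subset_card_eq (hW w hw).2
    exact ⟨S, Finset.mem_powersetCard.2 ⟨Finset.subset_univ _, hc⟩,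
      fun i hi => (Finset.mem_filter.1 (hS hi)).2⟩
  choose! S hSm hS using hS
  have hcard : ((Finset.univ : Finset (Fin n)).powersetCard σ).card * (2 * t) ^ σ < W.card := by
    rw [Finset.card_powersetCard]
    refine lt_of_le_of_lt (Nat.mul_le_mul_right _ (Nat.choose_le_pow _ _)) ?_
    simpa using hlt
  obtain ⟨S0, hS0, hfib⟩ := Finset.exists_lt_card_fiber_of_mul_lt_card_of_maps_to hSm hcard
  rcases ramsey_symm G.Adj (fun _ _ h => h.symm) ht1 σ _ hfib.le with ⟨Q, _, hc, h⟩ | ⟨T, hT, hc, h⟩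
  · exact not_clique_of_cliqueFree ht (fun v => v) Q hc h
  · have hTW : ∀ w ∈ T, w ∈ W ∧ S w = S0 := fun w hw => Finset.mem_filter.1 (hT hw)
    refine hb.elim S0 T X (fun v => {v}) (Finset.mem_powersetCard.1 hS0).2.ge hc.ge
      (fun i _ => hX i) (fun w _ => conn_singleton w) (fun i _ j _ => hXX i j)
      (fun v hv w hw hvw => anticomplete_singleton.2 ⟨hvw, h v hv w hw hvw⟩) ?_ ?_
    · intro i _ w hw
      exact Set.disjoint_singleton_right.2 ((hW w (hTW w hw).1).1 i)
    · intro i hi w hw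
      exact (hS w (hTW w hw).1 i (by rw [(hTW w hw).2]; exact hi)).symm

/-- A set that touches a tree model only through a vertex outside a small exceptional set can be
attached to the root of a binary tree model. -/
theorem FT.exists_bad {σ t d : ℕ} {R S : Set V} (h : FT G σ d R S) (hb : NoBiclique G σ)
    (ht : G.CliqueFree t) (ht1 : 1 ≤ t) :
    ∃ Bad : Set V, (∀ W : Finset V, (↑W : Set V) ⊆ Bad → W.card ≤ badBound σ t) ∧
      ∀ (Y : Set V) (w : V), w ∈ Y → w ∉ Bad → Disjoint Y S → ¬ Touch G (Y \ {w}) S →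
        Touch G {w} S → ∃ R' S', S' ⊆ S ∧ BT G d R' S' ∧ Attach G Y R' S' := by
  cases d with
  | zero =>
    refine ⟨∅, fun W hW => ?_, fun Y w hw _ hd hn hwS => ⟨R, S, subset_rfl, h, hd, ?_, ?_⟩⟩
    · rw [Set.subset_empty_iff, Finset.coe_eq_empty] at hW
      simp [hW]
    · rw [← h.2]
      exact hwS.mono (Set.singleton_subset_iff.2 hw) subset_rfl
    · rw [h.2, Set.sdiff_self]
      rintro ⟨x, _, y, hy, _⟩
      exact hy
  | succ d =>
    obtain ⟨hc, R', S', hB, hAn, hA, rfl⟩ := h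
    -- The exceptional vertices touch at least `σ` of the `σ + 2` subtrees at the root; any other
    -- vertex leaves two subtrees untouched.
    refine ⟨{w | (∀ i, w ∉ S' i) ∧ σ ≤ (Finset.univ.filter fun i => Touch G {w} (S' i)).card},
      fun W hW => card_le_of_touch_many hb ht ht1 S' (fun i => (hB i).conn) hAn W
        fun w hw => hW hw, fun Y w hw hbad hd hn hwS => ?_⟩
    have hwd : w ∉ R ∪ ⋃ i, S' i := Set.disjoint_left.1 hd hw
    have hcard : (Finset.univ.filter fun i => Touch G {w} (S' i)).card < σ := by
      by_contra hlt
      refine hbad ⟨fun i hi => hwd (Or.inr (Set.mem_iUnion.2 ⟨i, hi⟩)), not_lt.1 hlt⟩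
    obtain ⟨e, he, hee⟩ := exists_two_of_card (fun i => Touch G {w} (S' i)) (by lia)
    have hnt : ∀ b, ¬ Touch G Y (S' (e b)) := by
      rintro b ⟨x, hx, y, hy, hxy⟩
      by_cases hxw : x = w
      · exact he b ⟨x, hxw, y, hy, hxy⟩
      · exact hn ⟨x, ⟨hx, hxw⟩, y, Or.inr (Set.mem_iUnion.2 ⟨_, hy⟩), hxy⟩
    -- If `w` touches only a subtree and not the root, that whole subtree is absorbed into the root.
    -- It is anticomplete to the two untouched subtrees, so these remain children.
    have hroot : ∃ T ⊆ ⋃ i, S' i, Conn G (R ∪ T) ∧ (∀ b, Anticomplete G T (S' (e b))) ∧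
        Touch G {w} (R ∪ T) := by
      rw [touch_union_right, touch_iUnion_right] at hwS
      rcases hwS with hwR | ⟨i, hi⟩
      · refine ⟨∅, Set.empty_subset _, by simpa using hc, fun b => ?_, by simpa using hwR⟩
        simp [Anticomplete]
      · refine ⟨S' i, Set.subset_iUnion _ _, hc.union_of_touch (hB i).conn
          ((hA i).2.1.mono subset_rfl (hB i).root_subset), fun b => hAn _ _ ?_,
          hi.mono subset_rfl Set.subset_union_right⟩
        rintro rfl
        exact he b hi
    obtain ⟨T, hTS, hTc, hTA, hTw⟩ := hroot
    have hsub : ((R ∪ T) ∪ ⋃ b, S' (e b)) ⊆ R ∪ ⋃ i, S' i := by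
      refine Set.union_subset (Set.union_subset_union_right _ hTS) ?_
      exact (Set.iUnion_subset fun b => Set.subset_iUnion S' (e b)).trans Set.subset_union_right
    refine ⟨R ∪ T, (R ∪ T) ∪ ⋃ b, S' (e b), hsub, ⟨hTc, fun b => R' (e b), fun b => S' (e b),
      fun b => hB _, fun b c hbc => hAn _ _ (hee b c hbc), fun b => ⟨?_, ?_, ?_⟩, rfl⟩,
      hd.mono_right hsub, hTw.mono (Set.singleton_subset_iff.2 hw) subset_rfl, ?_⟩
    · exact Set.disjoint_union_left.2 ⟨(hA _).1, (hTA b).1⟩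
    · exact (hA _).2.1.mono Set.subset_union_left subset_rfl
    · rw [touch_union_left, not_or]
      exact ⟨(hA _).2.2, fun h =>
        (anticomplete_iff.1 (hTA b)).2 (h.mono subset_rfl Set.sdiff_subset)⟩
    · intro h
      have := h.mono (Y' := ⋃ b, S' (e b)) subset_rfl (by
        rintro x ⟨hx | hx, hx'⟩
        · exact absurd hx hx'
        · exact hx)
      rw [touch_iUnion_right] at this
      obtain ⟨b, hb⟩ := this
      exact hnt b hb

/-- Joining `σ + 2` binary tree models to a connected set. -/
theorem FT.assemble {σ d : ℕ} {X : Set V} {L R' S' : Fin (σ + 2) → Set V} (hX : Conn G X)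
    (hL : ∀ h, Conn G (X ∪ L h)) (hB : ∀ h, BT G d (R' h) (S' h))
    (hA : ∀ h, Attach G (X ∪ L h) (R' h) (S' h))
    (hLS : ∀ h l, h ≠ l → Anticomplete G (L h) (S' l))
    (hSS : ∀ h l, h ≠ l → Anticomplete G (S' h) (S' l)) :
    FT G σ (d + 1) (X ∪ ⋃ h, L h) ((X ∪ ⋃ h, L h) ∪ ⋃ h, S' h) := by
  refine ⟨hX.union_iUnion hL, R', S', hB, hSS, fun h => ⟨?_, ?_, ?_⟩, rfl⟩
  · rw [Set.disjoint_union_left, Set.disjoint_iUnion_left]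
    refine ⟨(hA h).1.mono_left Set.subset_union_left, fun l => ?_⟩
    by_cases hlh : l = h
    · subst hlh
      exact (hA l).1.mono_left Set.subset_union_right
    · exact (hLS l h hlh).1
  · exact (hA h).2.1.mono (Set.union_subset_union_right _ (Set.subset_iUnion _ _)) subset_rfl
  · rw [touch_union_left, touch_iUnion_left]
    rintro (ht | ⟨l, ht⟩)
    · exact (hA h).2.2 (ht.mono Set.subset_union_left subset_rfl)
    · by_cases hlh : l = h
      · subst hlh
        exact (hA l).2.2 (ht.mono Set.subset_union_right subset_rfl)
      · exact (anticomplete_iff.1 (hLS l h hlh)).2 (ht.mono subset_rfl Set.sdiff_subset)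

/-- Words are read from the root outwards, so that the recursion on subtrees prepends a letter. In
`binTree` children prepend a letter instead, hence the reversal in `BT.hasInducedMinor`. -/
theorem BT.exists_words {d : ℕ} {R S : Set V} (h : BT G d R S) :
    ∃ Y : List Bool → Set V, Y [] = R ∧ (∀ l, l.length ≤ d → Conn G (Y l) ∧ Y l ⊆ S) ∧
      (∀ l, l.length ≤ d → l ≠ [] → Y l ⊆ S \ R) ∧
      ∀ u v, u.length ≤ d → v.length ≤ d → u ≠ v → Disjoint (Y u) (Y v) ∧
        (Touch G (Y u) (Y v) ↔ ∃ b, v = u ++ [b] ∨ u = v ++ [b]) := by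
  induction d generalizing R S with
  | zero =>
    refine ⟨fun _ => R, rfl, fun l _ => ⟨h.1, h.2.ge⟩, fun l hl hne => ?_, fun u v hu hv huv => ?_⟩
    · exact absurd (List.length_eq_zero_iff.1 (by lia)) hne
    · rw [List.length_eq_zero_iff.1 (by lia : u.length = 0),
        List.length_eq_zero_iff.1 (by lia : v.length = 0)] at huv
      exact absurd rfl huv
  | succ d ih =>
    obtain ⟨hc, R', S', hB, hAn, hA, rfl⟩ := h
    choose Y hY0 hYc hYR hYY using fun b => ih (hB b)
    let Z : List Bool → Set V
      | [] => R
      | b :: m => Y b m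
    have hcons : ∀ b m, m.length ≤ d → Disjoint R (Y b m) ∧ (Touch G R (Y b m) ↔ m = []) := by
      intro b m hm
      refine ⟨(hA b).1.mono_right (hYc b m hm).2, fun ht => ?_, ?_⟩
      · by_contra hne
        exact (hA b).2.2 (ht.mono subset_rfl (hYR b m hm hne))
      · rintro rfl
        rw [hY0]
        exact (hA b).2.1
    refine ⟨Z, rfl, ?_, ?_, ?_⟩
    · rintro (_ | ⟨b, m⟩) hl
      · exact ⟨hc, Set.subset_union_left⟩
      · have := hYc b m (by simpa using hl)
        exact ⟨this.1, this.2.trans ((Set.subset_iUnion S' b).trans Set.subset_union_right)⟩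
    · rintro (_ | ⟨b, m⟩) hl hne
      · exact absurd rfl hne
      · have hl' : m.length ≤ d := by simpa using hl
        have := hYc b m hl'
        exact fun x hx => ⟨Or.inr (Set.mem_iUnion.2 ⟨b, this.2 hx⟩),
          fun hxR => Set.disjoint_left.1 (hcons b m hl').1 hxR hx⟩
    · rintro (_ | ⟨b, m⟩) (_ | ⟨c, n⟩) hu hv huv
      · exact absurd rfl huv
      · have := hcons c n (by simpa using hv)
        refine ⟨this.1, this.2.trans ?_⟩
        simp
      · have := hcons b m (by simpa using hu)
        refine ⟨this.1.symm, touch_comm.trans (this.2.trans ?_)⟩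
        simp
      · have hm : m.length ≤ d := by simpa using hu
        have hn : n.length ≤ d := by simpa using hv
        by_cases hbc : b = c
        · subst hbc
          have := hYY b m n hm hn (fun h => huv (by rw [h]))
          refine ⟨this.1, this.2.trans ?_⟩
          simp
        · have := (hAn b c hbc).mono (hYc b m hm).2 (hYc c n hn).2
          refine ⟨this.1, iff_of_false (anticomplete_iff.1 this).2 ?_⟩
          simp [hbc, Ne.symm hbc]

theorem BT.hasInducedMinor {d : ℕ} {R S : Set V} (h : BT G d R S) :
    HasInducedMinor G (binTree d) := by
  obtain ⟨Y, -, hc, -, hY⟩ := h.exists_words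
  have hlen : ∀ u : {l : List Bool // l.length ≤ d}, u.1.reverse.length ≤ d := fun u => by
    simpa using u.2
  have hne : ∀ u v : {l : List Bool // l.length ≤ d}, u ≠ v → u.1.reverse ≠ v.1.reverse :=
    fun u v huv h => huv (Subtype.ext (List.reverse_injective h))
  have hadj : ∀ u v : {l : List Bool // l.length ≤ d}, u ≠ v → ((binTree d).Adj u v ↔
      ∃ b, v.1.reverse = u.1.reverse ++ [b] ∨ u.1.reverse = v.1.reverse ++ [b]) := by
    intro u v huv
    have : ∀ (a c : List Bool) b, a.reverse = c.reverse ++ [b] ↔ a = b :: c := fun a c b => by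
      rw [← List.reverse_cons, List.reverse_inj]
    simp only [this, binTree, SimpleGraph.fromRel_adj, exists_or]
    tauto
  refine ⟨fun w => Y w.1.reverse, fun w => (hc _ (hlen w)).1,
    fun u v huv => (hY _ _ (hlen u) (hlen v) (hne u v huv)).1, fun u v huv ha => ?_,
    fun u v huv hn => ?_⟩
  · have := hY _ _ (hlen u) (hlen v) (hne u v huv.ne)
    exact (anticomplete_iff.1 ha).2 (this.2.2 ((hadj u v huv.ne).1 huv))
  · have := hY _ _ (hlen u) (hlen v) (hne u v huv)
    exact anticomplete_iff.2 ⟨this.1, fun ht => hn ((hadj u v huv).2 (this.2.1 ht))⟩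

theorem FT.hasInducedMinor {σ d : ℕ} {R S : Set V} (h : FT G σ d R S) :
    HasInducedMinor G (binTree d) := by
  cases d with
  | zero =>
    have h' : BT G 0 R S := h
    exact h'.hasInducedMinor
  | succ d =>
    obtain ⟨hc, R', S', hB, hAn, hA, rfl⟩ := h
    obtain ⟨e, -, he⟩ := exists_two_of_card (n := σ + 2) (fun _ => False) (by simp)
    have h' : BT G (d + 1) R (R ∪ ⋃ b, S' (e b)) :=
      ⟨hc, fun b => R' (e b), fun b => S' (e b), fun b => hB _, fun b c hbc => hAn _ _ (he b c hbc),
        fun b => hA _, rfl⟩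
    exact h'.hasInducedMinor

/-! ### Rows of vertices -/

/-- The vertices with indices from `a` to `b` in row `j`. -/
def seg (z : ℕ → ℕ → V) (j a b : ℕ) : Set V := {v | ∃ k, a ≤ k ∧ k ≤ b ∧ z j k = v}

theorem seg_mono {z : ℕ → ℕ → V} {j a b a' b' : ℕ} (ha : a' ≤ a) (hb : b ≤ b') :
    seg z j a b ⊆ seg z j a' b' := by
  rintro _ ⟨k, h1, h2, rfl⟩
  exact ⟨k, by lia, by lia, rfl⟩

theorem mem_seg {z : ℕ → ℕ → V} {j a b k : ℕ} (ha : a ≤ k) (hb : k ≤ b) : z j k ∈ seg z j a b :=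
  ⟨k, ha, hb, rfl⟩

theorem seg_succ {z : ℕ → ℕ → V} {j a b : ℕ} (h : a ≤ b + 1) :
    seg z j a (b + 1) = seg z j a b ∪ {z j (b + 1)} := by
  ext v
  constructor
  · rintro ⟨k, h1, h2, rfl⟩
    rcases Nat.lt_or_ge b k with hk | hk
    · right
      rw [show k = b + 1 by lia]
      rfl
    · exact Or.inl ⟨k, h1, hk, rfl⟩
  · rintro (⟨k, h1, h2, rfl⟩ | rfl)
    · exact ⟨k, h1, by lia, rfl⟩
    · exact ⟨b + 1, h, le_rfl, rfl⟩

theorem seg_zero {z : ℕ → ℕ → V} {j b : ℕ} : seg z j 0 b = seg z j 1 b ∪ {z j 0} := by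
  ext v
  constructor
  · rintro ⟨k, h1, h2, rfl⟩
    rcases Nat.eq_zero_or_pos k with rfl | hk
    · exact Or.inr rfl
    · exact Or.inl ⟨k, hk, h2, rfl⟩
  · rintro (⟨k, h1, h2, rfl⟩ | rfl)
    · exact ⟨k, by lia, h2, rfl⟩
    · exact ⟨0, le_rfl, by lia, rfl⟩

theorem seg_eq_empty {z : ℕ → ℕ → V} {j a b : ℕ} (h : b < a) : seg z j a b = ∅ := by
  ext v
  simp only [Set.mem_empty_iff_false, iff_false]
  rintro ⟨k, h1, h2, -⟩
  lia

theorem conn_seg {z : ℕ → ℕ → V} {j a b : ℕ} (hab : a ≤ b)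
    (h : ∀ k, a ≤ k → k < b → G.Adj (z j k) (z j (k + 1))) : Conn G (seg z j a b) := by
  induction b, hab using Nat.le_induction with
  | base =>
    convert conn_singleton (G := G) (z j a)
    ext v
    constructor
    · rintro ⟨k, h1, h2, rfl⟩
      rw [show k = a by lia]
      rfl
    · rintro rfl
      exact mem_seg le_rfl le_rfl
  | succ b hb ih =>
    rw [seg_succ (by lia)]
    exact (ih fun k h1 h2 => h k h1 (by lia)).union_of_touch (conn_singleton _)
      ⟨_, mem_seg hb le_rfl, _, rfl, h b hb (by lia)⟩

/-- The rows `z j 0, …, z j (len j)`, for `j ∈ K`, are pairwise disjoint induced paths. -/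
structure Rows (G : SimpleGraph V) (K : Finset ℕ) (z : ℕ → ℕ → V) (len : ℕ → ℕ) : Prop where
  inj : ∀ i ∈ K, ∀ j ∈ K, ∀ a b, a ≤ len i → b ≤ len j → z i a = z j b → i = j ∧ a = b
  adj : ∀ i ∈ K, ∀ a b, a ≤ len i → b ≤ len i → (G.Adj (z i a) (z i b) ↔ a + 1 = b ∨ b + 1 = a)

namespace Rows

variable {K : Finset ℕ} {z : ℕ → ℕ → V} {len : ℕ → ℕ}

theorem mono (h : Rows G K z len) {K' : Finset ℕ} (hK : K' ⊆ K) {len' : ℕ → ℕ}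
    (hl : ∀ i ∈ K', len' i ≤ len i) : Rows G K' z len' where
  inj i hi j hj a b ha hb := h.inj i (hK hi) j (hK hj) a b (ha.trans (hl i hi)) (hb.trans (hl j hj))
  adj i hi a b ha hb := h.adj i (hK hi) a b (ha.trans (hl i hi)) (hb.trans (hl i hi))

theorem conn (h : Rows G K z len) {i : ℕ} (hi : i ∈ K) {a b : ℕ} (hab : a ≤ b) (hb : b ≤ len i) :
    Conn G (seg z i a b) :=
  conn_seg hab fun k _ hk => (h.adj i hi k (k + 1) (by lia) (by lia)).2 (Or.inl rfl)

theorem disjoint (h : Rows G K z len) {i j : ℕ} (hi : i ∈ K) (hj : j ∈ K) (hij : i ≠ j)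
    {a b a' b' : ℕ} (hb : b ≤ len i) (hb' : b' ≤ len j) :
    Disjoint (seg z i a b) (seg z j a' b') := by
  rw [Set.disjoint_left]
  rintro _ ⟨k, _, hk, rfl⟩ ⟨l, _, hl, hkl⟩
  exact hij (h.inj j hj i hi l k (by lia) (by lia) hkl).1.symm

theorem anticomplete_gap (h : Rows G K z len) {i : ℕ} (hi : i ∈ K) {a b a' b' : ℕ}
    (hb : b + 2 ≤ a') (hb' : b' ≤ len i) : Anticomplete G (seg z i a b) (seg z i a' b') := by
  refine anticomplete_iff.2 ⟨?_, ?_⟩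
  · rw [Set.disjoint_left]
    rintro _ ⟨k, _, hk, rfl⟩ ⟨l, hal, hl, hkl⟩
    have := (h.inj i hi i hi l k (by lia) (by lia) hkl).2
    lia
  · rintro ⟨_, ⟨k, _, hk, rfl⟩, _, ⟨l, hal, hl, rfl⟩, hadj⟩
    have := (h.adj i hi k l (by lia) (by lia)).1 hadj
    lia

/-- Few rows meet a set all of whose finite subsets are small. -/
theorem exists_avoiding (h : Rows G K z len) {Bad : Set V} {n : ℕ}
    (hbad : ∀ W : Finset V, (↑W : Set V) ⊆ Bad → W.card ≤ n) (hK : n < K.card) :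
    ∃ j ∈ K, ∀ a ≤ len j, z j a ∉ Bad := by
  by_contra hcon
  push Not at hcon
  choose! a ha hab using hcon
  have hinj : Set.InjOn (fun j => z j (a j)) K := fun i hi j hj hij =>
    (h.inj i hi j hj _ _ (ha i hi) (ha j hj) hij).1
  have := hbad (K.image fun j => z j (a j)) (by
    intro v hv
    obtain ⟨j, hj, rfl⟩ := Finset.mem_image.1 (Finset.mem_coe.1 hv)
    exact hab j hj)
  rw [Finset.card_image_of_injOn hinj] at this
  lia

end Rows

/-! ### States, the two kinds of tree models they yield, and linking -/

/-- A connected set `x` with rows that start at neighbours of `x` and touch pairwise. -/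
structure IsState (G : SimpleGraph V) (x : Set V) (K : Finset ℕ) (z : ℕ → ℕ → V) (len : ℕ → ℕ) :
    Prop where
  rows : Rows G K z len
  conn : Conn G x
  notMem : ∀ i ∈ K, ∀ a ≤ len i, z i a ∉ x
  start : ∀ i ∈ K, Touch G x {z i 0}
  anti : ∀ i ∈ K, ∀ a, 1 ≤ a → a ≤ len i → ¬ Touch G x {z i a}
  touch : ∀ i ∈ K, ∀ j ∈ K, i ≠ j → Touch G (seg z i 1 (len i)) (seg z j 1 (len j))

theorem touch_seg_right {X : Set V} {z : ℕ → ℕ → V} {j a b : ℕ} :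
    Touch G X (seg z j a b) ↔ ∃ k, a ≤ k ∧ k ≤ b ∧ Touch G X {z j k} := by
  constructor
  · rintro ⟨x, hx, _, ⟨k, h1, h2, rfl⟩, h⟩
    exact ⟨k, h1, h2, x, hx, _, rfl, h⟩
  · rintro ⟨k, h1, h2, h⟩
    exact h.mono subset_rfl (Set.singleton_subset_iff.2 (mem_seg h1 h2))

namespace IsState

variable {x : Set V} {K : Finset ℕ} {z : ℕ → ℕ → V} {len : ℕ → ℕ}

theorem truncate (h : IsState G x K z len) {K' : Finset ℕ} (hK : K' ⊆ K) {len' : ℕ → ℕ}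
    (hl : ∀ i ∈ K', len' i ≤ len i)
    (ht : ∀ i ∈ K', ∀ j ∈ K', i ≠ j → Touch G (seg z i 1 (len' i)) (seg z j 1 (len' j))) :
    IsState G x K' z len' where
  rows := h.rows.mono hK hl
  conn := h.conn
  notMem i hi a ha := h.notMem i (hK hi) a (ha.trans (hl i hi))
  start i hi := h.start i (hK hi)
  anti i hi a h1 ha := h.anti i (hK hi) a h1 (ha.trans (hl i hi))
  touch := ht

theorem one_le_len (h : IsState G x K z len) (hK : 2 ≤ K.card) {i : ℕ} (hi : i ∈ K) :
    1 ≤ len i := by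
  obtain ⟨j, hj, hji⟩ := Finset.exists_mem_ne (by lia : 1 < K.card) i
  obtain ⟨_, ⟨k, h1, h2, _⟩, _⟩ := h.touch i hi j hj hji.symm
  lia

theorem not_touch_seg (h : IsState G x K z len) {i : ℕ} (hi : i ∈ K) :
    ¬ Touch G x (seg z i 1 (len i)) := by
  rw [touch_seg_right]
  rintro ⟨k, h1, h2, h'⟩
  exact h.anti i hi k h1 h2 h'

theorem disjoint_seg (h : IsState G x K z len) {i : ℕ} (hi : i ∈ K) {a b : ℕ} (hb : b ≤ len i) :
    Disjoint x (seg z i a b) := by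
  rw [Set.disjoint_right]
  rintro _ ⟨k, _, hk, rfl⟩
  exact h.notMem i hi k (by lia)

end IsState

/-- A tree model containing `x` in its root and living on few rows. -/
def OutX (G : SimpleGraph V) (σ D u : ℕ) (x : Set V) (K : Finset ℕ) (z : ℕ → ℕ → V)
    (len : ℕ → ℕ) : Prop :=
  ∃ (R S : Set V) (J : Finset ℕ), J ⊆ K ∧ J.card ≤ u ∧ FT G σ D R S ∧ x ⊆ R ∧
    S ⊆ x ∪ ⋃ j ∈ J, seg z j 0 (len j)

/-- A tree model living on few rows whose root touches all other rows. -/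
def OutR (G : SimpleGraph V) (σ D u : ℕ) (K : Finset ℕ) (z : ℕ → ℕ → V) (len : ℕ → ℕ) : Prop :=
  ∃ (R S : Set V) (J : Finset ℕ), J ⊆ K ∧ J.card ≤ u ∧ FT G σ D R S ∧
    S ⊆ ⋃ j ∈ J, seg z j 1 (len j) ∧ ∀ j ∈ K, j ∉ J → Touch G (seg z j 1 (len j)) R

/-- Every state with at least `f t` rows yields one of the two kinds of tree models. -/
def GrowsWith (σ e D : ℕ) (f : ℕ → ℕ) (u : ℕ) : Prop :=
  ∀ (t : ℕ), 2 ≤ t → ∀ (V : Type w) (G : SimpleGraph V), G.CliqueFree t → NoBiclique G σ →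
    ∀ (x : Set V) (K : Finset ℕ) (z : ℕ → ℕ → V) (len : ℕ → ℕ), IsState G x K z len →
      f t ≤ K.card → OutX G σ D u x K z len ∨ OutR G σ e u K z len

/-- The number `u` of rows used does not depend on `t`, so that trees from several states can be
chosen greedily without conflicts. The radius `e` of `OutR` is separate from `D` to allow an
induction on `e` with `D` fixed. -/
def Grows (σ e D : ℕ) : Prop := ∃ f u, Poly f ∧ GrowsWith.{w} σ e D f u

/-- Linking a connected set to a tree model along a path. -/
theorem exists_link {d : ℕ} {S X Bad : Set V} (hXc : Conn G X) (hXS : Disjoint X S)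
    (hXt : ¬ Touch G X S)
    (hBad : ∀ (Y : Set V) (w : V), w ∈ Y → w ∉ Bad → Disjoint Y S → ¬ Touch G (Y \ {w}) S →
        Touch G {w} S → ∃ R' S', S' ⊆ S ∧ BT G d R' S' ∧ Attach G Y R' S')
    (z : ℕ → ℕ → V) (j p m : ℕ) (hv : ∀ k, p ≤ k → k ≤ m → z j k ∉ S ∧ z j k ∉ Bad)
    (hadj : ∀ k, p ≤ k → k < m → G.Adj (z j k) (z j (k + 1))) (hX : Touch G X (seg z j p m))
    (hS : Touch G (seg z j p m) S) :
    ∃ L ⊆ seg z j p m, Conn G (X ∪ L) ∧ ∃ R' S', S' ⊆ S ∧ BT G d R' S' ∧ Attach G (X ∪ L) R' S' := by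
  -- Choose a vertex touching `X` and one touching `S` at minimal distance along the row: then the
  -- second is the only vertex between them, ends included, that touches `S`.
  have hex : ∃ n a b, p ≤ a ∧ a ≤ m ∧ p ≤ b ∧ b ≤ m ∧ Touch G X {z j a} ∧ Touch G {z j b} S ∧
      n = (a - b) + (b - a) := by
    rw [touch_seg_right] at hX
    rw [touch_comm, touch_seg_right] at hS
    obtain ⟨a, h1, h2, h3⟩ := hX
    obtain ⟨b, h4, h5, h6⟩ := hS
    exact ⟨_, a, b, h1, h2, h4, h5, h3, h6.symm, rfl⟩
  obtain ⟨a, b, ha1, ha2, hb1, hb2, hXa, hSb, hn⟩ := Nat.find_spec hex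
  have hmin : ∀ k, p ≤ k → k ≤ m → Touch G {z j k} S →
      (a - b) + (b - a) ≤ (a - k) + (k - a) := fun k h1 h2 h => by
    rw [← hn]
    exact Nat.find_min' hex ⟨a, k, ha1, ha2, h1, h2, hXa, h, rfl⟩
  have hL : Conn G (seg z j (min a b) (max a b)) :=
    conn_seg (by lia) fun k h1 h2 => hadj k (by lia) (by lia)
  have hmem : z j b ∈ seg z j (min a b) (max a b) := mem_seg (by lia) (by lia)
  refine ⟨seg z j (min a b) (max a b), seg_mono (by lia) (by lia), hXc.union_of_touch hL
    (hXa.mono subset_rfl (Set.singleton_subset_iff.2 (mem_seg (by lia) (by lia)))),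
    hBad _ (z j b) (Or.inr hmem) (hv b hb1 hb2).2 ?_ ?_ hSb⟩
  · rw [Set.disjoint_union_left]
    refine ⟨hXS, Set.disjoint_left.2 ?_⟩
    rintro _ ⟨k, h1, h2, rfl⟩
    exact (hv k (by lia) (by lia)).1
  · rintro ⟨y, ⟨hy | ⟨k, h1, h2, rfl⟩, hyw⟩, s, hs, hys⟩
    · exact hXt ⟨y, hy, s, hs, hys⟩
    · have hkb : k ≠ b := by
        rintro rfl
        exact hyw rfl
      have := hmin k (by lia) (by lia) ⟨_, rfl, s, hs, hys⟩
      lia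

/-- In a large state at `y`, a set `x` touching `y` can be attached to a binary tree model. -/
theorem GrowsWith.exists_attach {σ D u : ℕ} {f : ℕ → ℕ} (hG : GrowsWith.{w} σ D D f u) {t : ℕ}
    (ht : 2 ≤ t) (hcf : G.CliqueFree t) (hb : NoBiclique G σ) {y : Set V} {K : Finset ℕ}
    {z : ℕ → ℕ → V} {len : ℕ → ℕ} (hst : IsState G y K z len)
    (hK : f t + u + badBound σ t + 1 ≤ K.card) {x : Set V} (hx : Conn G x) (hxy : Touch G x y)
    (hdy : Disjoint x y) (hxz : ∀ j ∈ K, Anticomplete G x (seg z j 0 (len j))) :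
    ∃ J ⊆ K, J.card ≤ u + 1 ∧ ∃ L R' S', Conn G (x ∪ L) ∧ BT G D R' S' ∧
      Attach G (x ∪ L) R' S' ∧ L ∪ S' ⊆ y ∪ ⋃ j ∈ J, seg z j 0 (len j) := by
  have hxJ : ∀ J ⊆ K, Anticomplete G x (⋃ j ∈ J, seg z j 0 (len j)) := by
    intro J hJ
    refine ⟨?_, ?_⟩
    · simp only [Set.disjoint_iUnion_right]
      exact fun j hj => (hxz j (hJ hj)).1
    · intro v hv w hw
      simp only [Set.mem_iUnion] at hw
      obtain ⟨j, hj, hw⟩ := hw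
      exact (hxz j (hJ hj)).2 v hv w hw
  -- In the first outcome `x` touches the tree only through `y`, which lies in the root, so any two
  -- children can be kept. In the second, a row outside `J` that avoids the exceptional vertices
  -- links `x ∪ y` to the tree.
  rcases hG t ht V G hcf hb y K z len hst (by lia) with
    ⟨R, S, J, hJK, hJ, hFT, hyR, hS⟩ | ⟨R, S, J, hJK, hJ, hFT, hS, hR⟩
  · obtain ⟨S', hS', hBT, hA⟩ := hFT.exists_bt (Y := x)
      ((Set.disjoint_union_right.2 ⟨hdy, (hxJ J hJK).1⟩).mono_right hS)
      (hxy.mono subset_rfl hyR) (by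
        rintro ⟨v, hv, w, ⟨hw, hwR⟩, hvw⟩
        rcases hS hw with hw | hw
        · exact hwR (hyR hw)
        · exact (hxJ J hJK).2 v hv w hw hvw)
    exact ⟨J, hJK, by lia, ∅, R, S', by simpa using hx, hBT, by simpa using hA,
      Set.union_subset (Set.empty_subset _) (hS'.trans hS)⟩
  · obtain ⟨Bad, hW, hBad⟩ := hFT.exists_bad hb hcf (by lia)
    have hcard : badBound σ t < (K \ J).card := by
      have := Finset.le_card_sdiff J K
      lia
    obtain ⟨j, hj, hjb⟩ := (hst.rows.mono (Finset.sdiff_subset (t := J)) fun _ _ => le_rfl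
      ).exists_avoiding hW hcard
    rw [Finset.mem_sdiff] at hj
    have hS0 : S ⊆ ⋃ j ∈ J, seg z j 0 (len j) :=
      hS.trans (Set.iUnion₂_mono fun j _ => seg_mono (by lia) le_rfl)
    obtain ⟨L, hL, hLc, R', S', hS', hBT, hA⟩ := exists_link (X := x ∪ y) (hx.union_of_touch
      hst.conn hxy) (Set.disjoint_union_left.2 ⟨(hxJ J hJK).1.mono_right hS0, by
        refine Disjoint.mono_right hS0 ?_
        simp only [Set.disjoint_iUnion_right]
        exact fun i hi => hst.disjoint_seg (hJK hi) le_rfl⟩)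
      (by
        rw [touch_union_left, not_or]
        refine ⟨fun h => (anticomplete_iff.1 (hxJ J hJK)).2 (h.mono subset_rfl hS0), ?_⟩
        rintro ⟨v, hv, w, hw, hvw⟩
        have := hS hw
        simp only [Set.mem_iUnion] at this
        obtain ⟨i, hi, hw'⟩ := this
        exact hst.not_touch_seg (hJK hi) ⟨v, hv, w, hw', hvw⟩) hBad z j 0 (len j)
      (fun k _ hk => ⟨fun hkS => by
        have := hS hkS
        simp only [Set.mem_iUnion] at this
        obtain ⟨i, hi, l, _, hl, hli⟩ := this
        have := (hst.rows.inj i (hJK hi) j hj.1 l k hl hk hli).1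
        exact hj.2 (this ▸ hi), hjb k hk⟩)
      (fun k _ hk => (hst.rows.adj j hj.1 k (k + 1) (by lia) (by lia)).2 (Or.inl rfl))
      (touch_union_left.2 (Or.inr ((hst.start j hj.1).mono subset_rfl
        (Set.singleton_subset_iff.2 (mem_seg le_rfl (by lia))))))
      ((hR j hj.1 hj.2).mono (seg_mono (by lia) le_rfl) hFT.root_subset)
    refine ⟨insert j J, Finset.insert_subset hj.1 hJK,
      (Finset.card_insert_le _ _).trans (by lia), y ∪ L, R', S', by rwa [← Set.union_assoc], hBT,
      by rwa [← Set.union_assoc], ?_⟩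
    rw [Finset.set_biUnion_insert]
    refine Set.union_subset (Set.union_subset_union_right _ (hL.trans Set.subset_union_left)) ?_
    exact (hS'.trans hS0).trans (Set.subset_union_right.trans Set.subset_union_right)

/-- Greedy choice of small index sets avoiding sparse conflicts. -/
theorem exists_greedy {W : Finset ℕ} {b v n0 : ℕ} (n : ℕ) (P : ℕ → Finset ℕ → Prop)
    (C : ℕ → ℕ → ℕ → ℕ → Prop)
    (hP : ∀ h < n, ∀ U ⊆ W, n0 ≤ U.card → ∃ J ⊆ U, J.card ≤ v ∧ P h J)
    (hC : ∀ h < n, ∀ l < n, h ≠ l → ∀ i ∈ W, (W.filter fun j => C h l i j).card ≤ b)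
    (hCs : ∀ h < n, ∀ l < n, h ≠ l → ∀ i ∈ W, ∀ j ∈ W, C h l i j → C l h j i)
    (hW : n0 + n * (v * (b + 1)) ≤ W.card) :
    ∃ J : ℕ → Finset ℕ, (∀ h < n, J h ⊆ W ∧ (J h).card ≤ v ∧ P h (J h)) ∧
      ∀ h < n, ∀ l < n, h ≠ l → ∀ i ∈ J h, ∀ j ∈ J l, i ≠ j ∧ ¬ C h l i j := by
  suffices H : ∀ m ≤ n, ∃ J : ℕ → Finset ℕ, (∀ h < m, J h ⊆ W ∧ (J h).card ≤ v ∧ P h (J h)) ∧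
      ∀ h < m, ∀ l < m, h ≠ l → ∀ i ∈ J h, ∀ j ∈ J l, i ≠ j ∧ ¬ C h l i j from H n le_rfl
  intro m
  induction m with
  | zero => exact fun _ => ⟨fun _ => ∅, by simp, by simp⟩
  | succ m ih =>
    intro hm
    obtain ⟨J, hJ, hJJ⟩ := ih (by lia)
    -- Every index chosen so far forbids itself and its at most `b` conflicts.
    let D : Finset ℕ := (Finset.range m).biUnion fun h => (J h).biUnion fun i =>
      (W.filter fun j => C h m i j) ∪ {i}
    have hD : D.card ≤ n * (v * (b + 1)) := by
      have h1 : D.card ≤ (Finset.range m).card * (v * (b + 1)) := by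
        refine Finset.card_biUnion_le_card_mul _ _ _ fun h hh => ?_
        have hh := Finset.mem_range.1 hh
        refine (Finset.card_biUnion_le_card_mul _ _ (b + 1) fun i hi => ?_).trans
          (Nat.mul_le_mul_right _ (hJ h hh).2.1)
        refine (Finset.card_union_le _ _).trans ?_
        rw [Finset.card_singleton]
        exact Nat.add_le_add_right (hC h (by lia) m (by lia) (by lia) i ((hJ h hh).1 hi)) 1
      rw [Finset.card_range] at h1
      exact h1.trans (Nat.mul_le_mul_right _ (by lia))
    obtain ⟨J', hJ', hc, hPJ⟩ := hP m (by lia) (W \ D) Finset.sdiff_subset (by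
      have := Finset.le_card_sdiff D W
      lia)
    have hnew : ∀ h < m, ∀ i ∈ J h, ∀ j ∈ J', i ≠ j ∧ ¬ C h m i j := by
      intro h hh i hi j hj
      have hjD := Finset.mem_sdiff.1 (hJ' hj)
      have : ∀ k, k ∈ (W.filter fun j => C h m i j) ∪ {i} → k ∈ D := fun k hk =>
        Finset.mem_biUnion.2 ⟨h, Finset.mem_range.2 hh, Finset.mem_biUnion.2 ⟨i, hi, hk⟩⟩
      constructor
      · rintro rfl
        exact hjD.2 (this i (by simp))
      · exact fun hCC => hjD.2 (this j (by simp [hjD.1, hCC]))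
    have hJ'W := hJ'.trans Finset.sdiff_subset
    refine ⟨Function.update J m J', fun h hh => ?_, fun h hh l hl hhl => ?_⟩
    · rcases eq_or_ne h m with rfl | hne
      · rw [Function.update_self]
        exact ⟨hJ'W, hc, hPJ⟩
      · rw [Function.update_of_ne hne]
        exact hJ h (by lia)
    · rcases eq_or_ne h m with he | hne <;> rcases eq_or_ne l m with he' | hne'
      · exact absurd (he.trans he'.symm) hhl
      · subst he
        rw [Function.update_self, Function.update_of_ne hne']
        intro i hi j hj
        have := hnew l (by lia) j hj i hi
        exact ⟨this.1.symm, fun hCC => this.2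
          (hCs h (by lia) l (by lia) hhl i (hJ'W hi) j ((hJ l (by lia)).1 hj) hCC)⟩
      · subst he'
        rw [Function.update_self, Function.update_of_ne hne]
        exact hnew h (by lia)
      · rw [Function.update_of_ne hne, Function.update_of_ne hne']
        exact hJJ h (by lia) l (by lia) hhl

/-! ### Rows that touch many common hubs -/

theorem Poly.multiRamseyBound (s n : ℕ) {a : ℕ → ℕ} (ha : Poly a) :
    Poly fun t => multiRamseyBound s (a t) n := by
  induction n with
  | zero => exact ha
  | succ n ih => exact ((Poly.const 2).mul ih).pow s

/-- Segments `α r j, …, ω r j` of the rows `j ∈ W`, for `r < M`, such that `β r` touches the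
`r`-th segment only in its last vertex. -/
structure Regions (G : SimpleGraph V) (M : ℕ) (β : ℕ → Set V) (W : Finset ℕ) (z : ℕ → ℕ → V)
    (len : ℕ → ℕ) (α ω : ℕ → ℕ → ℕ) : Prop where
  rows : Rows G W z len
  conn : ∀ r < M, Conn G (β r)
  anti : ∀ r < M, ∀ s < M, r ≠ s → Anticomplete G (β r) (β s)
  disj : ∀ r < M, ∀ j ∈ W, Disjoint (β r) (seg z j 1 (len j))
  one_le : ∀ r < M, ∀ j ∈ W, 1 ≤ α r j
  lt : ∀ r < M, ∀ j ∈ W, α r j < ω r j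
  le_len : ∀ r < M, ∀ j ∈ W, ω r j ≤ len j
  gap : ∀ r < M, ∀ s < M, r < s → ∀ j ∈ W, ω r j + 2 ≤ α s j
  last : ∀ r < M, ∀ j ∈ W, Touch G (β r) {z j (ω r j)}
  not_touch : ∀ r < M, ∀ j ∈ W, ∀ a, α r j ≤ a → a < ω r j → ¬ Touch G (β r) {z j a}
  touch : ∀ r < M, ∀ i ∈ W, ∀ j ∈ W, i ≠ j →
    Touch G (seg z i (α r i) (ω r i - 1)) (seg z j (α r j) (ω r j - 1))

/-- Pigeonhole over the `N!` sorting permutations: all rows kept meet the hubs in the same weak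
order. -/
theorem exists_sorted_hubs {N : ℕ} (hN : 0 < N) (F : ℕ → ℕ → ℕ) (K : Finset ℕ) :
    ∃ (g : ℕ → ℕ) (K' : Finset ℕ), K' ⊆ K ∧ K.card ≤ N.factorial * K'.card ∧ (∀ k, g k < N) ∧
      (∀ k < N, ∀ l < N, g k = g l → k = l) ∧
      ∀ j ∈ K', ∀ k l, k ≤ l → l < N → F j (g k) ≤ F j (g l) := by
  obtain ⟨π, -, K', hK', hKπ, hπ⟩ := exists_fiber (s := K)
    (f := fun j => Tuple.sort fun k : Fin N => F j k) (t := Finset.univ)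
    (fun _ _ => Finset.mem_univ _) ⟨1, Finset.mem_univ _⟩
  refine ⟨fun k => π ⟨k % N, Nat.mod_lt _ hN⟩, K', hK', ?_,
    fun k => (π _).2, fun k hk l hl hkl => ?_, fun j hj k l hkl hl => ?_⟩
  · rwa [Finset.card_univ, Fintype.card_perm, Fintype.card_fin] at hπ
  · have := π.injective (Fin.ext hkl)
    rw [Fin.mk.injEq, Nat.mod_eq_of_lt hk, Nat.mod_eq_of_lt hl] at this
    exact this
  · have hj' := hKπ j hj
    have := Tuple.monotone_sort (fun k : Fin N => F j k)
    rw [hj'] at this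
    refine this ?_
    rw [Fin.mk_le_mk, Nat.mod_eq_of_lt hl, Nat.mod_eq_of_lt (by lia)]
    exact hkl

/-- After removal of the few rows with a vertex touching `σ` hubs, and with the hubs sorted by first
contact, every step of `σ` hubs moves strictly forward along each row. Each region owns `4σ`
consecutive hubs. The `σ` of them first met inside its segments forbid `σ` pairwise non-touching
segments, so Ramsey makes the segments touch pairwise; a later hub ends the segments and becomes the
centre `β r`. -/
theorem exists_regions {σ M t w N : ℕ} (hσ : 1 ≤ σ) (hM : 1 ≤ M) (hw : 1 ≤ w) (ht : 1 ≤ t)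
    (hcf : G.CliqueFree t) (hb : NoBiclique G σ) (hN : N = 4 * σ * M) {I : ℕ → Set V}
    {K : Finset ℕ} {z : ℕ → ℕ → V} {len : ℕ → ℕ} (hr : Rows G K z len)
    (hI : ∀ k < N, Conn G (I k)) (hII : ∀ k < N, ∀ l < N, k ≠ l → Anticomplete G (I k) (I l))
    (hIz : ∀ k < N, ∀ j ∈ K, Disjoint (I k) (seg z j 1 (len j)))
    (hIt : ∀ k < N, ∀ j ∈ K, Touch G (I k) (seg z j 1 (len j)))
    (hK : N ^ σ * (2 * t) ^ σ + N.factorial * multiRamseyBound σ w M ≤ K.card) :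
    ∃ (b : ℕ → ℕ) (W : Finset ℕ) (α ω : ℕ → ℕ → ℕ), W ⊆ K ∧ W.card = w ∧ (∀ r < M, b r < N) ∧
      Regions G M (fun r => I (b r)) W z len α ω := by
  have hN0 : 0 < N := by rw [hN]; positivity
  let Bad : Set V := {v | (∀ i : Fin N, v ∉ I i) ∧
    σ ≤ (Finset.univ.filter fun i : Fin N => Touch G {v} (I i)).card}
  have hBad : ∀ W : Finset V, (↑W : Set V) ⊆ Bad → W.card ≤ N ^ σ * (2 * t) ^ σ := fun W hW =>
    card_le_of_touch_many hb hcf ht (fun i : Fin N => I i) (fun i => hI i i.2)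
      (fun i j hij => hII i i.2 j j.2 fun h => hij (Fin.ext h)) W fun v hv => hW hv
  obtain ⟨Good, hGood⟩ : ∃ P : ℕ → Prop, ∀ j, P j ↔ ∀ a, 1 ≤ a → a ≤ len j → z j a ∉ Bad :=
    ⟨_, fun _ => Iff.rfl⟩
  let K1 := K.filter Good
  have hK1K : K1 ⊆ K := Finset.filter_subset _ _
  have hK1 : N.factorial * multiRamseyBound σ w M ≤ K1.card := by
    have h1 : (K \ K1).card ≤ N ^ σ * (2 * t) ^ σ := by
      by_contra hlt
      obtain ⟨j, hj, hjb⟩ := (hr.mono (Finset.sdiff_subset (t := K1)) fun _ _ => le_rfl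
        ).exists_avoiding hBad (not_le.1 hlt)
      rw [Finset.mem_sdiff] at hj
      exact hj.2 (Finset.mem_filter.2 ⟨hj.1, (hGood j).2 fun a _ => hjb a⟩)
    have h2 := Finset.card_sdiff_add_card_eq_card hK1K
    lia
  have hex : ∀ j ∈ K, ∀ k < N, ∃ a, 1 ≤ a ∧ a ≤ len j ∧ Touch G (I k) {z j a} := fun j hj k hk =>
    touch_seg_right.1 (hIt k hk j hj)
  let F : ℕ → ℕ → ℕ := fun j k => sInf {a | 1 ≤ a ∧ a ≤ len j ∧ Touch G (I k) {z j a}}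
  have hF : ∀ j ∈ K, ∀ k < N, 1 ≤ F j k ∧ F j k ≤ len j ∧ Touch G (I k) {z j (F j k)} :=
    fun j hj k hk => Nat.sInf_mem (hex j hj k hk)
  have hFmin : ∀ j ∈ K, ∀ k < N, ∀ a, 1 ≤ a → a < F j k → ¬ Touch G (I k) {z j a} :=
    fun j hj k hk a h1 ha h => by
      have := (hF j hj k hk).2.1
      exact absurd (Nat.sInf_le (show a ∈ {a | 1 ≤ a ∧ a ≤ len j ∧ Touch G (I k) {z j a}} from
        ⟨h1, by lia, h⟩)) (not_le.2 ha)
  obtain ⟨g, K2, hK2, hc, hgN, hginj, hmono⟩ := exists_sorted_hubs hN0 F K1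
  have hK2K := hK2.trans hK1K
  have hK2c : multiRamseyBound σ w M ≤ K2.card :=
    Nat.le_of_mul_le_mul_left (hK1.trans hc) N.factorial_pos
  -- Equality would make `σ` hubs have their first contact at one vertex, which a good row excludes.
  have hstrict : ∀ j ∈ K2, ∀ k, k + σ < N → F j (g k) < F j (g (k + σ)) := by
    intro j hj k hk
    refine lt_of_le_of_ne (hmono j hj k _ (by lia) hk) fun heq => ?_
    have hall : ∀ i < σ, F j (g (k + i)) = F j (g k) := fun i hi => by
      have h1 := hmono j hj k (k + i) (by lia) (by lia)
      have h2 := hmono j hj (k + i) (k + σ) (by lia) hk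
      lia
    have hjK := hK2K hj
    have hFk := hF j hjK (g k) (hgN k)
    refine (hGood j).1 (Finset.mem_filter.1 (hK2 hj)).2 _ hFk.1 hFk.2.1 ⟨fun i hi => ?_, ?_⟩
    · exact Set.disjoint_left.1 (hIz i i.2 j hjK) hi (mem_seg hFk.1 hFk.2.1)
    · refine Finset.le_card_of_inj_on_range (fun i => ⟨g (k + i), hgN _⟩) (fun i hi => ?_)
        fun i hi i' hi' h => ?_
      · rw [Finset.mem_filter]
        refine ⟨Finset.mem_univ _, ?_⟩
        rw [← hall i hi]
        exact (hF j hjK _ (hgN _)).2.2.symm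
      · have := hginj _ (by lia) _ (by lia) (Fin.mk.inj h)
        lia
  have hidx : ∀ r < M, 4 * σ * r + 4 * σ ≤ N := fun r hr => by
    have : 4 * σ * (r + 1) ≤ 4 * σ * M := Nat.mul_le_mul_left _ hr
    rw [hN]
    lia
  -- The hubs with offsets `σ, …, 2σ - 1` are first met between `α` and `ω - 1`; the hub with offset
  -- `3σ` is first met at `ω`, so it touches its segment only there.
  let α : ℕ → ℕ → ℕ := fun r j => F j (g (4 * σ * r + σ))
  let ω : ℕ → ℕ → ℕ := fun r j => F j (g (4 * σ * r + 3 * σ))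
  have hα2 : ∀ r < M, ∀ j ∈ K2, ∀ i < σ, α r j ≤ F j (g (4 * σ * r + σ + i)) ∧
      F j (g (4 * σ * r + σ + i)) < ω r j := fun r hrM j hj i hi => by
    have := hidx r hrM
    have h1 := hmono j hj (4 * σ * r + σ) (4 * σ * r + σ + i) (by lia) (by lia)
    have h2 := hstrict j hj (4 * σ * r + σ + i) (by lia)
    have h3 := hmono j hj (4 * σ * r + σ + i + σ) (4 * σ * r + 3 * σ) (by lia) (by lia)
    exact ⟨h1, by simp only [ω]; lia⟩
  have hle : ∀ r < M, ∀ j ∈ K2, ω r j ≤ len j := fun r _ j hj => (hF j (hK2K hj) _ (hgN _)).2.1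
  have h1α : ∀ r < M, ∀ j ∈ K2, 1 ≤ α r j := fun r _ j hj => (hF j (hK2K hj) _ (hgN _)).1
  have hlt : ∀ r < M, ∀ j ∈ K2, α r j < ω r j := fun r hrM j hj => by
    have := hα2 r hrM j hj 0 (by lia)
    lia
  obtain ⟨W, hWK, hWc, hW⟩ := multi_ramsey (s := σ) hw M
    (fun r i j => ¬ Touch G (seg z i (α r i) (ω r i - 1)) (seg z j (α r j) (ω r j - 1))) K2 hK2c (by
      rintro r hrM ⟨Q, hQ, hQc, hQt⟩
      have hidxr := hidx r hrM
      refine hb.elim (Finset.range σ) Q (fun i => I (g (4 * σ * r + σ + i)))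
        (fun j => seg z j (α r j) (ω r j - 1)) (by simp) hQc.ge (fun i _ => hI _ (hgN _))
        (fun j hj => ?_) (fun i hi i' hi' hii => ?_) (fun i hi j hj hij => ?_) (fun i hi j hj => ?_)
        (fun i hi j hj => ?_)
      · have := hlt r hrM j (hQ hj)
        have := hle r hrM j (hQ hj)
        exact hr.conn (hK2K (hQ hj)) (by lia) (by lia)
      · rw [Finset.mem_range] at hi hi'
        refine hII _ (hgN _) _ (hgN _) fun h => hii ?_
        have := hginj _ (by lia) _ (by lia) h
        lia
      · have h1 := hle r hrM i (hQ hi)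
        have h2 := hle r hrM j (hQ hj)
        refine anticomplete_iff.2
          ⟨hr.disjoint (hK2K (hQ hi)) (hK2K (hQ hj)) hij (by lia) (by lia), ?_⟩
        rcases hij.lt_or_gt with h | h
        · exact hQt i hi j hj h
        · exact fun h' => hQt j hj i hi h h'.symm
      · exact (hIz _ (hgN _) j (hK2K (hQ hj))).mono_right
          (seg_mono (h1α r hrM j (hQ hj)) (by have := hle r hrM j (hQ hj); lia))
      · have h1 := hα2 r hrM j (hQ hj) i (Finset.mem_range.1 hi)
        exact touch_seg_right.2 ⟨_, h1.1, by lia, (hF j (hK2K (hQ hj)) _ (hgN _)).2.2⟩)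
  have hWK' := hWK.trans hK2K
  refine ⟨fun r => g (4 * σ * r + 3 * σ), W, α, ω, hWK', hWc, fun r _ => hgN _, ?_⟩
  refine ⟨hr.mono hWK' fun _ _ => le_rfl, fun r _ => hI _ (hgN _), fun r hrM s hs hrs => ?_,
    fun r _ j hj => hIz _ (hgN _) j (hWK' hj), fun r hrM j hj => h1α r hrM j (hWK hj),
    fun r hrM j hj => hlt r hrM j (hWK hj), fun r hrM j hj => hle r hrM j (hWK hj), ?_,
    fun r _ j hj => (hF j (hWK' hj) _ (hgN _)).2.2, ?_, ?_⟩
  · refine hII _ (hgN _) _ (hgN _) fun h => hrs ?_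
    have h1 := hidx r hrM
    have h2 := hidx s hs
    have := hginj _ (by lia) _ (by lia) h
    exact Nat.eq_of_mul_eq_mul_left (by lia : 0 < 4 * σ) (by lia)
  -- Offset `3σ` of region `r` and offset `σ` of region `r + 1` are `2σ` apart, which gives two
  -- strict increases and hence a gap of two.
  · intro r hrM s hs hrs j hj
    have h1 := hidx s hs
    have h2 : 4 * σ * (r + 1) ≤ 4 * σ * s := Nat.mul_le_mul_left _ hrs
    have h3 := hstrict j (hWK hj) (4 * σ * r + 3 * σ) (by lia)
    have h4 := hstrict j (hWK hj) (4 * σ * r + 3 * σ + σ) (by lia)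
    have h5 := hmono j (hWK hj) (4 * σ * r + 3 * σ + σ + σ) (4 * σ * s + σ) (by lia) (by lia)
    simp only [α, ω]
    lia
  · intro r hrM j hj a ha1 ha2
    exact hFmin j (hWK' hj) _ (hgN _) a ((h1α r hrM j (hWK hj)).trans ha1) ha2
  · intro r hrM i hi j hj hij
    rcases hij.lt_or_gt with h | h
    · exact not_not.1 (hW r hrM i hi j hj h)
    · exact (not_not.1 (hW r hrM j hj i hi h)).symm

/-- Size of a clique of dense relations in which one finds a grid. -/
def gridBound (E σ : ℕ) : ℕ :=
  (2 * E * σ + 1) ^ σ * (4 * E * (2 * E * σ + 1) ^ σ * σ + 1) + (2 * E * σ + 1)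

theorem exists_grid_of_clique {κ : Type*} (p : ℕ → ℕ → κ → Prop) {E σ : ℕ} (hE : 1 ≤ E)
    (Q : Finset ℕ) (C : Finset κ) (hC : C.Nonempty) (hQ : Q.card = 2 * gridBound E σ)
    (h : ∀ r ∈ Q, ∀ s ∈ Q, r < s → C.card ≤ E * (C.filter fun c => p r s c).card) :
    ∃ S ⊆ Q, ∃ T ⊆ Q, ∃ c ∈ C, S.card = σ ∧ T.card = σ ∧ ∀ r ∈ S, ∀ s ∈ T, r < s ∧ p r s c := by
  obtain ⟨S, hS, T, hT, hSc, hTc, hST⟩ := exists_halves Q hQ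
  obtain ⟨T', hT', hT'c⟩ := Finset.exists_subset_card_eq
    (show 2 * E * σ + 1 ≤ T.card by rw [hTc]; exact Nat.le_add_left _ _)
  obtain ⟨H, hH, H', hH', c, hc, hHc, hHc', hp⟩ := exists_grid p hE S T' C hC hT'c.ge
    (by rw [hSc, hT'c]; exact Nat.le_add_right _ _)
    (fun r hr s hs => h r (hS hr) s (hT (hT' hs)) (hST r hr s (hT' hs)))
  exact ⟨H, hH.trans hS, H', (hH'.trans hT').trans hT, c, hc, hHc, hHc', fun r hr s hs =>
    ⟨hST r (hH hr) s (hT' (hH' hs)), hp r hr s hs⟩⟩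

/-- Some of the regions have few contacts between different rows and with each other's hubs. -/
theorem Regions.exists_sparse {σ M A E : ℕ} (hb : NoBiclique G σ) (hE : 1 ≤ E) (hA : 1 ≤ A)
    {β : ℕ → Set V} {W : Finset ℕ} {z : ℕ → ℕ → V} {len : ℕ → ℕ} {α ω : ℕ → ℕ → ℕ}
    (h : Regions G M β W z len α ω) (hW : W.Nonempty)
    (hM : multiRamseyBound (2 * gridBound E σ) A 3 ≤ M) :
    ∃ T ⊆ Finset.range M, T.card = A ∧ ∀ r ∈ T, ∀ s ∈ T, r ≠ s →
      E * ((W ×ˢ W).filter fun c => c.1 ≠ c.2 ∧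
        Touch G (seg z c.1 (α r c.1) (ω r c.1)) (seg z c.2 (α s c.2) (ω s c.2))).card
        ≤ W.card * W.card ∧
      E * (W.filter fun j => Touch G (β r) (seg z j (α s j) (ω s j))).card ≤ W.card := by
  let O : ℕ → ℕ → Set V := fun r j => seg z j (α r j) (ω r j)
  have hO : ∀ r < M, ∀ j ∈ W, Conn G (O r j) := fun r hr j hj =>
    h.rows.conn hj (h.lt r hr j hj).le (h.le_len r hr j hj)
  have hOO : ∀ r < M, ∀ s < M, r ≠ s → ∀ j ∈ W, Anticomplete G (O r j) (O s j) := by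
    intro r hr s hs hrs j hj
    rcases hrs.lt_or_gt with hlt | hlt
    · exact h.rows.anticomplete_gap hj (h.gap r hr s hs hlt j hj) (h.le_len s hs j hj)
    · exact (h.rows.anticomplete_gap hj (h.gap s hs r hr hlt j hj) (h.le_len r hr j hj)).symm
  have hOd : ∀ r < M, ∀ s < M, ∀ i ∈ W, ∀ j ∈ W, i ≠ j → Disjoint (O r i) (O s j) :=
    fun r hr s hs i hi j hj hij =>
      h.rows.disjoint hi hj hij (h.le_len r hr i hi) (h.le_len s hs j hj)
  have hβO : ∀ r < M, ∀ s < M, ∀ j ∈ W, Disjoint (β r) (O s j) := fun r hr s hs j hj =>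
    (h.disj r hr j hj).mono_right (seg_mono (h.one_le s hs j hj) (h.le_len s hs j hj))
  let p0 : ℕ → ℕ → ℕ × ℕ → Prop := fun r s c => c.1 ≠ c.2 ∧ Touch G (O r c.1) (O s c.2)
  let p1 : ℕ → ℕ → ℕ → Prop := fun r s j => Touch G (β r) (O s j)
  let p2 : ℕ → ℕ → ℕ → Prop := fun r s j => Touch G (β s) (O r j)
  let D0 : ℕ → ℕ → Prop := fun r s => W.card * W.card < E * ((W ×ˢ W).filter fun c => p0 r s c).card
  let D1 : ℕ → ℕ → Prop := fun r s => W.card < E * (W.filter fun c => p1 r s c).card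
  let D2 : ℕ → ℕ → Prop := fun r s => W.card < E * (W.filter fun c => p2 r s c).card
  -- A large clique of dense pairs would yield a fixed pair of rows, or a fixed row, and `σ + σ`
  -- regions with all contacts present: a biclique. `D1` and `D2` are the two orders of the contact
  -- between hubs and segments, since the Ramsey lemma only sees `r < s`.
  obtain ⟨T, hT, hTc, hTD⟩ := multi_ramsey (s := 2 * gridBound E σ) hA 3
    (fun l => if l = 0 then D0 else if l = 1 then D1 else D2) (Finset.range M) (by simpa using hM) (by
      intro l hl
      rintro ⟨Q, hQ, hQc, hcl⟩
      have hQM : ∀ r ∈ Q, r < M := fun r hr => Finset.mem_range.1 (hQ hr)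
      interval_cases l
      · obtain ⟨S, hS, T, hT, c, hc, hSc, hTc, hp⟩ := exists_grid_of_clique p0 hE Q (W ×ˢ W)
          (hW.product hW) hQc (fun r hr s hs hrs => by
            rw [Finset.card_product]
            have h0 : W.card * W.card < E * ((W ×ˢ W).filter fun c => p0 r s c).card :=
              hcl r hr s hs hrs
            refine h0.le.trans (le_of_eq ?_)
            congr!)
        rw [Finset.mem_product] at hc
        exact hb.elim S T (fun r => O r c.1) (fun r => O r c.2) hSc.ge hTc.ge
          (fun r hr => hO r (hQM r (hS hr)) _ hc.1) (fun r hr => hO r (hQM r (hT hr)) _ hc.2)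
          (fun r hr s hs hrs => hOO r (hQM r (hS hr)) s (hQM s (hS hs)) hrs _ hc.1)
          (fun r hr s hs hrs => hOO r (hQM r (hT hr)) s (hQM s (hT hs)) hrs _ hc.2)
          (fun r hr s hs => hOd r (hQM r (hS hr)) s (hQM s (hT hs)) _ hc.1 _ hc.2
            (hp r hr s hs).2.1)
          (fun r hr s hs => (hp r hr s hs).2.2)
      · obtain ⟨S, hS, T, hT, c, hc, hSc, hTc, hp⟩ := exists_grid_of_clique p1 hE Q W hW hQc
          (fun r hr s hs hrs => (hcl r hr s hs hrs).le)
        exact hb.elim S T β (fun r => O r c) hSc.ge hTc.ge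
          (fun r hr => h.conn r (hQM r (hS hr))) (fun r hr => hO r (hQM r (hT hr)) _ hc)
          (fun r hr s hs hrs => h.anti r (hQM r (hS hr)) s (hQM s (hS hs)) hrs)
          (fun r hr s hs hrs => hOO r (hQM r (hT hr)) s (hQM s (hT hs)) hrs _ hc)
          (fun r hr s hs => hβO r (hQM r (hS hr)) s (hQM s (hT hs)) _ hc)
          (fun r hr s hs => (hp r hr s hs).2)
      · obtain ⟨S, hS, T, hT, c, hc, hSc, hTc, hp⟩ := exists_grid_of_clique p2 hE Q W hW hQc
          (fun r hr s hs hrs => (hcl r hr s hs hrs).le)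
        exact hb.elim T S β (fun r => O r c) hTc.ge hSc.ge
          (fun r hr => h.conn r (hQM r (hT hr))) (fun r hr => hO r (hQM r (hS hr)) _ hc)
          (fun r hr s hs hrs => h.anti r (hQM r (hT hr)) s (hQM s (hT hs)) hrs)
          (fun r hr s hs hrs => hOO r (hQM r (hS hr)) s (hQM s (hS hs)) hrs _ hc)
          (fun r hr s hs => hβO r (hQM r (hT hr)) s (hQM s (hS hs)) _ hc)
          (fun r hr s hs => (hp s hs r hr).2))
  have h0 : ∀ r ∈ T, ∀ s ∈ T, r < s → ¬ D0 r s := hTD 0 (by lia)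
  have h1 : ∀ r ∈ T, ∀ s ∈ T, r < s → ¬ D1 r s := hTD 1 (by lia)
  have h2 : ∀ r ∈ T, ∀ s ∈ T, r < s → ¬ D2 r s := hTD 2 (by lia)
  refine ⟨T, hT, hTc, fun r hr s hs hrs => ?_⟩
  rcases hrs.lt_or_gt with hlt | hlt
  · exact ⟨not_lt.1 (h0 r hr s hs hlt), not_lt.1 (h1 r hr s hs hlt)⟩
  · refine ⟨?_, not_lt.1 (h2 s hs r hr hlt)⟩
    refine le_trans (Nat.mul_le_mul_left _ ?_) (not_lt.1 (h0 s hs r hr hlt))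
    refine Finset.card_le_card_of_injOn Prod.swap ?_ Prod.swap_injective.injOn
    rintro ⟨i, j⟩ hc
    simp only [Finset.coe_filter, Finset.mem_product, Set.mem_ofPred_eq, p0, O, Prod.swap] at hc ⊢
    exact ⟨hc.1.symm, hc.2.1.symm, hc.2.2.symm⟩

theorem exists_enum {n : ℕ} (T : Finset ℕ) (hT : T.card = n) :
    ∃ ρ : ℕ → ℕ, (∀ h < n, ρ h ∈ T) ∧ ∀ h < n, ∀ l < n, ρ h = ρ l → h = l := by
  rcases Nat.eq_zero_or_pos n with rfl | hn
  · exact ⟨fun h => h, by simp, by simp⟩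
  refine ⟨fun h => T.orderEmbOfFin hT ⟨h % n, Nat.mod_lt _ hn⟩,
    fun h _ => Finset.orderEmbOfFin_mem _ _ _, fun h hh l hl hhl => ?_⟩
  have := (T.orderEmbOfFin hT).injective hhl
  rw [Fin.mk.injEq, Nat.mod_eq_of_lt hh, Nat.mod_eq_of_lt hl] at this
  exact this

/-- Read backwards from `ω`, each segment starts at its only vertex touching `β r`, so every region
is a state centred at its hub. -/
theorem Regions.reindex {M : ℕ} {β : ℕ → Set V} {W : Finset ℕ} {z : ℕ → ℕ → V} {len : ℕ → ℕ}
    {α ω : ℕ → ℕ → ℕ} (h : Regions G M β W z len α ω) {r : ℕ} (hr : r < M) {U : Finset ℕ}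
    (hU : U ⊆ W) : IsState G (β r) U (fun j k => z j (ω r j - k)) (fun j => ω r j - α r j) := by
  have hlen := fun j hj => h.le_len r hr j (hU hj)
  have hlt := fun j hj => h.lt r hr j (hU hj)
  have h1 := fun j hj => h.one_le r hr j (hU hj)
  have hseg : ∀ j ∈ U, seg (fun j k => z j (ω r j - k)) j 1 (ω r j - α r j) =
      seg z j (α r j) (ω r j - 1) := by
    intro j hj
    have := hlt j hj
    ext v
    constructor
    · rintro ⟨k, hk1, hk2, rfl⟩
      exact mem_seg (by lia) (by lia)
    · rintro ⟨k, hk1, hk2, rfl⟩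
      exact ⟨ω r j - k, by lia, by lia, by
        change z j (ω r j - (ω r j - k)) = z j k
        rw [show ω r j - (ω r j - k) = k by lia]⟩
  refine ⟨⟨fun i hi j hj a b ha hb hab => ?_, fun i hi a b ha hb => ?_⟩, h.conn r hr,
    fun i hi a ha hx => ?_, fun i hi => by simpa using h.last r hr i (hU hi),
    fun i hi a ha1 ha => ?_, fun i hi j hj hij => ?_⟩
  · have hli := hlen i hi
    have hlj := hlen j hj
    have := hlt i hi
    obtain ⟨rfl, h'⟩ := h.rows.inj i (hU hi) j (hU hj) _ _ (by lia) (by lia) hab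
    exact ⟨rfl, by lia⟩
  · have hli := hlen i hi
    have := hlt i hi
    rw [h.rows.adj i (hU hi) _ _ (by lia) (by lia)]
    lia
  · have hli := hlen i hi
    have := hlt i hi
    have := h1 i hi
    exact Set.disjoint_left.1 (h.disj r hr i (hU hi)) hx (mem_seg (by lia) (by lia))
  · have := hlt i hi
    exact h.not_touch r hr i (hU hi) _ (by lia) (by lia)
  · rw [hseg i hi, hseg j hj]
    exact h.touch r hr i (hU hi) j (hU hj) hij

/-- Rows with few contacts to other rows, and none to the other hubs. -/
theorem exists_clean {A e : ℕ} (W : Finset ℕ) (C : ℕ → ℕ → ℕ → ℕ → Prop)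
    (B : ℕ → ℕ → ℕ → Prop)
    (h : ∀ r < A, ∀ s < A, r ≠ s →
      2 * A ^ 2 * (e + 1) * ((W ×ˢ W).filter fun c => C r s c.1 c.2).card ≤ W.card * W.card ∧
      2 * A ^ 2 * (e + 1) * (W.filter fun j => B r s j).card ≤ W.card) :
    ∃ W' ⊆ W, W.card ≤ 2 * W'.card ∧ ∀ r < A, ∀ s < A, r ≠ s → ∀ i ∈ W',
      e * (W.filter fun j => C r s i j).card ≤ W.card ∧ ¬ B r s i := by
  rcases W.eq_empty_or_nonempty with rfl | hW
  · exact ⟨∅, by simp, by simp, by simp⟩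
  have hWp := hW.card_pos
  let X1 : ℕ × ℕ → Finset ℕ := fun c =>
    W.filter fun i => W.card < e * (W.filter fun j => C c.1 c.2 i j).card
  let X2 : ℕ × ℕ → Finset ℕ := fun c => W.filter fun j => B c.1 c.2 j
  let P : Finset (ℕ × ℕ) := ((Finset.range A) ×ˢ (Finset.range A)).filter fun c => c.1 ≠ c.2
  -- There are at most `A ^ 2` ordered pairs, and each discards at most a `1 / (2 * A ^ 2)` fraction
  -- of the rows.
  let X : Finset ℕ := P.biUnion fun c => X1 c ∪ X2 c
  have hPm : ∀ c, c ∈ P ↔ (c.1 < A ∧ c.2 < A) ∧ c.1 ≠ c.2 := fun c => by simp [P]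
  have h1 : ∀ c ∈ P, 2 * A ^ 2 * (e + 1) * (X1 c ∪ X2 c).card ≤ (e + 1) * W.card := by
    intro c hc
    rw [hPm] at hc
    obtain ⟨ha, hb⟩ := h c.1 hc.1.1 c.2 hc.1.2 hc.2
    have hX1 : 2 * A ^ 2 * (e + 1) * (X1 c).card ≤ e * W.card := by
      have hsum : ((W ×ˢ W).filter fun d => C c.1 c.2 d.1 d.2).card =
          ∑ i ∈ W, (W.filter fun j => C c.1 c.2 i j).card := by
        rw [Finset.card_filter, Finset.sum_product]
        exact Finset.sum_congr rfl fun i _ => (Finset.card_filter _ _).symm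
      have hle : (X1 c).card * W.card ≤ e * ∑ i ∈ W, (W.filter fun j => C c.1 c.2 i j).card := by
        rw [Finset.mul_sum]
        refine le_trans ?_ (Finset.sum_le_sum_of_subset (Finset.filter_subset _ _ : X1 c ⊆ W))
        exact Finset.card_nsmul_le_sum _ _ _ fun i hi => (Finset.mem_filter.1 hi).2.le
      rw [← hsum] at hle
      refine Nat.le_of_mul_le_mul_right (?_ : _ * W.card ≤ _ * W.card) hWp
      calc 2 * A ^ 2 * (e + 1) * (X1 c).card * W.card
          = 2 * A ^ 2 * (e + 1) * ((X1 c).card * W.card) := by ring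
        _ ≤ 2 * A ^ 2 * (e + 1) * (e * ((W ×ˢ W).filter fun d => C c.1 c.2 d.1 d.2).card) :=
          Nat.mul_le_mul_left _ hle
        _ = e * (2 * A ^ 2 * (e + 1) * ((W ×ˢ W).filter fun d => C c.1 c.2 d.1 d.2).card) := by
          ring
        _ ≤ e * (W.card * W.card) := Nat.mul_le_mul_left _ ha
        _ = e * W.card * W.card := by ring
    have hu := Nat.mul_le_mul_left (2 * A ^ 2 * (e + 1)) (Finset.card_union_le (X1 c) (X2 c))
    rw [mul_add] at hu
    have : (e + 1) * W.card = e * W.card + W.card := by ring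
    have hb' : 2 * A ^ 2 * (e + 1) * (X2 c).card ≤ W.card := hb
    lia
  have hPc : P.card ≤ A ^ 2 := by
    refine (Finset.card_filter_le _ _).trans ?_
    simp [Finset.card_product, sq]
  have hX : 2 * X.card ≤ W.card := by
    rcases Nat.eq_zero_or_pos A with rfl | hA
    · have : X.card = 0 := by simp [X, P]
      lia
    · have h2 : 2 * A ^ 2 * (e + 1) * X.card ≤ A ^ 2 * ((e + 1) * W.card) := by
        refine (Nat.mul_le_mul_left _ Finset.card_biUnion_le).trans ?_
        rw [Finset.mul_sum]
        refine (Finset.sum_le_card_nsmul _ _ _ h1).trans ?_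
        exact Nat.mul_le_mul_right _ hPc
      have h3 : (A ^ 2 * (e + 1)) * (2 * X.card) ≤ (A ^ 2 * (e + 1)) * W.card := by
        calc _ = 2 * A ^ 2 * (e + 1) * X.card := by ring
          _ ≤ _ := h2
          _ = _ := by ring
      exact Nat.le_of_mul_le_mul_left h3 (by positivity)
  refine ⟨W \ X, Finset.sdiff_subset, ?_, fun r hr s hs hrs i hi => ?_⟩
  · have := Finset.le_card_sdiff X W
    lia
  · rw [Finset.mem_sdiff] at hi
    have hPrs : (r, s) ∈ P := (hPm _).2 ⟨⟨hr, hs⟩, hrs⟩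
    have hnX : i ∉ X1 (r, s) ∪ X2 (r, s) := fun hm => hi.2 (Finset.mem_biUnion.2 ⟨_, hPrs, hm⟩)
    rw [Finset.mem_union, not_or] at hnX
    constructor
    · by_contra hlt
      exact hnX.1 (Finset.mem_filter.2 ⟨hi.1, not_le.1 hlt⟩)
    · exact fun hB => hnX.2 (Finset.mem_filter.2 ⟨hi.1, hB⟩)

/-- In each of `σ + 2` sparsely interacting regions, `exists_attach` hangs a binary tree model from
`x` by way of the hub. Each uses at most `u + 1` rows, so a greedy choice makes these pieces
pairwise anticomplete, and together they form a tree of radius `D + 1` with `x` in its root. -/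
theorem Regions.exists_tree {σ D u t M E : ℕ} {f : ℕ → ℕ} (hG : GrowsWith.{w} σ D D f u)
    (ht : 2 ≤ t) (hcf : G.CliqueFree t) (hb : NoBiclique G σ)
    {β : ℕ → Set V} {W : Finset ℕ} {z : ℕ → ℕ → V} {len : ℕ → ℕ} {α ω : ℕ → ℕ → ℕ}
    (h : Regions G M β W z len α ω)
    (hE : E = 2 * (σ + 2) ^ 2 * (4 * (σ + 2) * (u + 1) + 1))
    (hM : multiRamseyBound (2 * gridBound E σ) (σ + 2) 3 ≤ M)
    (hW : 4 * (f t + u + badBound σ t + 1 + (σ + 2) * (u + 1)) ≤ W.card)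
    {x : Set V} (hx : Conn G x) (hxβ : ∀ r < M, Touch G x (β r)) (hxd : ∀ r < M, Disjoint x (β r))
    (hxz : ∀ j ∈ W, Anticomplete G x (seg z j 1 (len j))) :
    ∃ (R S : Set V) (J : Finset ℕ), J ⊆ W ∧ J.card ≤ (σ + 2) * (u + 1) ∧ FT G σ (D + 1) R S ∧
      x ⊆ R ∧ S ⊆ x ∪ (⋃ r < M, β r) ∪ ⋃ j ∈ J, seg z j 1 (len j) := by
  have hE1 : 1 ≤ E := by rw [hE]; exact Nat.mul_pos (by positivity) (by lia)
  obtain ⟨T, hT, hTc, hTs⟩ := h.exists_sparse hb hE1 (A := σ + 2) (by lia)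
    (Finset.card_pos.1 (by lia)) hM
  obtain ⟨ρ, hρT, hρ⟩ := exists_enum T hTc
  have hρM : ∀ h < σ + 2, ρ h < M := fun h hh => Finset.mem_range.1 (hT (hρT h hh))
  obtain ⟨O, hO⟩ : ∃ O : ℕ → ℕ → Set V, ∀ r j, O r j = seg z j (α (ρ r) j) (ω (ρ r) j) :=
    ⟨_, fun _ _ => rfl⟩
  have hOsub : ∀ r < σ + 2, ∀ j ∈ W, O r j ⊆ seg z j 1 (len j) := fun r hr j hj => by
    rw [hO]
    exact seg_mono (h.one_le _ (hρM r hr) j hj) (h.le_len _ (hρM r hr) j hj)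
  obtain ⟨W', hW', hWc, hclean⟩ := exists_clean (A := σ + 2) (e := 4 * (σ + 2) * (u + 1)) W
    (fun r s i j => i ≠ j ∧ Touch G (O r i) (O s j)) (fun r s j => Touch G (β (ρ r)) (O s j))
    (fun r hr s hs hrs => by
      have := hTs _ (hρT r hr) _ (hρT s hs) fun h => hrs (hρ r hr s hs h)
      rw [hE] at this
      simp only [hO]
      exact this)
  obtain ⟨J, hJ, hJJ⟩ := exists_greedy (W := W') (v := u + 1)
    (b := W.card / (4 * (σ + 2) * (u + 1)))
    (n0 := f t + u + badBound σ t + 1) (σ + 2)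
    (fun h J => ∃ L R' S', Conn G (x ∪ L) ∧ BT G D R' S' ∧ Attach G (x ∪ L) R' S' ∧
      L ∪ S' ⊆ β (ρ h) ∪ ⋃ j ∈ J, O h j)
    (fun r s i j => i ≠ j ∧ Touch G (O r i) (O s j))
    (fun r hr U hU hUc => by
      have hst := h.reindex (hρM r hr) (hU.trans hW')
      have hsub : ∀ j ∈ U, seg (fun j k => z j (ω (ρ r) j - k)) j 0 (ω (ρ r) j - α (ρ r) j) ⊆
          O r j := by
        rintro j hj _ ⟨k, hk1, hk2, rfl⟩
        have := h.lt _ (hρM r hr) j (hW' (hU hj))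
        rw [hO]
        exact mem_seg (by lia) (by lia)
      obtain ⟨J, hJU, hJc, L, R', S', h1, h2, h3, h4⟩ := hG.exists_attach ht hcf hb hst hUc hx
        (hxβ _ (hρM r hr)) (hxd _ (hρM r hr)) fun j hj =>
          (hxz j (hW' (hU hj))).mono subset_rfl
            ((hsub j hj).trans (hOsub r hr j (hW' (hU hj))))
      exact ⟨J, hJU, hJc, L, R', S', h1, h2, h3, h4.trans (Set.union_subset_union_right _
        (Set.iUnion₂_mono fun j hj => hsub j (hJU hj)))⟩)
    (fun r hr s hs hrs i hi => by
      rw [Nat.le_div_iff_mul_le (by positivity), mul_comm]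
      refine le_trans (Nat.mul_le_mul_left _ (Finset.card_le_card ?_))
        (hclean r hr s hs hrs i hi).1
      intro j hj
      simp only [Finset.mem_filter] at hj ⊢
      exact ⟨hW' hj.1, hj.2⟩)
    (fun r hr s hs hrs i hi j hj hC => ⟨hC.1.symm, hC.2.symm⟩)
    -- Cleaning keeps half of `W`. The conflicts cost at most a quarter, by the choice of the
    -- divisor `4 * (σ + 2) * (u + 1)`, and `hW` pays for the rest.
    (by
      have h1 : 4 * (σ + 2) * (u + 1) * (W.card / (4 * (σ + 2) * (u + 1))) ≤ W.card :=
        Nat.mul_div_le _ _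
      set b := W.card / (4 * (σ + 2) * (u + 1))
      have h2 : 4 * ((σ + 2) * ((u + 1) * (b + 1))) =
        4 * (σ + 2) * (u + 1) * b + 4 * ((σ + 2) * (u + 1)) := by ring
      lia)
  choose! L R' S' hL hBT hA hsub using fun r hr => (hJ r hr).2.2
  have hanti : ∀ r < σ + 2, ∀ s < σ + 2, r ≠ s → Anticomplete G (L r ∪ S' r) (L s ∪ S' s) := by
    intro r hr s hs hrs
    have hβO : ∀ r < σ + 2, ∀ s < σ + 2, r ≠ s → ∀ i ∈ J s,
        Anticomplete G (β (ρ r)) (O s i) := by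
      intro r hr s hs hrs i hi
      have hi' := (hJ s hs).1 hi
      exact anticomplete_iff.2 ⟨(h.disj _ (hρM r hr) i (hW' hi')).mono_right
        (hOsub s hs i (hW' hi')), (hclean r hr s hs hrs i hi').2⟩
    refine Anticomplete.mono ?_ (hsub r hr) (hsub s hs)
    have hββ := h.anti _ (hρM r hr) _ (hρM s hs) fun h => hrs (hρ r hr s hs h)
    refine Anticomplete.union_left ?_ (Anticomplete.biUnion_left fun j hj => ?_)
    · exact (hββ.symm.union_left
        (Anticomplete.biUnion_left fun i hi => (hβO r hr s hs hrs i hi).symm)).symm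
    · refine ((hβO s hs r hr hrs.symm j hj).union_left
        (Anticomplete.biUnion_left fun i hi => ?_)).symm
      have hi' := hW' ((hJ s hs).1 hi)
      have hj' := hW' ((hJ r hr).1 hj)
      have := hJJ r hr s hs hrs j hj i hi
      exact (anticomplete_iff.2 ⟨(h.rows.disjoint hj' hi' this.1 le_rfl le_rfl).mono
        (hOsub r hr j hj') (hOsub s hs i hi'), fun h => this.2 ⟨this.1, h⟩⟩).symm
  have hFT := FT.assemble (σ := σ) (d := D) (X := x) (L := fun h => L h) (R' := fun h => R' h)
    (S' := fun h => S' h) hx (fun h => hL h h.2) (fun h => hBT h h.2) (fun h => hA h h.2)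
    (fun h l hhl => (hanti h h.2 l l.2 fun e => hhl (Fin.ext e)).mono Set.subset_union_left
      Set.subset_union_right)
    (fun h l hhl => (hanti h h.2 l l.2 fun e => hhl (Fin.ext e)).mono Set.subset_union_right
      Set.subset_union_right)
  refine ⟨_, _, (Finset.range (σ + 2)).biUnion J, ?_, ?_, hFT, Set.subset_union_left, ?_⟩
  · exact Finset.biUnion_subset.2 fun h hh => (hJ h (Finset.mem_range.1 hh)).1.trans hW'
  · refine (Finset.card_biUnion_le_card_mul _ _ (u + 1) fun h hh =>
      (hJ h (Finset.mem_range.1 hh)).2.1).trans ?_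
    rw [Finset.card_range]
  · have hmem : ∀ h : Fin (σ + 2), L h ∪ S' h ⊆ x ∪ (⋃ r < M, β r) ∪
        ⋃ j ∈ (Finset.range (σ + 2)).biUnion J, seg z j 1 (len j) := by
      intro r v hv
      rcases hsub r r.2 hv with hv | hv
      · exact Or.inl (Or.inr (Set.mem_iUnion₂.2 ⟨_, hρM r r.2, hv⟩))
      · obtain ⟨j, hj, hv⟩ := Set.mem_iUnion₂.1 hv
        exact Or.inr (Set.mem_iUnion₂.2 ⟨j, Finset.mem_biUnion.2
          ⟨r, Finset.mem_range.2 r.2, hj⟩, hOsub r r.2 j (hW' ((hJ r r.2).1 hj)) hv⟩)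
    refine Set.union_subset (Set.union_subset ?_ (Set.iUnion_subset fun h =>
      Set.subset_union_left.trans (hmem h))) (Set.iUnion_subset fun h =>
      Set.subset_union_right.trans (hmem h))
    exact Set.subset_union_left.trans Set.subset_union_left

/-- Any `N` hubs touching `x` with at least `g t` common rows yield a tree model with `x` in its
root. -/
def PopsWith (σ D N : ℕ) (g : ℕ → ℕ) (u : ℕ) : Prop :=
  ∀ (t : ℕ), 2 ≤ t → ∀ (V : Type w) (G : SimpleGraph V), G.CliqueFree t → NoBiclique G σ →
    ∀ (x : Set V) (I : ℕ → Set V) (K : Finset ℕ) (z : ℕ → ℕ → V) (len : ℕ → ℕ), Conn G x →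
      Rows G K z len → (∀ j ∈ K, Anticomplete G x (seg z j 1 (len j))) →
      (∀ k < N, Conn G (I k) ∧ Disjoint x (I k) ∧ Touch G x (I k)) →
      (∀ k < N, ∀ l < N, k ≠ l → Anticomplete G (I k) (I l)) →
      (∀ k < N, ∀ j ∈ K, Disjoint (I k) (seg z j 1 (len j)) ∧
        Touch G (I k) (seg z j 1 (len j))) → g t ≤ K.card →
      ∃ (R S : Set V) (J : Finset ℕ), J ⊆ K ∧ J.card ≤ u ∧ FT G σ (D + 1) R S ∧ x ⊆ R ∧
        S ⊆ x ∪ (⋃ k < N, I k) ∪ ⋃ j ∈ J, seg z j 1 (len j)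

/-- The number of hubs depends only on `σ` and `u`, hence not on `t`; only the number of common rows
does. -/
theorem Grows.exists_popsWith {σ D : ℕ} (hσ : 1 ≤ σ) (hG : Grows.{w} σ D D) :
    ∃ (N : ℕ) (g : ℕ → ℕ) (u : ℕ), 1 ≤ N ∧ Poly g ∧ PopsWith.{w} σ D N g u := by
  obtain ⟨f, u, hf, hG⟩ := hG
  obtain ⟨E, hE⟩ : ∃ E, E = 2 * (σ + 2) ^ 2 * (4 * (σ + 2) * (u + 1) + 1) := ⟨_, rfl⟩
  obtain ⟨M, hM⟩ : ∃ M, M = multiRamseyBound (2 * gridBound E σ) (σ + 2) 3 := ⟨_, rfl⟩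
  obtain ⟨N, hN⟩ : ∃ N, N = 4 * σ * M := ⟨_, rfl⟩
  have hM1 : 1 ≤ M := by rw [hM]; exact one_le_multiRamseyBound (by lia) _
  let wt : ℕ → ℕ := fun t => 4 * (f t + u + badBound σ t + 1 + (σ + 2) * (u + 1))
  have hwt : Poly wt := (Poly.const 4).mul ((((hf.add (Poly.const u)).add (Poly.badBound σ)).add
    (Poly.const 1)).add (Poly.const _))
  refine ⟨N, fun t => N ^ σ * (2 * t) ^ σ + N.factorial * multiRamseyBound σ (wt t) M,
    (σ + 2) * (u + 1), by rw [hN]; exact Nat.mul_pos (by lia) hM1,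
    ((Poly.const _).mul (((Poly.const 2).mul Poly.id).pow σ)).add
      ((Poly.const _).mul (hwt.multiRamseyBound σ M)), ?_⟩
  intro t ht V G hcf hb x I K z len hx hr hxz hI hII hIz hK
  obtain ⟨b, W, α, ω, hWK, hWc, hbN, hreg⟩ := exists_regions hσ hM1
    (show 1 ≤ wt t by simp only [wt]; lia) (by lia) hcf hb hN hr
    (fun k hk => (hI k hk).1) hII (fun k hk j hj => (hIz k hk j hj).1)
    (fun k hk j hj => (hIz k hk j hj).2) hK
  obtain ⟨R, S, J, hJ, hJc, hFT, hxR, hS⟩ := hreg.exists_tree hG ht hcf hb hE hM.ge hWc.ge hx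
    (fun r hr => (hI _ (hbN r hr)).2.2) (fun r hr => (hI _ (hbN r hr)).2.1)
    fun j hj => hxz j (hWK hj)
  refine ⟨R, S, J, hJ.trans hWK, hJc, hFT, hxR, hS.trans ?_⟩
  refine Set.union_subset_union_left _ (Set.union_subset_union_right _ ?_)
  intro v hv
  obtain ⟨r, hr, hv⟩ := Set.mem_iUnion₂.1 hv
  exact Set.mem_iUnion₂.2 ⟨_, hbN r hr, hv⟩

/-! ### Growing tree models -/

/-- Either many rows have initial segments that touch pairwise and avoid half of each of the target
sets of rows, or there is a tree model. -/
theorem exists_step {σ D N u t q k : ℕ} {g : ℕ → ℕ} (hP : PopsWith.{w} σ D N g u) (hN : 1 ≤ N)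
    (ht : 2 ≤ t) (hcf : G.CliqueFree t) (hb : NoBiclique G σ) (hq : 1 ≤ q) {x : Set V}
    {K : Finset ℕ} {z : ℕ → ℕ → V} {len : ℕ → ℕ} (hst : IsState G x K z len) (A : Finset ℕ)
    (B : ℕ → Finset ℕ) (hk : 1 ≤ k) (hAK : A ⊆ K) (hBK : ∀ l < k, B l ⊆ K)
    (hAB : ∀ l < k, Disjoint A (B l))
    (hB : ∀ l < k, 4 * q * (4 * q * N) ^ N * g t + 1 ≤ (B l).card)
    (hA : k * tailBound σ q t (tailBound σ 2 t (4 * q * N)) ≤ A.card) :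
    (∃ Q ⊆ A, Q.card = q ∧ ∃ (m : ℕ → ℕ) (B' : ℕ → Finset ℕ), (∀ i ∈ Q, m i ≤ len i) ∧
      (∀ i ∈ Q, ∀ j ∈ Q, i ≠ j → Touch G (seg z i 1 (m i)) (seg z j 1 (m j))) ∧
      ∀ l < k, B' l ⊆ B l ∧ (B l).card ≤ 2 * (B' l).card ∧
        ∀ i ∈ Q, ∀ j ∈ B' l, ¬ Touch G (seg z i 1 (m i)) (seg z j 1 (len j))) ∨
    OutX G σ (D + 1) (u + N) x K z len := by
  let cnt : ℕ → ℕ → ℕ → Finset ℕ := fun l i a =>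
    (B l).filter fun j => Touch G (seg z i 1 a) (seg z j 1 (len j))
  -- The longest initial piece of row `i` that touches at most a `1 / (2q)` fraction of every target
  -- set. Length `0` always qualifies, because the tail starts at index `1`.
  let m : ℕ → ℕ := fun i =>
    Nat.findGreatest (fun a => ∀ l < k, 2 * q * (cnt l i a).card ≤ (B l).card) (len i)
  have hm : ∀ i, ∀ l < k, 2 * q * (cnt l i (m i)).card ≤ (B l).card := fun i =>
    Nat.findGreatest_spec (P := fun a => ∀ l < k, 2 * q * (cnt l i a).card ≤ (B l).card)
      (Nat.zero_le (len i)) fun l _ => by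
        have : cnt l i 0 = ∅ := by
          simp only [cnt, seg_eq_empty Nat.zero_lt_one]
          simp
        simp [this]
  have hne : ∀ i ∈ A, ∀ l < k, ∀ j ∈ B l, i ≠ j := fun i hi l hl j hj h =>
    Finset.disjoint_left.1 (hAB l hl) hi (h ▸ hj)
  -- The full row touches all rows of every target set, so the piece can be extended by one vertex;
  -- the extension touches more than a `1 / (2q)` fraction of some target set.
  have hmlt : ∀ i ∈ A, m i < len i := by
    intro i hi
    refine lt_of_le_of_ne (Nat.findGreatest_le _) fun heq => ?_
    have h1 := hm i 0 (by lia)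
    have h2 : cnt 0 i (m i) = B 0 := by
      rw [heq]
      exact Finset.filter_true_of_mem fun j hj =>
        hst.touch i (hAK hi) j (hBK 0 (by lia) hj) (hne i hi 0 (by lia) j hj)
    rw [h2] at h1
    have h3 := hB 0 (by lia)
    have h4 : 2 * (B 0).card ≤ 2 * q * (B 0).card := Nat.mul_le_mul_right _ (by lia)
    lia
  have hex : ∀ i ∈ A, ∃ l ∈ Finset.range k, (B l).card ≤ 2 * q * (cnt l i (m i + 1)).card := by
    intro i hi
    have := Nat.findGreatest_is_greatest (Nat.lt_succ_self (m i)) (hmlt i hi)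
    push Not at this
    obtain ⟨l, hl, h⟩ := this
    exact ⟨l, Finset.mem_range.2 hl, h.le⟩
  -- If `q` of the pieces touch pairwise, they form the new block: together they touch at most half
  -- of each target set, and the untouched half is kept. Otherwise the extended pieces supply
  -- anticomplete hubs.
  by_cases hclq : ∃ Q ⊆ A, Q.card = q ∧ ∀ i ∈ Q, ∀ j ∈ Q, i ≠ j →
      Touch G (seg z i 1 (m i)) (seg z j 1 (m j))
  · obtain ⟨Q, hQ, hQc, hQt⟩ := hclq
    refine Or.inl ⟨Q, hQ, hQc, m, fun l => B l \ Q.biUnion fun i => cnt l i (m i),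
      fun i hi => (hmlt i (hQ hi)).le, hQt, fun l hl => ⟨Finset.sdiff_subset, ?_, ?_⟩⟩
    · have h1 : 2 * q * (Q.biUnion fun i => cnt l i (m i)).card ≤ q * (B l).card := by
        refine (Nat.mul_le_mul_left _ Finset.card_biUnion_le).trans ?_
        rw [Finset.mul_sum]
        refine (Finset.sum_le_card_nsmul _ _ _ fun i _ => hm i l hl).trans ?_
        rw [hQc, smul_eq_mul]
      have h2 : 2 * (Q.biUnion fun i => cnt l i (m i)).card ≤ (B l).card :=
        Nat.le_of_mul_le_mul_left (by rw [← mul_assoc, mul_comm q 2]; exact h1) (by lia : 0 < q)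
      have := Finset.le_card_sdiff (Q.biUnion fun i => cnt l i (m i)) (B l)
      lia
    · intro i hi j hj htch
      rw [Finset.mem_sdiff] at hj
      exact hj.2 (Finset.mem_biUnion.2 ⟨i, hi, Finset.mem_filter.2 ⟨hj.1, htch⟩⟩)
  right
  choose! c hck hc using hex
  obtain ⟨l, hl, A1, hA1A, hcl, hfib⟩ := exists_fiber hck ⟨0, Finset.mem_range.2 (by lia)⟩
  rw [Finset.card_range] at hfib
  rw [Finset.mem_range] at hl
  have hA1 := Nat.le_of_mul_le_mul_left (hA.trans hfib) (by lia : 0 < k)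
  have hrows := hst.rows
  have hpos : 1 ≤ 4 * q * N := Nat.mul_pos (by lia) (by lia)
  have htail : ∀ q a, 1 ≤ tailBound σ q t a := fun q a => by
    unfold tailBound ehBound
    lia
  obtain ⟨A2, hA2, hA2c, h2⟩ := exists_anticomplete_insert hb hcf (by lia) hq (htail _ _)
    (fun i => seg z i 1 (m i)) (fun i => z i (m i + 1)) _ hA1 (fun i hi => by
      have := hmlt i (hA1A hi)
      rcases Nat.eq_zero_or_pos (m i) with h0 | h0
      · exact Or.inl (seg_eq_empty (by lia))
      · exact Or.inr (hrows.conn (hAK (hA1A hi)) h0 this.le))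
    (fun i hi j hj hij => by
      have h1 := hmlt i (hA1A hi)
      have h2 := hmlt j (hA1A hj)
      rw [← seg_succ (by lia), ← seg_succ (by lia)]
      exact hrows.disjoint (hAK (hA1A hi)) (hAK (hA1A hj)) hij h1 h2)
    (fun ⟨Q, hQ, h⟩ => hclq ⟨Q, hQ.trans hA1A, h⟩)
  have hA2A := hA2.trans hA1A
  -- The extended pieces are already anticomplete, so clique size `2` is excluded. This round adds
  -- the starting vertices, through which the hubs touch `x`.
  obtain ⟨A3, hA3, hA3c, h3⟩ := exists_anticomplete_insert hb hcf (by lia) (by lia : 1 ≤ 2) hpos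
    (fun i => seg z i 1 (m i + 1)) (fun i => z i 0) A2 hA2c.ge (fun i hi =>
      Or.inr (hrows.conn (hAK (hA2A hi)) (by lia) (hmlt i (hA2A hi))))
    (fun i hi j hj hij => by
      rw [← seg_zero, ← seg_zero]
      exact hrows.disjoint (hAK (hA2A hi)) (hAK (hA2A hj)) hij (hmlt i (hA2A hi))
        (hmlt j (hA2A hj)))
    (by
      rintro ⟨Q, hQ, hQc, h⟩
      obtain ⟨i, hi, j, hj, hij⟩ := Finset.one_lt_card.1 (by lia : 1 < Q.card)
      have h' := h2 i (hQ hi) j (hQ hj) hij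
      rw [← seg_succ (by lia), ← seg_succ (by lia)] at h'
      exact (anticomplete_iff.1 h').2 (h i hi j hj hij))
  have hA3A := hA3.trans hA2A
  -- The size `4 * q * N` is what `exists_common` needs for `N` hubs at density `1 / (2q)`.
  obtain ⟨H, hH, hHc, hcom⟩ := exists_common
    (fun i j => Touch G (seg z i 1 (m i + 1)) (seg z j 1 (len j))) (e := 2 * q) (N := N) A3 (B l)
    (by lia) (by rw [hA3c]; exact le_of_eq (by ring)) (Finset.card_pos.1 (by lia)) (fun i hi => by
      have := hc i (hA3A hi)
      rw [hcl i (hA2 (hA3 hi))] at this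
      exact this)
  obtain ⟨C, hCB, hCt, hcom⟩ : ∃ C ⊆ B l, (∀ j ∈ C, ∀ i ∈ H,
      Touch G (seg z i 1 (m i + 1)) (seg z j 1 (len j))) ∧
      (B l).card ≤ 2 * (2 * q) * A3.card ^ N * C.card :=
    ⟨_, Finset.filter_subset _ _, fun j hj => (Finset.mem_filter.1 hj).2, hcom⟩
  have hCg : g t ≤ C.card := by
    rw [hA3c] at hcom
    have h1 : 4 * q * (4 * q * N) ^ N * g t ≤ 4 * q * (4 * q * N) ^ N * C.card := by
      have h1 := hB l hl
      have h2 : 2 * (2 * q) = 4 * q := by ring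
      rw [h2] at hcom
      lia
    exact Nat.le_of_mul_le_mul_left h1 (Nat.mul_pos (by lia) (Nat.pow_pos hpos))
  obtain ⟨ρ, hρH, hρ⟩ := exists_enum H hHc
  have hρA : ∀ k < N, ρ k ∈ A := fun k hk => hA3A (hH (hρH k hk))
  have hCK : C ⊆ K := hCB.trans (hBK l hl)
  have hIsub : ∀ k < N, seg z (ρ k) 0 (m (ρ k) + 1) ⊆ seg z (ρ k) 0 (len (ρ k)) := fun k hk =>
    seg_mono le_rfl (hmlt _ (hρA k hk))
  obtain ⟨R, S, J, hJ, hJc, hFT, hxR, hS⟩ := hP t ht V G hcf hb x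
    (fun k => seg z (ρ k) 0 (m (ρ k) + 1)) C z len hst.conn (hrows.mono hCK fun _ _ => le_rfl)
    (fun j hj => anticomplete_iff.2 ⟨hst.disjoint_seg (hCK hj) le_rfl, hst.not_touch_seg (hCK hj)⟩)
    (fun k hk => ⟨hrows.conn (hAK (hρA k hk)) (by lia) (hmlt _ (hρA k hk)),
      hst.disjoint_seg (hAK (hρA k hk)) (hmlt _ (hρA k hk)),
      (hst.start _ (hAK (hρA k hk))).mono subset_rfl
        (Set.singleton_subset_iff.2 (mem_seg le_rfl (by lia)))⟩)
    (fun k hk k' hk' hkk => by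
      have := h3 _ (hH (hρH k hk)) _ (hH (hρH k' hk')) fun h => hkk (hρ k hk k' hk' h)
      rwa [← seg_zero, ← seg_zero] at this)
    (fun k hk j hj => ⟨hrows.disjoint (hAK (hρA k hk)) (hCK hj)
      (hne _ (hρA k hk) l hl j (hCB hj)) (hmlt _ (hρA k hk)) le_rfl,
      (hCt j hj _ (hρH k hk)).mono (seg_mono (by lia) le_rfl) subset_rfl⟩) hCg
  refine ⟨R, S, J ∪ H, Finset.union_subset (hJ.trans hCK) ((hH.trans hA3A).trans hAK),
    (Finset.card_union_le _ _).trans (by lia), hFT, hxR, hS.trans ?_⟩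
  rintro v ((hv | hv) | hv)
  · exact Or.inl hv
  · obtain ⟨k, hk, hv⟩ := Set.mem_iUnion₂.1 hv
    exact Or.inr (Set.mem_iUnion₂.2
      ⟨_, Finset.mem_union_right _ (hρH k hk), hIsub k hk hv⟩)
  · obtain ⟨j, hj, hv⟩ := Set.mem_iUnion₂.1 hv
    exact Or.inr (Set.mem_iUnion₂.2 ⟨j, Finset.mem_union_left _ hj, seg_mono (by lia) le_rfl hv⟩)

/-- Sizes of the row sets in the iteration of `exists_step`, in backward order. -/
def chainSize (σ N n : ℕ) (g s : ℕ → ℕ) (t : ℕ) : ℕ → ℕ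
  | 0 => s t
  | i + 1 => n * tailBound σ (chainSize σ N n g s t i) t
        (tailBound σ 2 t (4 * chainSize σ N n g s t i * N)) +
      (4 * chainSize σ N n g s t i * (4 * chainSize σ N n g s t i * N) ^ N * g t +
        2 * chainSize σ N n g s t i + 1)

theorem Poly.chainSize (σ N n : ℕ) {g s : ℕ → ℕ} (hg : Poly g) (hs : Poly s) (i : ℕ) :
    Poly fun t => chainSize σ N n g s t i := by
  induction i with
  | zero => exact hs
  | succ i ih =>
    have h4 := (Poly.const 4).mul ih
    have h5 := h4.mul (Poly.const N)
    exact ((Poly.const n).mul (ih.tailBound σ ((Poly.const 2).tailBound σ h5))).add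
      ((((h4.mul (h5.pow N)).mul hg).add ((Poly.const 2).mul ih)).add (Poly.const 1))

theorem one_le_chainSize {σ N n : ℕ} {g s : ℕ → ℕ} {t : ℕ} (hs : 1 ≤ s t) (i : ℕ) :
    1 ≤ chainSize σ N n g s t i := by
  cases i with
  | zero => exact hs
  | succ i => simp only [chainSize]; lia

/-- Row sets `B 0, …, B m` such that the rows in `B 0, …, B (m - 1)`, truncated to `lt`, touch
pairwise in each set and avoid the rows in the other sets. -/
structure Chain (G : SimpleGraph V) (K : Finset ℕ) (z : ℕ → ℕ → V) (len : ℕ → ℕ) (m s : ℕ)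
    (B : ℕ → Finset ℕ) (lt : ℕ → ℕ → ℕ) : Prop where
  subset : ∀ l ≤ m, B l ⊆ K
  le_card : ∀ l ≤ m, s ≤ (B l).card
  le_len : ∀ h < m, ∀ i ∈ B h, lt h i ≤ len i
  touch : ∀ h < m, ∀ i ∈ B h, ∀ j ∈ B h, i ≠ j →
    Touch G (seg z i 1 (lt h i)) (seg z j 1 (lt h j))
  disjoint : ∀ h < m, ∀ l ≤ m, h ≠ l → Disjoint (B h) (B l)
  avoid : ∀ h < m, ∀ l ≤ m, h ≠ l → ∀ i ∈ B h, ∀ j ∈ B l,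
    ¬ Touch G (seg z i 1 (lt h i)) (seg z j 1 (len j))

/-- Each application of `exists_step` takes a part of the last set as source, with the remainder and
all earlier blocks as targets. The touching family found becomes a new block, and the surviving
remainder is the new last set. -/
theorem exists_chain {σ D N u t n : ℕ} {g s : ℕ → ℕ} (hP : PopsWith.{w} σ D N g u) (hN : 1 ≤ N)
    (ht : 2 ≤ t) (hcf : G.CliqueFree t) (hb : NoBiclique G σ) (hs : 1 ≤ s t) {x : Set V}
    {K : Finset ℕ} {z : ℕ → ℕ → V} {len : ℕ → ℕ} (hst : IsState G x K z len)
    (hK : chainSize σ N n g s t n ≤ K.card) (hX : ¬ OutX G σ (D + 1) (u + N) x K z len) :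
    ∃ B lt, Chain G K z len n (s t) B lt := by
  suffices H : ∀ m ≤ n, ∃ B lt, Chain G K z len m (chainSize σ N n g s t (n - m)) B lt by
    have := H n le_rfl
    rwa [Nat.sub_self] at this
  intro m
  induction m with
  | zero =>
    intro _
    exact ⟨fun _ => K, fun _ => len, fun _ _ => subset_rfl, fun _ _ => hK, by simp, by simp,
      by simp, by simp⟩
  | succ m ih =>
    intro hm
    obtain ⟨B, lt, hC⟩ := ih (by lia)
    obtain ⟨i, hni⟩ : ∃ i, n - m = i + 1 := ⟨n - m - 1, by lia⟩
    have hni' : n - (m + 1) = i := by lia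
    rw [hni] at hC
    rw [hni']
    have hq := one_le_chainSize (σ := σ) (N := N) (n := n) (g := g) hs i
    obtain ⟨q, hqd⟩ : ∃ q, q = chainSize σ N n g s t i := ⟨_, rfl⟩
    have hcard := hC.le_card
    simp only [chainSize] at hcard
    rw [← hqd] at hq hcard ⊢
    obtain ⟨A, hA, hAc⟩ := Finset.exists_subset_card_eq
      (show n * tailBound σ q t (tailBound σ 2 t (4 * q * N)) ≤ (B m).card by
        have := hcard m le_rfl
        lia)
    have hsd : 4 * q * (4 * q * N) ^ N * g t + 2 * q + 1 ≤ (B m \ A).card := by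
      have h1 := Finset.le_card_sdiff A (B m)
      have h2 := hcard m le_rfl
      lia
    have hAK := hA.trans (hC.subset m le_rfl)
    -- Targets lose at most half in the step, hence the summand `2 * q` in `chainSize`.
    obtain ⟨T, hT⟩ : ∃ T : ℕ → Finset ℕ, T = fun l => if l = m then B m \ A else B l := ⟨_, rfl⟩
    have hTB : ∀ l, T l ⊆ B l := by
      intro l
      rw [hT]
      dsimp only
      split_ifs with h
      · rw [h]
        exact Finset.sdiff_subset
      · exact subset_rfl
    have hTm : T m = B m \ A := by simp [hT]
    have hTc : ∀ l < m + 1, 4 * q * (4 * q * N) ^ N * g t + 2 * q + 1 ≤ (T l).card := by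
      intro l hl
      rw [hT]
      dsimp only
      split_ifs with h
      · exact hsd
      · have := hcard l (by lia)
        lia
    have hAT : ∀ l < m + 1, Disjoint A (T l) := by
      intro l hl
      rcases eq_or_ne l m with rfl | hlm
      · rw [hTm]
        exact Finset.disjoint_sdiff
      · exact ((hC.disjoint l (by lia) m le_rfl hlm).mono (hTB l) hA).symm
    rcases exists_step hP hN ht hcf hb hq hst A T (k := m + 1) (by lia) hAK
      (fun l hl => (hTB l).trans (hC.subset l (by lia))) hAT
      (fun l hl => by have := hTc l hl; lia)
      (by rw [hAc]; exact Nat.mul_le_mul_right _ hm) with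
      ⟨Q, hQA, hQc, lt', B', hlt', hQt, hB'⟩ | h
    · have hB'B : ∀ l < m + 1, B' l ⊆ B l := fun l hl => (hB' l hl).1.trans (hTB l)
      have hB'c : ∀ l < m + 1, q ≤ (B' l).card := fun l hl => by
        have h1 := hTc l hl
        have h2 := (hB' l hl).2.1
        lia
      obtain ⟨F, hF1, hF2, hF3⟩ : ∃ F : ℕ → Finset ℕ, (∀ l < m, F l = B' l) ∧ F m = Q ∧
          F (m + 1) = B' m :=
        ⟨fun l => if l < m then B' l else if l = m then Q else B' m,
          fun l hl => by simp [hl], by simp, by simp⟩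
      have hQB := hQA.trans hA
      have hcase : ∀ l ≤ m + 1, l < m ∨ l = m ∨ l = m + 1 := fun l hl => by lia
      have hcase' : ∀ l < m + 1, l < m ∨ l = m := fun l hl => by lia
      refine ⟨F, fun h i => if h = m then lt' i else lt h i, ?_, ?_, ?_, ?_, ?_, ?_⟩
      · intro l hl
        rcases hcase l hl with h | rfl | rfl
        · rw [hF1 l h]
          exact (hB'B l (by lia)).trans (hC.subset l h.le)
        · rw [hF2]
          exact hQA.trans hAK
        · rw [hF3]
          exact (hB'B m (by lia)).trans (hC.subset m le_rfl)
      · intro l hl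
        rcases hcase l hl with h | rfl | rfl
        · rw [hF1 l h]
          exact hB'c l (by lia)
        · rw [hF2, hQc]
        · rw [hF3]
          exact hB'c m (by lia)
      · intro l hl i hi
        rcases hcase' l hl with h | rfl
        · rw [if_neg h.ne]
          rw [hF1 l h] at hi
          exact hC.le_len l h i (hB'B l hl hi)
        · rw [if_pos rfl]
          rw [hF2] at hi
          exact hlt' i hi
      · intro l hl i hi j hj hij
        rcases hcase' l hl with h | rfl
        · rw [if_neg h.ne, if_neg h.ne]
          rw [hF1 l h] at hi hj
          exact hC.touch l h i (hB'B l hl hi) j (hB'B l hl hj) hij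
        · rw [if_pos rfl, if_pos rfl]
          rw [hF2] at hi hj
          exact hQt i hi j hj hij
      · intro h hh l hl hhl
        rcases hcase' h hh with h1 | rfl <;> rcases hcase l hl with h2 | h2 | rfl
        · rw [hF1 h h1, hF1 l h2]
          exact (hC.disjoint h h1 l h2.le hhl).mono (hB'B h hh) (hB'B l (by lia))
        · rw [hF1 h h1, h2, hF2]
          exact (hC.disjoint h h1 m le_rfl h1.ne).mono (hB'B h hh) hQB
        · rw [hF1 h h1, hF3]
          exact (hC.disjoint h h1 m le_rfl h1.ne).mono (hB'B h hh) (hB'B m (by lia))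
        · rw [hF2, hF1 l h2]
          exact (hAT l (by lia)).mono hQA (hB' l (by lia)).1
        · exact absurd h2.symm hhl
        · rw [hF2, hF3]
          exact (hAT h (by lia)).mono hQA (hB' h (by lia)).1
      · intro h hh l hl hhl i hi j hj
        rcases hcase' h hh with h1 | rfl <;> rcases hcase l hl with h2 | h2 | rfl
        · rw [if_neg h1.ne]
          rw [hF1 h h1] at hi
          rw [hF1 l h2] at hj
          exact hC.avoid h h1 l h2.le hhl i (hB'B h hh hi) j (hB'B l (by lia) hj)
        · rw [if_neg h1.ne]
          rw [hF1 h h1] at hi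
          rw [h2, hF2] at hj
          exact hC.avoid h h1 m le_rfl h1.ne i (hB'B h hh hi) j (hQB hj)
        · rw [if_neg h1.ne]
          rw [hF1 h h1] at hi
          rw [hF3] at hj
          exact hC.avoid h h1 m le_rfl h1.ne i (hB'B h hh hi) j (hB'B m (by lia) hj)
        · rw [if_pos rfl]
          rw [hF2] at hi
          rw [hF1 l h2] at hj
          exact (hB' l (by lia)).2.2 i hi j hj
        · exact absurd h2.symm hhl
        · rw [if_pos rfl]
          rw [hF2] at hi
          rw [hF3] at hj
          exact (hB' h (by lia)).2.2 i hi j hj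
    · exact absurd h hX

/-- Joining the tree models of a chain along a further row. -/
theorem Chain.exists_outR {σ e u t s : ℕ} (ht : 2 ≤ t) (hcf : G.CliqueFree t)
    (hb : NoBiclique G σ) {x : Set V} {K : Finset ℕ} {z : ℕ → ℕ → V} {len : ℕ → ℕ}
    (hst : IsState G x K z len) {B : ℕ → Finset ℕ} {lt : ℕ → ℕ → ℕ}
    (hC : Chain G K z len (σ + 2) s B lt) (hs : u + badBound σ t + 1 ≤ s)
    (hR : ∀ h < σ + 2, OutR G σ e u (B h) z (lt h)) :
    OutR G σ (e + 1) ((σ + 2) * (u + 1) + 1) K z len := by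
  -- An untruncated row of the last set is the core of the new root. It touches the tail of every
  -- other row, which is what `OutR` asks for.
  obtain ⟨c, hc⟩ := Finset.card_pos.1
    (show 0 < (B (σ + 2)).card from by have := hC.le_card (σ + 2) le_rfl; lia)
  have hcK := hC.subset _ le_rfl hc
  have hcB : ∀ h < σ + 2, c ∉ B h := fun h hh hcB =>
    Finset.disjoint_left.1 (hC.disjoint h hh _ le_rfl hh.ne) hcB hc
  have hBK : ∀ h < σ + 2, B h ⊆ K := fun h hh => hC.subset h hh.le
  obtain ⟨b0, hb0⟩ := Finset.card_pos.1
    (show 0 < (B 0).card from by have := hC.le_card 0 (by lia); lia)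
  have hcb0 : c ≠ b0 := fun h => hcB 0 (by lia) (h ▸ hb0)
  have hclen : 1 ≤ len c :=
    hst.one_le_len (Finset.one_lt_card.2 ⟨c, hcK, b0, hBK 0 (by lia) hb0, hcb0⟩) hcK
  have hcc : Conn G (seg z c 1 (len c)) := hst.rows.conn hcK hclen le_rfl
  have htr : ∀ h < σ + 2, ∀ l ≤ σ + 2, h ≠ l → ∀ i ∈ B h, ∀ j ∈ B l,
      Anticomplete G (seg z i 1 (lt h i)) (seg z j 1 (len j)) := fun h hh l hl hhl i hi j hj =>
    anticomplete_iff.2 ⟨hst.rows.disjoint (hBK h hh hi) (hC.subset l hl hj)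
      (fun hij => Finset.disjoint_left.1 (hC.disjoint h hh l hl hhl) hi (hij ▸ hj))
      (hC.le_len h hh i hi) le_rfl, hC.avoid h hh l hl hhl i hi j hj⟩
  -- In block `h`, a full row `j` outside the tree touches both `c` and, already in its truncated
  -- part, the root of the tree. Rows are linked in full length, which is safe since the trees of
  -- the other blocks avoid full rows; contacts between the links themselves are harmless, as all of
  -- them join the root.
  have key : ∀ h < σ + 2, ∃ (J : Finset ℕ) (j : ℕ) (L R' S' : Set V), J ⊆ B h ∧ J.card ≤ u ∧
      j ∈ B h ∧ L ⊆ seg z j 1 (len j) ∧ S' ⊆ ⋃ i ∈ J, seg z i 1 (lt h i) ∧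
      Conn G (seg z c 1 (len c) ∪ L) ∧ BT G e R' S' ∧
      Attach G (seg z c 1 (len c) ∪ L) R' S' := by
    intro h hh
    obtain ⟨R, S, J, hJ, hJc, hFT, hS, hRt⟩ := hR h hh
    obtain ⟨Bad, hW, hBad⟩ := hFT.exists_bad hb hcf (by lia)
    obtain ⟨j, hj, hjb⟩ := (hst.rows.mono ((Finset.sdiff_subset (t := J)).trans (hBK h hh))
      fun _ _ => le_rfl).exists_avoiding hW (by
        have h1 := Finset.le_card_sdiff J (B h)
        have h2 := hC.le_card h hh.le
        lia)
    rw [Finset.mem_sdiff] at hj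
    have hXS : Anticomplete G (seg z c 1 (len c)) S :=
      (Anticomplete.biUnion_left fun i hi => htr h hh _ le_rfl hh.ne i (hJ hi) c hc).symm.mono
        subset_rfl hS
    obtain ⟨L, hL, hLc, R', S', hS', hBT, hA⟩ := exists_link hcc hXS.1 (anticomplete_iff.1 hXS).2
      hBad z j 1 (len j)
      (fun k _ hk => ⟨fun hkS => by
        obtain ⟨i, hi, l, _, hl, hli⟩ := Set.mem_iUnion₂.1 (hS hkS)
        have := (hst.rows.inj i (hBK h hh (hJ hi)) j (hBK h hh hj.1) l k
          (hl.trans (hC.le_len h hh i (hJ hi))) hk hli).1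
        exact hj.2 (this ▸ hi), hjb k hk⟩)
      (fun k _ hk => (hst.rows.adj j (hBK h hh hj.1) k (k + 1) (by lia) (by lia)).2 (Or.inl rfl))
      (hst.touch c hcK j (hBK h hh hj.1) fun hcj => hcB h hh (hcj ▸ hj.1))
      ((hRt j hj.1 hj.2).mono (seg_mono le_rfl (hC.le_len h hh j hj.1)) hFT.root_subset)
    exact ⟨J, j, L, R', S', hJ, hJc, hj.1, hL, hS'.trans hS, hLc, hBT, hA⟩
  choose! J j L R' S' hJ hJc hj hL hS' hLc hBT hA using key
  have hLS : ∀ h < σ + 2, ∀ l < σ + 2, h ≠ l → Anticomplete G (L h) (S' l) :=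
    fun h hh l hl hhl => ((Anticomplete.biUnion_left fun i hi =>
      htr l hl h hh.le hhl.symm i (hJ l hl hi) (j h) (hj h hh)).mono (hS' l hl) (hL h hh)).symm
  have hSS : ∀ h < σ + 2, ∀ l < σ + 2, h ≠ l → Anticomplete G (S' h) (S' l) :=
    fun h hh l hl hhl => ((Anticomplete.biUnion_left fun i hi =>
      ((Anticomplete.biUnion_left fun k hk => ((htr h hh l hl.le hhl i (hJ h hh hi) k
        (hJ l hl hk)).mono subset_rfl
          (seg_mono le_rfl (hC.le_len l hl k (hJ l hl hk)))).symm).symm.mono subset_rfl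
            (hS' l hl))).mono (hS' h hh) subset_rfl)
  have hFT := FT.assemble (σ := σ) (d := e) (X := seg z c 1 (len c)) (L := fun h => L h)
    (R' := fun h => R' h) (S' := fun h => S' h) hcc (fun h => hLc h h.2) (fun h => hBT h h.2)
    (fun h => hA h h.2) (fun h l hhl => hLS h h.2 l l.2 fun e => hhl (Fin.ext e))
    (fun h l hhl => hSS h h.2 l l.2 fun e => hhl (Fin.ext e))
  have hsub : ∀ h < σ + 2, insert (j h) (J h) ⊆ K := fun h hh =>
    Finset.insert_subset (hBK h hh (hj h hh)) ((hJ h hh).trans (hBK h hh))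
  refine ⟨_, _, insert c ((Finset.range (σ + 2)).biUnion fun h => insert (j h) (J h)), ?_, ?_, hFT,
    ?_, fun i hi hiJ => ?_⟩
  · exact Finset.insert_subset hcK (Finset.biUnion_subset.2 fun h hh =>
      hsub h (Finset.mem_range.1 hh))
  · refine (Finset.card_insert_le _ _).trans (Nat.add_le_add_right ?_ 1)
    refine (Finset.card_biUnion_le_card_mul _ _ (u + 1) fun h hh =>
      (Finset.card_insert_le _ _).trans (Nat.add_le_add_right
        (hJc h (Finset.mem_range.1 hh)) 1)).trans ?_
    rw [Finset.card_range]
  · have hmem : ∀ (h : Fin (σ + 2)) (i : ℕ), i ∈ insert (j h) (J h) →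
        i ∈ insert c ((Finset.range (σ + 2)).biUnion fun h => insert (j h) (J h)) := fun h i hi =>
      Finset.mem_insert_of_mem (Finset.mem_biUnion.2 ⟨h, Finset.mem_range.2 h.2, hi⟩)
    refine Set.union_subset (Set.union_subset ?_ (Set.iUnion_subset fun h => ?_))
      (Set.iUnion_subset fun h => ?_)
    · exact Set.subset_iUnion₂_of_subset c (Finset.mem_insert_self _ _) subset_rfl
    · exact (hL h h.2).trans
        (Set.subset_iUnion₂_of_subset (j h) (hmem h _ (Finset.mem_insert_self _ _)) subset_rfl)
    · intro v hv
      obtain ⟨i, hi, hv⟩ := Set.mem_iUnion₂.1 (hS' h h.2 hv)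
      exact Set.mem_iUnion₂.2 ⟨i, hmem h i (Finset.mem_insert_of_mem hi),
        seg_mono le_rfl (hC.le_len h h.2 i (hJ h h.2 hi)) hv⟩
  · have hic : i ≠ c := fun h => hiJ (h ▸ Finset.mem_insert_self _ _)
    exact (hst.touch i hi c hcK hic).mono subset_rfl Set.subset_union_left

theorem OutX.mono {σ D u u' : ℕ} {x : Set V} {K K' : Finset ℕ} {z : ℕ → ℕ → V} {len len' : ℕ → ℕ}
    (h : OutX G σ D u x K z len) (hK : K ⊆ K') (hu : u ≤ u') (hl : ∀ i ∈ K, len i ≤ len' i) :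
    OutX G σ D u' x K' z len' := by
  obtain ⟨R, S, J, hJ, hJc, hFT, hxR, hS⟩ := h
  exact ⟨R, S, J, hJ.trans hK, hJc.trans hu, hFT, hxR, hS.trans (Set.union_subset_union_right _
    (Set.iUnion₂_mono fun j hj => seg_mono le_rfl (hl j (hJ hj))))⟩

theorem OutR.mono {σ D u u' : ℕ} {K : Finset ℕ} {z : ℕ → ℕ → V} {len : ℕ → ℕ}
    (h : OutR G σ D u K z len) (hu : u ≤ u') : OutR G σ D u' K z len := by
  obtain ⟨R, S, J, hJ, hJc, h⟩ := h
  exact ⟨R, S, J, hJ, hJc.trans hu, h⟩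

/-- The tail of any single row is an `OutR` model of radius `0`, because it touches all other tails.
-/
theorem Grows.zero (σ D : ℕ) : Grows.{w} σ 0 D := by
  refine ⟨fun _ => 2, 1, Poly.const 2, fun t _ V G _ _ x K z len hst hK => Or.inr ?_⟩
  obtain ⟨c, hc⟩ := Finset.card_pos.1 (by lia : 0 < K.card)
  refine ⟨seg z c 1 (len c), seg z c 1 (len c), {c}, by simpa using hc, by simp,
    ⟨hst.rows.conn hc (hst.one_le_len hK hc) le_rfl, rfl⟩, by simp, fun j hj hjc => ?_⟩
  exact hst.touch j hj c hc fun h => hjc (by simp [h])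

/-- Unless `OutX` occurs, a chain gives `σ + 2` truncated states, still centred at `x`. An `OutX`
model in one of them is one for the whole state; otherwise their `OutR` models are joined. -/
theorem Grows.succ {σ e D N u' : ℕ} {g : ℕ → ℕ} (hP : PopsWith.{w} σ D N g u') (hN : 1 ≤ N)
    (hg : Poly g) (h : Grows.{w} σ e (D + 1)) : Grows.{w} σ (e + 1) (D + 1) := by
  obtain ⟨f, u, hf, hG⟩ := h
  let s : ℕ → ℕ := fun t => f t + u + badBound σ t + 1
  have hs : Poly s := ((hf.add (Poly.const u)).add (Poly.badBound σ)).add (Poly.const 1)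
  refine ⟨fun t => chainSize σ N (σ + 2) g s t (σ + 2), u' + N + u + ((σ + 2) * (u + 1) + 1),
    Poly.chainSize σ N _ hg hs _, fun t ht V G hcf hb x K z len hst hK => ?_⟩
  by_cases hX : OutX G σ (D + 1) (u' + N) x K z len
  · exact Or.inl (hX.mono subset_rfl (by lia) fun _ _ => le_rfl)
  obtain ⟨B, lt, hC⟩ := exists_chain hP hN ht hcf hb (by simp only [s]; lia) hst hK hX
  have hsub : ∀ h < σ + 2, OutX G σ (D + 1) u x (B h) z (lt h) ∨ OutR G σ e u (B h) z (lt h) :=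
    fun h hh => hG t ht V G hcf hb x (B h) z (lt h)
      (hst.truncate (hC.subset h hh.le) (hC.le_len h hh) (hC.touch h hh))
      (le_trans (by simp only [s]; lia) (hC.le_card h hh.le))
  by_cases hX' : ∃ h < σ + 2, OutX G σ (D + 1) u x (B h) z (lt h)
  · obtain ⟨h, hh, hX'⟩ := hX'
    exact Or.inl (hX'.mono (hC.subset h hh.le) (by lia) (hC.le_len h hh))
  · push Not at hX'
    exact Or.inr ((hC.exists_outR ht hcf hb hst (by simp only [s]; lia)
      fun h hh => (hsub h hh).resolve_left (hX' h hh)).mono (by lia))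

theorem grows {σ : ℕ} (hσ : 1 ≤ σ) (D : ℕ) : Grows.{w} σ D D := by
  induction D with
  | zero => exact Grows.zero σ 0
  | succ D ih =>
    obtain ⟨N, g, u, hN, hg, hP⟩ := ih.exists_popsWith hσ
    have : ∀ e, Grows.{w} σ e (D + 1) := fun e => by
      induction e with
      | zero => exact Grows.zero σ _
      | succ e ihe => exact Grows.succ hP hN hg ihe
    exact this _

/-! ### Bicliques from many anticomplete paths -/

theorem multi_ramsey_fintype {ι : Type*} [Fintype ι] {s a : ℕ} (ha : 1 ≤ a)
    (p : ι → ℕ → ℕ → Prop) (K : Finset ℕ) (hK : multiRamseyBound s a (Fintype.card ι) ≤ K.card)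
    (h : ∀ l, ¬ ∃ Q ⊆ K, Q.card = s ∧ ∀ i ∈ Q, ∀ j ∈ Q, i < j → p l i j) :
    ∃ S ⊆ K, S.card = a ∧ ∀ l, ∀ i ∈ S, ∀ j ∈ S, i < j → ¬ p l i j := by
  obtain ⟨S, hS, hc, hp⟩ := multi_ramsey (s := s) ha (Fintype.card ι)
    (fun l i j => ∃ hl : l < Fintype.card ι, p ((Fintype.equivFin ι).symm ⟨l, hl⟩) i j) K hK
    (fun l hl ⟨Q, hQ, hQc, hQp⟩ => h ((Fintype.equivFin ι).symm ⟨l, hl⟩)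
      ⟨Q, hQ, hQc, fun i hi j hj hij => (hQp i hi j hj hij).2⟩)
  refine ⟨S, hS, hc, fun l i hi j hj hij hl => ?_⟩
  refine hp (Fintype.equivFin ι l) (Fin.is_lt _) i hi j hj hij ⟨Fin.is_lt _, ?_⟩
  simpa using hl

/-- Independent sets in digraphs of small outdegree. -/
theorem exists_independent {σ : ℕ} (hσ : 1 ≤ σ) (T : ℕ → Finset ℕ) (K : Finset ℕ)
    (hK : multiRamseyBound (σ + 1) σ 2 ≤ K.card) (hT : ∀ i ∈ K, (T i).card < σ) :
    ∃ S ⊆ K, S.card = σ ∧ ∀ i ∈ S, ∀ j ∈ S, i ≠ j → j ∉ T i := by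
  have hbig : ∀ Q ⊆ K, Q.card = σ + 1 → ∀ i ∈ Q, ¬ ∀ j ∈ Q, j ≠ i → j ∈ T i := by
    intro Q hQ hQc i hi h
    have h1 : (Q.erase i).card ≤ (T i).card := Finset.card_le_card fun j hj =>
      h j (Finset.mem_of_mem_erase hj) (Finset.ne_of_mem_erase hj)
    rw [Finset.card_erase_of_mem hi] at h1
    have := hT i (hQ hi)
    lia
  obtain ⟨S, hS, hSc, hp⟩ := multi_ramsey (s := σ + 1) hσ 2
    (fun l i j => if l = 0 then j ∈ T i else i ∈ T j) K hK (by
      rintro l hl ⟨Q, hQ, hQc, h⟩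
      have hne : Q.Nonempty := Finset.card_pos.1 (by lia)
      interval_cases l
      · exact hbig Q hQ hQc _ (Q.min'_mem hne) fun j hj hji =>
          h _ (Q.min'_mem hne) j hj (lt_of_le_of_ne (Q.min'_le j hj) hji.symm)
      · exact hbig Q hQ hQc _ (Q.max'_mem hne) fun j hj hji =>
          h j hj _ (Q.max'_mem hne) (lt_of_le_of_ne (Q.le_max' j hj) hji))
  refine ⟨S, hS, hSc, fun i hi j hj hij => ?_⟩
  rcases hij.lt_or_gt with hlt | hlt
  · exact hp 0 (by lia) i hi j hj hlt
  · exact hp 1 (by lia) j hj i hi hlt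

/-- Number of candidate centres of one side of the biclique. -/
def leftSize (σ : ℕ) : ℕ := multiRamseyBound (σ + 1) σ 2

/-- Sized for a pigeonhole over the `σ`-subsets of the left side, with `σ` right vertices left over.
-/
def rightSize (σ : ℕ) : ℕ := leftSize σ ^ σ * σ

def transversalSize (σ : ℕ) : ℕ :=
  multiRamseyBound (2 * σ) (σ * σ) (Fintype.card ((Fin σ × Fin σ) × (Fin σ × Fin σ)))

/-- Sized for a pigeonhole over the sets of left vertices that a path touches. The extra `σ` ensures
enough paths for a biclique if such a set has `σ` elements. -/
def multiplicity (σ : ℕ) : ℕ := 2 ^ leftSize σ * (transversalSize σ + σ)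

/-- Pairwise anticomplete members of families of anticomplete sets. -/
theorem exists_transversal {σ : ℕ} (hσ : 1 ≤ σ) (hb : NoBiclique G σ)
    (F : Fin σ × Fin σ → ℕ → Set V) (hF : ∀ e, ∀ k < transversalSize σ, Conn G (F e k))
    (hself : ∀ e, ∀ k < transversalSize σ, ∀ l < transversalSize σ, k ≠ l →
      Anticomplete G (F e k) (F e l))
    (hdisj : ∀ e e', e ≠ e' → ∀ k < transversalSize σ, ∀ l < transversalSize σ,
      Disjoint (F e k) (F e' l)) :
    ∃ κ : Fin σ × Fin σ → ℕ, (∀ e, κ e < transversalSize σ) ∧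
      ∀ e e', e ≠ e' → Anticomplete G (F e (κ e)) (F e' (κ e')) := by
  -- On `S` no two families touch at distinct indices, so giving each of the `σ * σ` families its
  -- own index from `S` suffices.
  obtain ⟨S, hS, hSc, hp⟩ := multi_ramsey_fintype (s := 2 * σ) (a := σ * σ)
    (Nat.mul_pos hσ hσ) (fun (l : (Fin σ × Fin σ) × (Fin σ × Fin σ)) i j =>
      Touch G (F l.1 i) (F l.2 j)) (Finset.range (transversalSize σ))
    (by rw [Finset.card_range]; rfl) (fun l => by
      have hself' : ∀ e, ∀ i ∈ Finset.range (transversalSize σ),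
          ∀ j ∈ Finset.range (transversalSize σ), i ≠ j → Anticomplete G (F e i) (F e j) :=
        fun e i hi j hj => hself e i (Finset.mem_range.1 hi) j (Finset.mem_range.1 hj)
      refine not_clique_lt hb (F l.1) (F l.2) _ (fun i hi => Or.inr (hF _ i (Finset.mem_range.1 hi)))
        (fun i hi => Or.inr (hF _ i (Finset.mem_range.1 hi))) (hself' _) (hself' _)
        (fun i hi j hj hij => ?_) _ fun _ _ _ _ _ h => h
      by_cases hl : l.1 = l.2
      · rw [hl]
        exact (hself' _ i hi j hj hij).1
      · exact hdisj _ _ hl i (Finset.mem_range.1 hi) j (Finset.mem_range.1 hj))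
  let κ : Fin σ × Fin σ → ℕ := fun e => S.orderEmbOfFin hSc (finProdFinEquiv e)
  have hκS : ∀ e, κ e ∈ S := fun e => Finset.orderEmbOfFin_mem _ _ _
  have hκ : ∀ e, κ e < transversalSize σ := fun e => Finset.mem_range.1 (hS (hκS e))
  refine ⟨κ, hκ, fun e e' hee => anticomplete_iff.2 ⟨hdisj e e' hee _ (hκ e) _ (hκ e'), ?_⟩⟩
  have hne : κ e ≠ κ e' := fun h =>
    hee (finProdFinEquiv.injective ((S.orderEmbOfFin hSc).injective h))
  rcases hne.lt_or_gt with hlt | hlt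
  · exact hp (e, e') _ (hκS e) _ (hκS e') hlt
  · exact fun h => hp (e', e) _ (hκS e') _ (hκS e) hlt h.symm

/-- For each pair, keep paths touching the same set `T i j` of other left vertices; it has fewer
than `σ` elements, as otherwise it forms a biclique with these paths. For each right `j`, the sets
`T i j` form a digraph of small outdegree, whose independent `σ`-set can be made common to `σ` right
vertices. A transversal of pairwise anticomplete paths then gives `K_{σ,σ}`. -/
theorem NoBiclique.not_many_paths {σ : ℕ} (hσ : 1 ≤ σ) (hb : NoBiclique G σ) (b : ℕ → V)
    (F : ℕ → ℕ → ℕ → Set V) {m : ℕ} (hm : m = leftSize σ + rightSize σ)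
    (hbinj : ∀ i < m, ∀ j < m, i ≠ j → b i ≠ b j ∧ ¬ G.Adj (b i) (b j))
    (hF : ∀ i j, i < leftSize σ → leftSize σ ≤ j → j < m → ∀ k < multiplicity σ,
      Conn G (F i j k) ∧ Touch G {b i} (F i j k) ∧ Touch G (F i j k) {b j} ∧
      ∀ l < m, b l ∉ F i j k)
    (hself : ∀ i j, i < leftSize σ → leftSize σ ≤ j → j < m → ∀ k < multiplicity σ,
      ∀ l < multiplicity σ, k ≠ l → Anticomplete G (F i j k) (F i j l))
    (hdisj : ∀ i j, i < leftSize σ → leftSize σ ≤ j → j < m → ∀ i' j', i' < leftSize σ →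
      leftSize σ ≤ j' → j' < m → (i, j) ≠ (i', j') → ∀ k < multiplicity σ,
      ∀ l < multiplicity σ, Disjoint (F i j k) (F i' j' l)) : False := by
  have hpat : ∀ i j, i < leftSize σ → leftSize σ ≤ j → j < m →
      ∃ (T : Finset ℕ) (ρ : ℕ → ℕ), T.card < σ ∧ (∀ k < transversalSize σ, ρ k < multiplicity σ) ∧
        (∀ k < transversalSize σ, ∀ l < transversalSize σ, ρ k = ρ l → k = l) ∧
        ∀ k < transversalSize σ, ∀ l < leftSize σ, l ≠ i → l ∉ T →
          ¬ Touch G {b l} (F i j (ρ k)) := by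
    intro i j hi hj hjm
    obtain ⟨T, hT, K, hK, hKT, hKc⟩ := exists_fiber (s := Finset.range (multiplicity σ))
      (t := (Finset.range (leftSize σ)).powerset)
      (f := fun k => (Finset.range (leftSize σ)).filter fun l => l ≠ i ∧ Touch G {b l} (F i j k))
      (fun k _ => Finset.mem_powerset.2 (Finset.filter_subset _ _)) ⟨∅, by simp⟩
    rw [Finset.card_range, Finset.card_powerset, Finset.card_range] at hKc
    have hKc' : transversalSize σ + σ ≤ K.card := Nat.le_of_mul_le_mul_left hKc (by positivity)
    have hKm : ∀ k ∈ K, k < multiplicity σ := fun k hk => Finset.mem_range.1 (hK hk)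
    have hTm : ∀ k ∈ K, ∀ l, l ∈ T ↔ l < leftSize σ ∧ l ≠ i ∧ Touch G {b l} (F i j k) := by
      intro k hk l
      rw [← hKT k hk, Finset.mem_filter, Finset.mem_range]
    obtain ⟨k0, hk0⟩ := Finset.card_pos.1 (by lia : 0 < K.card)
    have hTl : ∀ l ∈ T, l < m := fun l hl => by
      have := ((hTm k0 hk0 l).1 hl).1
      lia
    have hTσ : T.card < σ := by
      by_contra hlt
      exact hb.elim T K (fun l => {b l}) (F i j) (not_lt.1 hlt) (by lia)
        (fun l _ => conn_singleton _) (fun k hk => (hF i j hi hj hjm k (hKm k hk)).1)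
        (fun l hl l' hl' hll => anticomplete_singleton.2 (hbinj l (hTl l hl) l' (hTl l' hl') hll))
        (fun k hk k' hk' => hself i j hi hj hjm k (hKm k hk) k' (hKm k' hk'))
        (fun l hl k hk => Set.disjoint_singleton_left.2
          ((hF i j hi hj hjm k (hKm k hk)).2.2.2 l (hTl l hl)))
        (fun l hl k hk => ((hTm k hk l).1 hl).2.2)
    obtain ⟨K', hK', hK'c⟩ := Finset.exists_subset_card_eq (by lia : transversalSize σ ≤ K.card)
    obtain ⟨ρ, hρK, hρ⟩ := exists_enum K' hK'c
    exact ⟨T, ρ, hTσ, fun k hk => hKm _ (hK' (hρK k hk)), hρ, fun k hk l hl hli hlT ht =>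
      hlT ((hTm _ (hK' (hρK k hk)) l).2 ⟨hl, hli, ht⟩)⟩
  choose! T ρ hTσ hρm hρ hTt using hpat
  have hind : ∀ j ∈ Finset.Ico (leftSize σ) m, ∃ S ∈ (Finset.range (leftSize σ)).powersetCard σ,
      ∀ i ∈ S, ∀ l ∈ S, i ≠ l → l ∉ T i j := by
    intro j hj
    rw [Finset.mem_Ico] at hj
    obtain ⟨S, hS, hSc, h⟩ := exists_independent hσ (fun i => T i j) (Finset.range (leftSize σ))
      (by rw [Finset.card_range]; rfl) fun i hi => hTσ i j (Finset.mem_range.1 hi) hj.1 hj.2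
    exact ⟨S, Finset.mem_powersetCard.2 ⟨hS, hSc⟩, h⟩
  choose! S hSm hS using hind
  have hle : σ ≤ leftSize σ := by
    have hpos : ∀ n, σ ≤ multiRamseyBound (σ + 1) σ n := fun n => by
      induction n with
      | zero => exact le_rfl
      | succ n ih =>
        change σ ≤ (2 * multiRamseyBound (σ + 1) σ n) ^ (σ + 1)
        have := Nat.le_self_pow (Nat.succ_ne_zero σ) (2 * multiRamseyBound (σ + 1) σ n)
        lia
    exact hpos 2
  obtain ⟨X, hX, J, hJ, hJX, hJc⟩ := exists_fiber hSm
    (Finset.powersetCard_nonempty.2 (by rwa [Finset.card_range]))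
  rw [Finset.mem_powersetCard] at hX
  rw [Nat.card_Ico, Finset.card_powersetCard, Finset.card_range, hm, Nat.add_sub_cancel_left]
    at hJc
  have hJσ : σ ≤ J.card := by
    have h1 := hJc.trans (Nat.mul_le_mul_right _ (Nat.choose_le_pow _ _))
    exact Nat.le_of_mul_le_mul_left h1 (Nat.pow_pos (by lia))
  obtain ⟨Y, hYJ, hYc⟩ := Finset.exists_subset_card_eq hJσ
  obtain ⟨x, hxX, hx⟩ := exists_enum X hX.2
  obtain ⟨y, hyY, hy⟩ := exists_enum Y hYc
  have hxl : ∀ a < σ, x a < leftSize σ := fun a ha => Finset.mem_range.1 (hX.1 (hxX a ha))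
  have hyl : ∀ a < σ, leftSize σ ≤ y a ∧ y a < m := fun a ha =>
    Finset.mem_Ico.1 (hJ (hYJ (hyY a ha)))
  let F' : Fin σ × Fin σ → ℕ → Set V := fun e k => F (x e.1) (y e.2) (ρ (x e.1) (y e.2) k)
  have hρm' : ∀ e : Fin σ × Fin σ, ∀ k < transversalSize σ,
      ρ (x e.1) (y e.2) k < multiplicity σ := fun e k hk =>
    hρm _ _ (hxl _ e.1.2) (hyl _ e.2.2).1 (hyl _ e.2.2).2 k hk
  have hF' : ∀ e : Fin σ × Fin σ, ∀ k < transversalSize σ, Conn G (F' e k) ∧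
      Touch G {b (x e.1)} (F' e k) ∧ Touch G (F' e k) {b (y e.2)} ∧ ∀ l < m, b l ∉ F' e k :=
    fun e k hk => hF _ _ (hxl _ e.1.2) (hyl _ e.2.2).1 (hyl _ e.2.2).2 _ (hρm' e k hk)
  obtain ⟨κ, hκ, hanti⟩ := exists_transversal hσ hb F' (fun e k hk => (hF' e k hk).1)
    (fun e k hk l hl hkl => hself _ _ (hxl _ e.1.2) (hyl _ e.2.2).1 (hyl _ e.2.2).2 _
      (hρm' e k hk) _ (hρm' e l hl) fun h =>
        hkl (hρ _ _ (hxl _ e.1.2) (hyl _ e.2.2).1 (hyl _ e.2.2).2 k hk l hl h))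
    (fun e e' hee k hk l hl => hdisj _ _ (hxl _ e.1.2) (hyl _ e.2.2).1 (hyl _ e.2.2).2 _ _
      (hxl _ e'.1.2) (hyl _ e'.2.2).1 (hyl _ e'.2.2).2 (fun h => hee (by
        rw [Prod.mk.injEq] at h
        exact Prod.ext (Fin.ext (hx _ e.1.2 _ e'.1.2 h.1)) (Fin.ext (hy _ e.2.2 _ e'.2.2 h.2))))
      _ (hρm' e k hk) _ (hρm' e' l hl))
  have hxm : ∀ a : Fin σ, x a < m := fun a => by
    have := hxl a a.2
    lia
  have hbx : ∀ a a' : Fin σ, a ≠ a' → Anticomplete G {b (x a)} {b (x a')} := fun a a' haa =>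
    anticomplete_singleton.2 (hbinj _ (hxm a) _ (hxm a') fun h =>
      haa (Fin.ext (hx _ a.2 _ a'.2 h)))
  have hbF : ∀ a : Fin σ, ∀ e : Fin σ × Fin σ, a ≠ e.1 →
      Anticomplete G {b (x a)} (F' e (κ e)) := by
    intro a e hae
    have hne : x a ≠ x e.1 := fun h => hae (Fin.ext (hx _ a.2 _ e.1.2 h))
    refine anticomplete_iff.2 ⟨Set.disjoint_singleton_left.2
      ((hF' e _ (hκ e)).2.2.2 _ (hxm a)), ?_⟩
    refine hTt _ _ (hxl _ e.1.2) (hyl _ e.2.2).1 (hyl _ e.2.2).2 _ (hκ e) _ (hxl _ a.2) hne ?_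
    have hyJ := hYJ (hyY _ e.2.2)
    have := hS _ (hJ hyJ) (x e.1) (by rw [hJX _ hyJ]; exact hxX _ e.1.2) (x a)
      (by rw [hJX _ hyJ]; exact hxX _ a.2) hne.symm
    exact this
  -- Each left vertex absorbs its `σ` paths. Contacts of a path with other right vertices need no
  -- control, because all left-right pairs are adjacent in `K_{σ,σ}`.
  refine hb (fun a => {b (x a)} ∪ ⋃ c : Fin σ, F' (a, c) (κ (a, c))) (fun c => {b (y c)})
    (fun a => (conn_singleton _).union_iUnion fun c => (conn_singleton _).union_of_touch
      (hF' (a, c) _ (hκ _)).1 (hF' (a, c) _ (hκ _)).2.1) (fun _ => conn_singleton _)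
    (fun a a' haa => ?_) (fun c c' hcc => ?_) (fun a c => ?_) (fun a c => ?_)
  · have hU : ∀ (a : Fin σ) (Z : Set V), Anticomplete G {b (x a)} Z →
        (∀ c : Fin σ, Anticomplete G (F' (a, c) (κ (a, c))) Z) →
        Anticomplete G ({b (x a)} ∪ ⋃ c : Fin σ, F' (a, c) (κ (a, c))) Z := by
      intro a Z h1 h2
      have := h1.union_left (Anticomplete.biUnion_left (J := Finset.univ) fun c _ => h2 c)
      simpa using this
    refine hU _ _ (hU _ _ (hbx a a' haa).symm fun c => (hbF a (a', c) haa).symm).symm fun c =>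
      (hU _ _ (hbF a' (a, c) haa.symm) fun c' => hanti _ _ fun h => ?_).symm
    exact haa (congrArg Prod.fst h).symm
  · refine anticomplete_singleton.2 (hbinj _ (hyl _ c.2).2 _ (hyl _ c'.2).2 fun h => ?_)
    exact hcc (Fin.ext (hy _ c.2 _ c'.2 h))
  · rw [Set.disjoint_singleton_right]
    rintro (h | h)
    · have h1 := hxl _ a.2
      have h2 := hyl _ c.2
      exact (hbinj _ h2.2 _ (hxm a) (by lia)).1 h
    · obtain ⟨c', hc'⟩ := Set.mem_iUnion.1 h
      exact (hF' (a, c') _ (hκ _)).2.2.2 _ (hyl _ c.2).2 hc'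
  · exact (hF' (a, c) _ (hκ _)).2.2.1.mono
      ((Set.subset_iUnion (fun c : Fin σ => F' (a, c) (κ (a, c))) c).trans
        Set.subset_union_right) subset_rfl

/-! ### Paths of a block -/

/-- The row is the interior of the path; it is nonempty because the ends are distinct and
nonadjacent. -/
theorem IsPathFromTo.exists_row {x y : V} {P : G.Subgraph} (h : IsPathFromTo G x y P)
    (hxy : x ≠ y) (hadj : ¬ G.Adj x y) :
    ∃ (z : ℕ → V) (n : ℕ), (∀ a b, a ≤ n → b ≤ n → z a = z b → a = b) ∧
      (∀ a b, a ≤ n → b ≤ n → (G.Adj (z a) (z b) ↔ a + 1 = b ∨ b + 1 = a)) ∧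
      G.Adj x (z 0) ∧ G.Adj (z n) y ∧ (∀ a, 1 ≤ a → a ≤ n → ¬ G.Adj x (z a)) ∧
      ∀ a ≤ n, z a ∈ P.verts \ {x, y} := by
  obtain ⟨hind, p, hp, rfl⟩ := h
  have hinj : ∀ a b, a ≤ p.length → b ≤ p.length → p.getVert a = p.getVert b → a = b :=
    fun a b ha hb hab => hp.getVert_injOn ha hb hab
  have hiff : ∀ a b, a ≤ p.length → b ≤ p.length →
      (G.Adj (p.getVert a) (p.getVert b) ↔ a + 1 = b ∨ b + 1 = a) := by
    intro a b ha hb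
    constructor
    · intro hab
      have := hind (p.mem_verts_toSubgraph.2 (p.getVert_mem_support a))
        (p.mem_verts_toSubgraph.2 (p.getVert_mem_support b)) hab
      rw [SimpleGraph.Walk.toSubgraph_adj_iff] at this
      obtain ⟨i, hi, hil⟩ := this
      rw [Sym2.eq_iff] at hi
      rcases hi with ⟨h1, h2⟩ | ⟨h1, h2⟩
      · have h3 := hinj _ _ (by lia) ha h1
        have h4 := hinj _ _ (by lia) hb h2
        lia
      · have h3 := hinj _ _ (by lia) hb h1
        have h4 := hinj _ _ (by lia) ha h2
        lia
    · rintro (rfl | rfl)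
      · exact p.adj_getVert_succ (by lia)
      · exact (p.adj_getVert_succ (by lia)).symm
  have hlen : 2 ≤ p.length := by
    by_contra hlt
    have h01 : p.length = 0 ∨ p.length = 1 := by lia
    rcases h01 with h0 | h1
    · exact hxy (SimpleGraph.Walk.eq_of_length_eq_zero h0)
    · exact hadj (SimpleGraph.Walk.adj_of_length_eq_one h1)
  refine ⟨fun a => p.getVert (a + 1), p.length - 2, fun a b ha hb hab => ?_, fun a b ha hb => ?_,
    ?_, ?_, fun a h1 ha => ?_, fun a ha => ⟨?_, ?_⟩⟩
  · have := hinj _ _ (by lia) (by lia) hab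
    lia
  · rw [hiff _ _ (by lia) (by lia)]
    lia
  · have := (hiff 0 1 (by lia) (by lia)).2 (Or.inl rfl)
    rwa [p.getVert_zero] at this
  · have := (hiff (p.length - 2 + 1) p.length (by lia) le_rfl).2 (Or.inl (by lia))
    rwa [p.getVert_length] at this
  · have := hiff 0 (a + 1) (by lia) (by lia)
    rw [p.getVert_zero] at this
    rw [this]
    lia
  · exact p.mem_verts_toSubgraph.2 (p.getVert_mem_support _)
  · rintro (h | h)
    · have := hinj (a + 1) 0 (by lia) (by lia) (by rw [p.getVert_zero]; exact h)
      lia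
    · have := hinj (a + 1) p.length (by lia) le_rfl (by rw [p.getVert_length]; exact h)
      lia

/-- Many internally disjoint paths between two nonadjacent vertices contain many paths with
pairwise anticomplete interiors, or a binary tree model. -/
theorem exists_anticomplete_interiors {σ ρ u t N : ℕ} {f : ℕ → ℕ} (hG : GrowsWith.{w} σ ρ ρ f u)
    (ht : 2 ≤ t) (hcf : G.CliqueFree t) (hb : NoBiclique G σ)
    (htree : ¬ HasInducedMinor G (binTree ρ)) (hN : 1 ≤ N) {x y : V} (hxy : x ≠ y)
    (hadj : ¬ G.Adj x y) (S : Set G.Subgraph) (hS : ∀ P ∈ S, IsPathFromTo G x y P)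
    (hdisj : ∀ P ∈ S, ∀ Q ∈ S, P ≠ Q → Disjoint (P.verts \ {x, y}) (Q.verts \ {x, y}))
    (hcard : (tailBound σ (f t + 1) t N : ℕ∞) ≤ S.encard) :
    ∃ F : ℕ → Set V, ∀ k < N, Conn G (F k) ∧ Touch G {x} (F k) ∧ Touch G (F k) {y} ∧
      F k ⊆ pathVerts S \ {x, y} ∧ ∀ l < N, k ≠ l → Anticomplete G (F k) (F l) := by
  obtain ⟨S', hS', hS'c⟩ := Set.exists_subset_encard_eq hcard
  have hfin : S'.Finite := Set.finite_of_encard_eq_coe hS'c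
  have hc : hfin.toFinset.card = tailBound σ (f t + 1) t N := by
    rw [hfin.encard_eq_coe_toFinset_card] at hS'c
    exact_mod_cast hS'c
  set n := tailBound σ (f t + 1) t N with hn
  have hn0 : 0 < n := by
    rw [hn]
    unfold tailBound ehBound
    lia
  let P : ℕ → G.Subgraph := fun j =>
    (hfin.toFinset.equivFinOfCardEq hc).symm ⟨j % n, Nat.mod_lt _ hn0⟩
  have hPS : ∀ j, P j ∈ S := fun j => hS' (hfin.mem_toFinset.1 (Subtype.prop _))
  have hPinj : ∀ i < n, ∀ j < n, i ≠ j → P i ≠ P j := by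
    intro i hi j hj hij h
    have := (hfin.toFinset.equivFinOfCardEq hc).symm.injective (Subtype.ext h)
    rw [Fin.mk.injEq, Nat.mod_eq_of_lt hi, Nat.mod_eq_of_lt hj] at this
    exact hij this
  choose z len hinj hiff hx0 hy0 hxa hmem using fun j => (hS _ (hPS j)).exists_row hxy hadj
  have hrows : Rows G (Finset.range n) z len := by
    refine ⟨fun i hi j hj a b ha hb hab => ?_, fun i _ => hiff i⟩
    by_cases hij : i = j
    · subst hij
      exact ⟨rfl, hinj i a b ha hb hab⟩
    · exact absurd (hmem j b hb) (Set.disjoint_left.1 (hdisj _ (hPS i) _ (hPS j)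
        (hPinj i (Finset.mem_range.1 hi) j (Finset.mem_range.1 hj) hij)) (hab ▸ hmem i a ha))
  obtain ⟨K, hK, hKc, hanti⟩ := exists_anticomplete_insert hb hcf (by lia)
    (by lia : 1 ≤ f t + 1) hN (fun j => seg z j 1 (len j)) (fun j => z j 0) (Finset.range n)
    (by rw [Finset.card_range]) (fun i hi => by
      rcases Nat.eq_zero_or_pos (len i) with h0 | h0
      · exact Or.inl (seg_eq_empty (by lia))
      · exact Or.inr (hrows.conn hi h0 le_rfl))
    (fun i hi j hj hij => by
      rw [← seg_zero, ← seg_zero]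
      exact hrows.disjoint hi hj hij le_rfl le_rfl)
    (by
      -- Pairwise touching tails form a state centred at `{x}`, and both of its outcomes contain the
      -- excluded tree.
      rintro ⟨Q, hQ, hQc, hQt⟩
      have hst : IsState G {x} Q z len := ⟨hrows.mono hQ fun _ _ => le_rfl, conn_singleton x,
        fun i _ a ha h => (hmem i a ha).2 (Or.inl h), fun i _ => touch_singleton.2 (hx0 i),
        fun i _ a h1 ha h => hxa i a h1 ha (touch_singleton.1 h), hQt⟩
      rcases hG t ht V G hcf hb _ Q z len hst (by lia) with
        ⟨R, S, J, _, _, hFT, _⟩ | ⟨R, S, J, _, _, hFT, _⟩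
      · exact htree hFT.hasInducedMinor
      · exact htree hFT.hasInducedMinor)
  obtain ⟨ρ, hρK, hρ⟩ := exists_enum K hKc
  refine ⟨fun k => seg z (ρ k) 0 (len (ρ k)), fun k hk =>
    ⟨hrows.conn (hK (hρK k hk)) (by lia) le_rfl, ?_, ?_, ?_, fun l hl hkl => ?_⟩⟩
  · exact ⟨x, rfl, _, mem_seg le_rfl (by lia), hx0 _⟩
  · exact ⟨_, mem_seg (by lia) le_rfl, y, rfl, hy0 _⟩
  · rintro _ ⟨a, _, ha, rfl⟩
    exact ⟨Set.mem_biUnion (hPS _) (hmem _ a ha).1, (hmem _ a ha).2⟩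
  · change Anticomplete G (seg z (ρ k) 0 _) (seg z (ρ l) 0 _)
    rw [seg_zero, seg_zero]
    exact hanti _ (hρK k hk) _ (hρK l hl) fun h => hkl (hρ k hk l hl h)

end PolySep

/-! ### Proof of the theorem -/

theorem mainTheorem7 :
    ∀ σ : ℕ, 1 ≤ σ → ∃ c : ℕ, 1 ≤ c ∧
      ∀ ρ : ℕ, 1 ≤ ρ → ∃ d : ℕ,
        ∀ t : ℕ, 1 ≤ t →
          ∀ (V : Type*) [Finite V] (G : SimpleGraph V),
            G.CliqueFree t →
            ¬ PolySep.HasInducedMinor G (PolySep.binTree ρ) →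
            ¬ PolySep.HasInducedMinor G (completeBipartiteGraph (Fin σ) (Fin σ)) →
            PolySep.IsPairSeparable G c (t ^ d) := by
  intro σ hσ
  have hl1 : 1 ≤ PolySep.leftSize σ := PolySep.one_le_multiRamseyBound hσ 2
  refine ⟨PolySep.leftSize σ + PolySep.rightSize σ, by lia, fun ρ _ => ?_⟩
  obtain ⟨f, u, hf, hG⟩ := PolySep.grows hσ ρ
  have hN : 1 ≤ PolySep.multiplicity σ :=
    Nat.mul_pos (by positivity) (by lia)
  obtain ⟨d, hd⟩ := PolySep.Poly.tailBound σ (hf.add (PolySep.Poly.const 1))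
    (PolySep.Poly.const (PolySep.multiplicity σ))
  refine ⟨d, fun t ht1 V _ G hcf htree hbic => ?_⟩
  rintro ⟨B, 𝓟, hB, hstrong, hstable⟩
  obtain ⟨b, hbB, hbinj⟩ : ∃ b : ℕ → V,
      (∀ i < PolySep.leftSize σ + PolySep.rightSize σ, b i ∈ B) ∧
      ∀ i < PolySep.leftSize σ + PolySep.rightSize σ,
        ∀ j < PolySep.leftSize σ + PolySep.rightSize σ, i ≠ j → b i ≠ b j := by
    obtain ⟨B', hB', hB'c⟩ := Set.exists_subset_encard_eq hB.le_card
    have hfin : B'.Finite := Set.finite_of_encard_eq_coe hB'c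
    have hc : hfin.toFinset.card = PolySep.leftSize σ + PolySep.rightSize σ := by
      rw [hfin.encard_eq_coe_toFinset_card] at hB'c
      exact_mod_cast hB'c
    refine ⟨fun j => (hfin.toFinset.equivFinOfCardEq hc).symm
      ⟨j % (PolySep.leftSize σ + PolySep.rightSize σ), Nat.mod_lt _ (by lia)⟩,
      fun j _ => hB' (hfin.mem_toFinset.1 (Subtype.prop _)), fun i hi j hj hij h => ?_⟩
    have := (hfin.toFinset.equivFinOfCardEq hc).symm.injective (Subtype.ext h)
    rw [Fin.mk.injEq, Nat.mod_eq_of_lt hi, Nat.mod_eq_of_lt hj] at this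
    exact hij this
  -- Polynomial bounds hold for `t ≥ 2` only; for `t = 1` the graph has no vertex, whereas the block
  -- has one.
  have ht : 2 ≤ t := by
    by_contra hlt
    have h1 : t = 1 := by lia
    subst h1
    exact hcf {b 0} ⟨by simp, by simp⟩
  have hnb := PolySep.noBiclique_of_not_hasInducedMinor hbic
  set m := PolySep.leftSize σ + PolySep.rightSize σ with hm
  have hnadj : ∀ i < m, ∀ j < m, i ≠ j → ¬ G.Adj (b i) (b j) := fun i hi j hj hij =>
    hstable (hbB i hi) (hbB j hj) (hbinj i hi j hj hij)
  have hpair : ∀ i j, i < PolySep.leftSize σ → PolySep.leftSize σ ≤ j → j < m →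
      ∃ F : ℕ → Set V, ∀ k < PolySep.multiplicity σ, PolySep.Conn G (F k) ∧
        PolySep.Touch G {b i} (F k) ∧ PolySep.Touch G (F k) {b j} ∧
        F k ⊆ PolySep.pathVerts (𝓟 s(b i, b j)) \ {b i, b j} ∧
        ∀ l < PolySep.multiplicity σ, k ≠ l → PolySep.Anticomplete G (F k) (F l) := by
    intro i j hi hj hjm
    have hij := hbinj i (by lia) j hjm (by lia)
    have hiB := hbB i (by lia)
    have hjB := hbB j hjm
    refine PolySep.exists_anticomplete_interiors hG ht hcf hnb htree hN hij
      (hnadj i (by lia) j hjm (by lia)) _ (hB.isPath _ hiB _ hjB hij)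
      (hB.internally_disjoint _ hiB _ hjB hij) (le_trans ?_ (hB.le_card_paths _ hiB _ hjB hij))
    exact_mod_cast hd t ht
  choose! F hF using hpair
  -- Since `t ^ d` is positive, every pair has a path, so each vertex of `B` lies in the systems of
  -- all its pairs. Strongness then keeps it out of the interiors of paths between two other
  -- vertices of `B`.
  have hends : ∀ i < m, ∀ j < m, i ≠ j → b i ∈ PolySep.pathVerts (𝓟 s(b i, b j)) := by
    intro i hi j hj hij
    have hc := hB.le_card_paths _ (hbB i hi) _ (hbB j hj) (hbinj i hi j hj hij)
    have hpos : 0 < t ^ d := Nat.pow_pos (by lia)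
    obtain ⟨P, hP⟩ : (𝓟 s(b i, b j)).Nonempty := by
      rw [← Set.encard_pos]
      exact lt_of_lt_of_le (by exact_mod_cast hpos) hc
    obtain ⟨_, p, _, rfl⟩ := hB.isPath _ (hbB i hi) _ (hbB j hj) (hbinj i hi j hj hij) P hP
    exact Set.mem_biUnion hP (p.mem_verts_toSubgraph.2 p.start_mem_support)
  refine hnb.not_many_paths hσ b F hm
    (fun i hi j hj hij => ⟨hbinj i hi j hj hij, hnadj i hi j hj hij⟩)
    (fun i j hi hj hjm k hk => ?_) (fun i j hi hj hjm k hk => (hF i j hi hj hjm k hk).2.2.2.2)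
    (fun i j hi hj hjm i' j' hi' hj' hjm' hne k hk l hl => ?_)
  · obtain ⟨h1, h2, h3, h4, -⟩ := hF i j hi hj hjm k hk
    refine ⟨h1, h2, h3, fun l hl hlF => ?_⟩
    have hlP := h4 hlF
    have hli : l ≠ i := by
      rintro rfl
      exact hlP.2 (Or.inl rfl)
    have hlj : l ≠ j := by
      rintro rfl
      exact hlP.2 (Or.inr rfl)
    have hbl := hbinj l hl i (by lia) hli
    have hbl' := hbinj l hl j hjm hlj
    have := hstrong _ (hbB i (by lia)) _ (hbB j hjm) _ (hbB l hl) _ (hbB i (by lia))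
      (hbinj i (by lia) j hjm (by lia)) hbl (by
        rw [Ne, Sym2.eq_iff]
        rintro (⟨h, -⟩ | ⟨-, h⟩)
        · exact hbl h.symm
        · exact hbl' h.symm)
    have hmem : b l ∈ ({b i, b j} : Set V) ∩ {b l, b i} :=
      this ▸ ⟨hlP.1, hends l hl i (by lia) hli⟩
    exact hlP.2 hmem.1
  · have h4 := (hF i j hi hj hjm k hk).2.2.2.1
    have h4' := (hF i' j' hi' hj' hjm' l hl).2.2.2.1
    rw [Set.disjoint_left]
    intro v hv hv'
    have hs : s(b i, b j) ≠ s(b i', b j') := by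
      have hinj : ∀ p < m, ∀ q < m, b p = b q → p = q := fun p hp q hq h => by
        by_contra hpq
        exact hbinj p hp q hq hpq h
      rw [Ne, Sym2.eq_iff]
      rintro (⟨h1, h2⟩ | ⟨h1, h2⟩)
      · exact hne (Prod.ext (hinj _ (by lia) _ (by lia) h1) (hinj _ hjm _ hjm' h2))
      · have := hinj _ (by lia) _ hjm' h1
        lia
    have := hstrong _ (hbB i (by lia)) _ (hbB j hjm) _ (hbB i' (by lia)) _ (hbB j' hjm')
      (hbinj i (by lia) j hjm (by lia)) (hbinj i' (by lia) j' hjm' (by lia)) hs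
    have hmem : v ∈ ({b i, b j} : Set V) ∩ {b i', b j'} := this ▸ ⟨(h4 hv).1, (h4' hv').1⟩
    exact (h4 hv).2 hmem.1
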